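/- Throughout, $\tau=u+iv\in\mathbb H$ ($u,v\in\mathbb R$, $v>0$), $q=e^{2\pi i\tau}$, complex powers are principal, $\eta(\tau)=q^{1/24}\prod_{n\ge1}(1-q^n)$, $E_2(\tau)=1-24\sum_{n\ge1}\sigma_1(n)q^n$, and $\psi$ is the multiplier of $\eta$, i.e. the function on $\mathrm{SL}_2(\mathbb Z)$ with $\eta\left(\frac{a\tau+b}{c\tau+d}\right)=\psi\left(\begin{smallmatrix}a&b\\c&d\end{smallmatrix}\right)(c\tau+d)^{1/2}\eta(\tau)$ for all $\tau\in\mathbb H$. Let $N(m,n)$ be the number of partitions of $n$ of rank $m$, where the rank of a partition is its largest part minus the number of its parts (the empty partition has rank $0$), and let $R_2(q)=\sum_{n\ge0}\left(\sum_{m\in\mathbb Z}m^2N(m,n)\right)q^n$. Define $$\mathcal R(\tau)=\tfrac12R_2(q^{24})q^{-1},\qquad \mathcal N(\tau)=\frac{i}{4\sqrt2\,\pi}\int_{-\overline\tau}^{i\infty}\frac{\eta(24w)}{(-i(\tau+w))^{3/2}}\,dw,$$ $$\mathcal M(\tau)=\mathcal R(\tau)+\mathcal N(\tau)-\frac1{24\eta(24\tau)}+\frac{E_2(24\tau)}{8\eta(24\tau)},$$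 the integral being taken along the vertical ray from $-\overline\tau$. **Corollary.** The function $\widehat M(\tau):=\mathcal M(\tau/24)$ is a harmonic Maass form of weight $\frac32$ on $\mathrm{SL}_2(\mathbb Z)$ with multiplier $\psi^{-1}$. That is: 1. $\widehat M:\mathbb H\to\mathbb C$ is smooth, and for all $\left(\begin{smallmatrix}a&b\\c&d\end{smallmatrix}\right)\in\mathrm{SL}_2(\mathbb Z)$ and $\tau\in\mathbb H$ $$\widehat M\left(\frac{a\tau+b}{c\tau+d}\right)=\psi^{-1}\begin{pmatrix}a&b\\c&d\end{pmatrix}(c\tau+d)^{3/2}\,\widehat M(\tau).$$ 2. $\Delta_{3/2}\widehat M=0$, where $\Delta_k=-v^2\left(\frac{\partial^2}{\partial u^2}+\frac{\partial^2}{\partial v^2}\right)+ikv\left(\frac{\partial}{\partial u}+i\frac{\partial}{\partial v}\right)$. 3. For every $\gamma=\left(\begin{smallmatrix}a&b\\c&d\end{smallmatrix}\right)\in\mathrm{SL}_2(\mathbb Z)$ there are an integer $N\ge1$, a polynomial $P\in\mathbb C[X]$ and $\varepsilon>0$ such that $(c\tau+d)^{-3/2}\,\widehat M(\gamma\tau)-P(q^{-1/N})=O(e^{-\varepsilon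 v})$ as $v\to\infty$, uniformly in $u$, where $q^{-1/N}:=e^{-2\pi i\tau/N}$. -/

import Mathlib

open scoped MatrixGroups ContDiff
open UpperHalfPlane

noncomputable section

namespace RankForms

/-! ### Partition ranks and their moments -/

/-- Dyson's rank of a partition: its largest part minus the number of its parts. The empty
partition has rank `0`. -/
def partitionRank {n : ℕ} (p : n.Partition) : ℤ :=
  (p.parts.sup : ℤ) - (Multiset.card p.parts : ℤ)

/-- `N(m, n)`, the number of partitions of `n` with rank `m`. -/
def rankCount (m : ℤ) (n : ℕ) : ℕ :=
  (Finset.univ.filter fun p : n.Partition => partitionRank p = m).card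

/-- The `k`-th rank moment `∑_{m ∈ ℤ} m ^ k N(m, n)`, a sum with finitely many nonzero terms. -/
def rankMoment (k n : ℕ) : ℤ :=
  ∑ᶠ m : ℤ, m ^ k * (rankCount m n : ℤ)

/-- The sum defining the rank moment is a finite one, and it is the sum of the `k`-th powers of the
ranks of all the partitions of `n`. -/
theorem rankMoment_eq_sum (k n : ℕ) :
    rankMoment k n = ∑ p : n.Partition, partitionRank p ^ k := by
  classical
  have hsupp : (Function.support fun m : ℤ => m ^ k * (rankCount m n : ℤ)) ⊆
      (Finset.univ.image fun p : n.Partition => partitionRank p : Finset ℤ) := by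
    intro m hm
    by_contra h
    apply hm
    have h0 : rankCount m n = 0 := by
      rw [rankCount, Finset.card_eq_zero, Finset.filter_eq_empty_iff]
      intro p _ hp
      exact h (by simpa using ⟨p, hp⟩)
    simp [h0]
  rw [rankMoment, finsum_eq_sum_of_support_subset _ hsupp,
    ← Finset.sum_fiberwise_of_maps_to
      (fun p _ => Finset.mem_image_of_mem (fun p : n.Partition => partitionRank p)
        (Finset.mem_univ p))]
  refine Finset.sum_congr rfl fun m _ => ?_
  rw [Finset.sum_congr rfl (g := fun _ => m ^ k)
    (fun p hp => by rw [(Finset.mem_filter.mp hp).2])]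
  rw [Finset.sum_const, rankCount, nsmul_eq_mul, mul_comm]

/-- The generating function `∑_{n ≥ 0} (∑_{m ∈ ℤ} m ^ k N(m, n)) q ^ n` of the `k`-th rank
moments. -/
def rankMomentSeries (k : ℕ) (q : ℂ) : ℂ :=
  ∑' n : ℕ, (rankMoment k n : ℂ) * q ^ n

/-! ### The function `M` and its rescaling -/

/-- `24 τ` as a point of the upper half-plane. -/
def mul24 (τ : ℍ) : ℍ :=
  (⟨24, by norm_num⟩ : {x : ℝ // 0 < x}) • τ

/-- `τ / 24` as a point of the upper half-plane. -/
def div24 (τ : ℍ) : ℍ :=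
  (⟨1 / 24, by norm_num⟩ : {x : ℝ // 0 < x}) • τ

/-- The second rank moment part `R(τ) = (1/2) R₂(q ^ 24) q⁻¹` with `q = exp (2 π i τ)`, where `R₂` is
the generating function of the second rank moments. -/
def rankPart (τ : ℍ) : ℂ :=
  1 / 2 * rankMomentSeries 2 (Complex.exp (2 * Real.pi * Complex.I * τ) ^ 24) *
    (Complex.exp (2 * Real.pi * Complex.I * τ))⁻¹

/-- The non-holomorphic Eichler type integral
`N(τ) = i / (4 √2 π) ∫_{-conj τ}^{i∞} η(24 w) (-i (τ + w)) ^ (-3/2) dw`, taken along the vertical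
ray `w = -conj τ + i t`, `t > 0`, so that `dw = i dt`. On this ray `-i (τ + w) = 2 Im τ + t` is
positive. -/
def eichlerPart (τ : ℍ) : ℂ :=
  Complex.I / (4 * (Real.sqrt 2 : ℂ) * Real.pi) *
    ∫ t in Set.Ioi (0 : ℝ),
      ModularForm.eta (24 * (-(starRingEnd ℂ) (τ : ℂ) + Complex.I * t)) /
          (-Complex.I * ((τ : ℂ) + (-(starRingEnd ℂ) (τ : ℂ) + Complex.I * t))) ^ (3 / 2 : ℂ) *
        Complex.I

/-- `M(τ) = R(τ) + N(τ) - 1 / (24 η(24 τ)) + E₂(24 τ) / (8 η(24 τ))`. -/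
def rankM (τ : ℍ) : ℂ :=
  rankPart τ + eichlerPart τ - 1 / (24 * ModularForm.eta (mul24 τ)) +
    EisensteinSeries.E2 (mul24 τ) / (8 * ModularForm.eta (mul24 τ))

/-- The rescaled function `τ ↦ M(τ / 24)`. -/
def rankMHat (τ : ℍ) : ℂ :=
  rankM (div24 τ)

/-! ### The multiplier of the Dedekind eta function -/

/-- The automorphy factor `c τ + d`. -/
def autFactor (γ : SL(2, ℤ)) (τ : ℍ) : ℂ :=
  (γ 1 0 : ℂ) * (τ : ℂ) + (γ 1 1 : ℂ)

/-- The multiplier `ψ` of the Dedekind eta function, that is the function on `SL₂(ℤ)` with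
`η(γ τ) = ψ(γ) (c τ + d) ^ (1/2) η(τ)` for all `τ` (principal branch). It is read off at the point
`τ = i`; the theorem `eta_smul` below shows that every other point gives the same value. -/
def etaMultiplier (γ : SL(2, ℤ)) : ℂ :=
  ModularForm.eta (γ • UpperHalfPlane.I : ℍ) /
    (autFactor γ UpperHalfPlane.I ^ (1 / 2 : ℂ) * ModularForm.eta UpperHalfPlane.I)

theorem autFactor_ne_zero (γ : SL(2, ℤ)) (τ : ℍ) : autFactor γ τ ≠ 0 := by
  simpa [autFactor, denom] using denom_ne_zero (γ : GL (Fin 2) ℝ) τ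

theorem continuous_autFactor_sqrt (γ : SL(2, ℤ)) :
    Continuous fun τ : ℍ => autFactor γ τ ^ (1 / 2 : ℂ) := by
  by_cases hc : γ 1 0 = 0
  · simp only [autFactor, hc, Int.cast_zero, zero_mul, zero_add]
    exact continuous_const
  · refine Continuous.cpow ?_ continuous_const fun τ => Or.inr ?_
    · unfold autFactor
      fun_prop
    · simpa [autFactor] using ⟨hc, τ.im_pos.ne'⟩

theorem eta_smul_pow (γ : SL(2, ℤ)) (τ : ℍ) :
    ModularForm.eta (γ • τ : ℍ) ^ 24 = autFactor γ τ ^ 12 * ModularForm.eta τ ^ 24 := by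
  have h := congrFun (SlashInvariantForm.slash_action_generators_SL2Z
    ModularForm.discriminant_S_invariant ModularForm.discriminant_T_invariant γ) τ
  rw [ModularForm.SL_slash_apply] at h
  have hd : denom γ τ = autFactor γ τ := by simp [autFactor, denom]
  rw [hd, zpow_neg, ← div_eq_mul_inv, div_eq_iff (zpow_ne_zero _ (autFactor_ne_zero γ τ))] at h
  simp only [ModularForm.discriminant] at h
  rw [h, mul_comm]
  norm_cast

/-- The transformation law of the Dedekind eta function under `SL₂(ℤ)`. -/
theorem eta_smul (γ : SL(2, ℤ)) (τ : ℍ) :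
    ModularForm.eta (γ • τ : ℍ) =
      etaMultiplier γ * autFactor γ τ ^ (1 / 2 : ℂ) * ModularForm.eta τ := by
  have hη : ∀ τ : ℍ, ModularForm.eta τ ≠ 0 := fun τ => ModularForm.eta_ne_zero τ.im_pos
  have hsq : ∀ τ : ℍ, autFactor γ τ ^ (1 / 2 : ℂ) ≠ 0 := fun τ => by
    simp [Complex.cpow_eq_zero_iff, autFactor_ne_zero]
  have hcη : Continuous fun τ : ℍ => ModularForm.eta τ :=
    continuous_iff_continuousAt.mpr fun τ =>
      ContinuousAt.comp (f := fun τ : ℍ => (τ : ℂ))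
        (ModularForm.differentiableAt_eta_of_mem_upperHalfPlaneSet τ.im_pos).continuousAt
        continuous_coe.continuousAt
  set F : ℍ → ℂ := fun τ => ModularForm.eta (γ • τ : ℍ) /
    (autFactor γ τ ^ (1 / 2 : ℂ) * ModularForm.eta τ) with hF
  have hFc : Continuous F :=
    (hcη.comp (continuous_const_smul (γ : GL (Fin 2) ℝ))).div ((continuous_autFactor_sqrt γ).mul hcη)
      fun τ => mul_ne_zero (hsq τ) (hη τ)
  have hpow : ∀ τ, F τ ^ 24 = 1 := fun τ => by
    have h1 : (autFactor γ τ ^ (1 / 2 : ℂ)) ^ 24 = autFactor γ τ ^ 12 := by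
      rw [← Complex.cpow_nat_mul, ← Complex.cpow_natCast]
      norm_num
    rw [hF, div_pow, mul_pow, h1, eta_smul_pow]
    exact div_self (mul_ne_zero (pow_ne_zero _ (autFactor_ne_zero γ τ)) (pow_ne_zero _ (hη τ)))
  have hfin : Set.Finite {z : ℂ | z ^ 24 = 1} := by
    refine (Polynomial.nthRoots 24 (1 : ℂ)).toFinset.finite_toSet.subset fun z hz => ?_
    simpa [Polynomial.mem_nthRoots] using hz
  have hdisc : IsDiscrete {z : ℂ | z ^ 24 = 1} := hfin.isDiscrete
  have hconst : F τ = F UpperHalfPlane.I :=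
    isPreconnected_univ.constant_of_mapsTo hdisc hFc.continuousOn
      (fun τ _ => hpow τ) (Set.mem_univ _) (Set.mem_univ _)
  have : etaMultiplier γ = F τ := hconst.symm
  rw [this, mul_assoc]
  exact (div_mul_cancel₀ _ (mul_ne_zero (hsq τ) (hη τ))).symm

/-! ### Harmonic Maass forms -/

/-- The partial derivative `∂G/∂u` with respect to the real part of `z = u + i v`. -/
def partialU (G : ℂ → ℂ) (z : ℂ) : ℂ :=
  fderiv ℝ G z 1

/-- The partial derivative `∂G/∂v` with respect to the imaginary part of `z = u + i v`. -/
def partialV (G : ℂ → ℂ) (z : ℂ) : ℂ :=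
  fderiv ℝ G z Complex.I

/-- The weight `k` hyperbolic Laplace operator
`Δ_k = -v² (∂²/∂u² + ∂²/∂v²) + i k v (∂/∂u + i ∂/∂v)`, `τ = u + i v`, applied to a function on the
upper half-plane and evaluated at `τ`. -/
def hyperbolicLaplacian (k : ℝ) (f : ℍ → ℂ) (τ : ℍ) : ℂ :=
  -(τ.im : ℂ) ^ 2 *
      (partialU (partialU (f ∘ ofComplex)) τ + partialV (partialV (f ∘ ofComplex)) τ) +
    Complex.I * (k : ℂ) * (τ.im : ℂ) *
      (partialU (f ∘ ofComplex) τ + Complex.I * partialV (f ∘ ofComplex) τ)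

/-- Harmonic Maass forms of weight `k ∈ ½ ℤ` on a congruence subgroup `Γ` of `SL₂(ℤ)` with
multiplier `χ`. All complex powers are principal, smoothness is meant with respect to the two real
variables `u`, `v` of `τ = u + i v`, and the growth condition is the following one: for every cusp
`γ ∞` there is a polynomial `P` in `q ^ (-1/N)`, for some `N ≥ 1`, such that
`(c τ + d) ^ (-k) f(γ τ) - P = O(exp (-ε v))` as `v → ∞`, for some `ε > 0`. The identity `γ = 1`
gives the condition at the cusp `∞`. -/
structure IsHarmonicMaassForm (k : ℝ) (Γ : Subgroup SL(2, ℤ)) (χ : SL(2, ℤ) → ℂ) (f : ℍ → ℂ) :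
    Prop where
  half_integral : ∃ j : ℤ, k = j / 2
  congruence : CongruenceSubgroup.IsCongruenceSubgroup Γ
  smooth : ContDiffOn ℝ ∞ (f ∘ ofComplex) {z : ℂ | 0 < z.im}
  transform : ∀ γ ∈ Γ, ∀ τ : ℍ, f (γ • τ) = χ γ * autFactor γ τ ^ (k : ℂ) * f τ
  harmonic : ∀ τ : ℍ, hyperbolicLaplacian k f τ = 0
  growth : ∀ γ : SL(2, ℤ), ∃ (N : ℕ) (P : Polynomial ℂ) (ε : ℝ), 0 < N ∧ 0 < ε ∧
    (fun τ : ℍ => autFactor γ τ ^ (-k : ℂ) * f (γ • τ) -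
        P.eval (Complex.exp (-(2 * Real.pi * Complex.I * τ / N))))
      =O[atImInfty] fun τ : ℍ => Real.exp (-ε * τ.im)

end RankForms

end

noncomputable section

namespace RankForms

/-! ### Dyson's adjoint bijection -/

/-! Multiplied by `η`, the completed function becomes a lattice sum that is visibly modular of
weight two (`rankMHat_mul_eta`); dividing by `η` again leaves weight 3/2 and multiplier `ψ⁻¹`.

Let `P` be the partition series and `G_m` the series counting partitions of rank at least `m`.
Dyson's adjoint bijection gives `G_m = [m = 0] + q^(m+1) (P - G_(m+3))`. Iteration yields `G_m = P
θ_m` for `m > 0` with an explicit partial theta series (`rankGeSeries_eq_mul`), and summing over `m`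
turns `R₂ / P` into a series in `q^n / (1 - q^n)²` (`rankMomentSeries_two`). By the pentagonal
number theorem `1 / P` is Euler's product, and an alternating Lipschitz formula rewrites `R₂ / P` as
the sum of `± exp(3πi n ω) / ω²` over lattice points `ω = nτ + m` (`tsum_rankSummand`).

To repair the lack of modularity, insert the factor `exp(-3π ω² / ρ)`. At `ρ = ∞` nothing changes,
while at `ρ = 2v` the exponential becomes `exp(-3π |ω|² / (2v))`, which is invariant under `SL₂(ℤ)`.
Differentiation in `ρ` cancels `ω²`, and Poisson summation factors the resulting kernel into `η(τ)
η(-τ + iρ)` (`tsum_thetaKernel`). Integrating over `ρ` from `2v` to `∞` thus expresses the defect as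
`η(τ)` times the Eichler integral of `η`; the term `ω = 0` contributes `3π / (2v)`, exactly what
completes `E₂` (`tsum_rankSummand_eq`).

For harmonicity, the operator `∂/∂u + i ∂/∂v` sends the completed function to a constant times
`v^(-3/2) η(-conj τ)`, and the Laplacian factors through it. For growth, the principal part at `∞`
is `q^(-1/24) / 12`, and the transformation law carries it to every cusp. -/

/-- Removes the first column of the Young diagram and inserts a part exceeding the number of
parts by `k`. -/
def dysonMap (k : ℤ) (s : Multiset ℕ) : Multiset ℕ :=
  (((s.card : ℤ) + k).toNat ::ₘ s.map (· - 1)).filter (· ≠ 0)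

/-- The inverse of `dysonMap`: removes the largest part and inserts a first column. -/
def dysonInv (k : ℤ) (s : Multiset ℕ) : Multiset ℕ :=
  (s.erase s.sup).map (· + 1) +
    Multiset.replicate (((s.sup : ℤ) - k).toNat - (s.erase s.sup).card) 1

theorem sum_filter_ne_zero (s : Multiset ℕ) : (s.filter (· ≠ 0)).sum = s.sum := by
  induction s using Multiset.induction_on with
  | empty => simp
  | cons a s ih =>
    by_cases h : a = 0
    · simpa [h] using ih
    · simpa [h] using ih

theorem sum_map_pred {s : Multiset ℕ} (hs : ∀ x ∈ s, 0 < x) :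
    (s.map (· - 1)).sum + s.card = s.sum := by
  induction s using Multiset.induction_on with
  | empty => simp
  | cons a s ih =>
    have h1 := ih fun x hx => hs x (Multiset.mem_cons_of_mem hx)
    have h2 := hs a (Multiset.mem_cons_self a s)
    simp only [Multiset.map_cons, Multiset.sum_cons, Multiset.card_cons]
    omega

theorem multiset_sup_mem {s : Multiset ℕ} (hs : s ≠ 0) : s.sup ∈ s := by
  induction s using Multiset.induction_on with
  | empty => exact absurd rfl hs
  | cons a s ih =>
    rw [Multiset.sup_cons]
    rcases le_total s.sup a with h | h
    · simp [sup_eq_left.mpr h]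
    · rw [sup_eq_right.mpr h]
      by_cases h0 : s = 0
      · subst h0
        have : a = 0 := by simpa using h
        simp [this]
      · exact Multiset.mem_cons_of_mem (ih h0)

theorem multiset_sup_eq {s : Multiset ℕ} {M : ℕ} (hM : M ∈ s) (h : ∀ x ∈ s, x ≤ M) :
    s.sup = M :=
  le_antisymm (Multiset.sup_le.mpr h) (Multiset.le_sup hM)

/-- Parts equal to 1 vanish when the first column is removed; the drop in cardinality counts them,
so they can be restored. -/
theorem map_succ_filter_map_pred {s : Multiset ℕ} (hs : ∀ x ∈ s, 0 < x) :
    ((s.map (· - 1)).filter (· ≠ 0)).map (· + 1) +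
      Multiset.replicate (s.card - ((s.map (· - 1)).filter (· ≠ 0)).card) 1 = s := by
  induction s using Multiset.induction_on with
  | empty => simp
  | cons a s ih =>
    have h1 := ih fun x hx => hs x (Multiset.mem_cons_of_mem hx)
    have h2 := hs a (Multiset.mem_cons_self a s)
    have hle : ((s.map (· - 1)).filter (· ≠ 0)).card ≤ s.card := by
      simpa using Multiset.card_le_card (Multiset.filter_le (· ≠ 0) (s.map (· - 1)))
    by_cases h : a - 1 = 0
    · have ha : a = 1 := by omega
      subst ha
      rw [Multiset.map_cons, Multiset.filter_cons_of_neg (p := fun x : ℕ => x ≠ 0) _ (not_ne_iff.mpr h),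
        Multiset.card_cons,
        show s.card + 1 - ((s.map (· - 1)).filter (· ≠ 0)).card
          = (s.card - ((s.map (· - 1)).filter (· ≠ 0)).card) + 1 by omega,
        Multiset.replicate_succ, Multiset.add_cons, h1]
    · rw [Multiset.map_cons, Multiset.filter_cons_of_pos (p := fun x : ℕ => x ≠ 0) _ h, Multiset.map_cons,
        Multiset.card_cons, Multiset.card_cons, Nat.add_sub_add_right, Multiset.cons_add, h1,
        Nat.sub_add_cancel h2]

theorem filter_eq_self_of_pos {s : Multiset ℕ} (hs : ∀ x ∈ s, 0 < x) :
    s.filter (· ≠ 0) = s :=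
  Multiset.filter_eq_self.mpr fun x hx => (hs x hx).ne'

section

variable {k : ℤ} {s : Multiset ℕ}

theorem dysonMap_pos : ∀ x ∈ dysonMap k s, 0 < x := fun _ hx =>
  Nat.pos_of_ne_zero (Multiset.mem_filter.mp hx).2

theorem dysonInv_pos : ∀ x ∈ dysonInv k s, 0 < x := fun x hx => by
  rcases Multiset.mem_add.mp hx with h | h
  · obtain ⟨y, -, rfl⟩ := Multiset.mem_map.mp h
    omega
  · rw [Multiset.eq_of_mem_replicate h]
    exact one_pos

theorem dysonMap_sum (hs : ∀ x ∈ s, 0 < x) (hk : 0 ≤ (s.card : ℤ) + k) :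
    ((dysonMap k s).sum : ℤ) = s.sum + k := by
  rw [dysonMap, sum_filter_ne_zero, Multiset.sum_cons]
  have := sum_map_pred hs
  rw [Nat.cast_add]
  omega

/-- The rank bound says that every decremented part is at most `card + k`, so the inserted part is
the largest. When `card + k = 0` the inserted part is filtered out, and the formula survives because
the empty supremum is 0. -/
theorem dysonMap_sup (hr : (s.sup : ℤ) - s.card ≤ k + 1) (hk : 0 ≤ (s.card : ℤ) + k) :
    (dysonMap k s).sup = ((s.card : ℤ) + k).toNat := by
  have hb : ∀ x ∈ dysonMap k s, x ≤ ((s.card : ℤ) + k).toNat := by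
    intro x hx
    rcases Multiset.mem_cons.mp (Multiset.mem_filter.mp hx).1 with h | h
    · exact h.le
    · obtain ⟨y, hy, rfl⟩ := Multiset.mem_map.mp h
      have := Multiset.le_sup hy
      omega
  by_cases h0 : ((s.card : ℤ) + k).toNat = 0
  · exact Nat.le_antisymm (Multiset.sup_le.mpr hb) (by omega)
  · exact multiset_sup_eq (Multiset.mem_filter.mpr ⟨Multiset.mem_cons_self _ _, h0⟩) hb

theorem dysonMap_card_le : (dysonMap k s).card ≤ s.card + 1 := by
  simpa [dysonMap] using Multiset.card_le_card (Multiset.filter_le (· ≠ 0)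
    (((s.card : ℤ) + k).toNat ::ₘ s.map (· - 1)))

theorem dysonMap_erase (hr : (s.sup : ℤ) - s.card ≤ k + 1) (hk : 0 ≤ (s.card : ℤ) + k) :
    (dysonMap k s).erase (dysonMap k s).sup = (s.map (· - 1)).filter (· ≠ 0) := by
  rw [dysonMap_sup hr hk, dysonMap]
  by_cases h0 : ((s.card : ℤ) + k).toNat = 0
  · rw [Multiset.filter_cons_of_neg (p := fun x : ℕ => x ≠ 0) _ (not_ne_iff.mpr h0), h0,
      Multiset.erase_of_notMem]
    simp
  · rw [Multiset.filter_cons_of_pos (p := fun x : ℕ => x ≠ 0) _ h0, Multiset.erase_cons_head]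

theorem dysonInv_dysonMap (hs : ∀ x ∈ s, 0 < x) (hr : (s.sup : ℤ) - s.card ≤ k + 1)
    (hk : 0 ≤ (s.card : ℤ) + k) : dysonInv k (dysonMap k s) = s := by
  rw [dysonInv, dysonMap_erase hr hk, dysonMap_sup hr hk]
  have : ((((s.card : ℤ) + k).toNat : ℤ) - k).toNat = s.card := by omega
  rw [this]
  exact map_succ_filter_map_pred hs

theorem cons_erase_filter (hs : ∀ x ∈ s, 0 < x) :
    (s.sup ::ₘ s.erase s.sup).filter (· ≠ 0) = s := by
  by_cases h : s = 0
  · simp [h]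
  · rw [Multiset.cons_erase (multiset_sup_mem h), filter_eq_self_of_pos hs]

/-- This ensures that the natural number subtraction in `dysonInv` does not truncate. -/
theorem card_erase_sup (hr : k - 1 ≤ (s.sup : ℤ) - s.card) (hk : s = 0 → k ≤ 0) :
    ((s.erase s.sup).card : ℤ) ≤ s.sup - k := by
  by_cases h : s = 0
  · have := hk h
    simp [h]
    omega
  · have h1 := Multiset.card_erase_add_one (multiset_sup_mem h)
    omega

theorem dysonInv_card (hr : k - 1 ≤ (s.sup : ℤ) - s.card) (hk : s = 0 → k ≤ 0) :
    ((dysonInv k s).card : ℤ) = s.sup - k := by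
  have := card_erase_sup hr hk
  rw [dysonInv, Multiset.card_add, Multiset.card_map, Multiset.card_replicate]
  omega

theorem dysonInv_sum (hr : k - 1 ≤ (s.sup : ℤ) - s.card) (hk : s = 0 → k ≤ 0) :
    ((dysonInv k s).sum : ℤ) = s.sum - k := by
  have h1 := card_erase_sup hr hk
  have h2 : s.sup + (s.erase s.sup).sum = s.sum := by
    by_cases h : s = 0
    · simp [h]
    · rw [← Multiset.sum_cons, Multiset.cons_erase (multiset_sup_mem h)]
  have h3 : ((s.erase s.sup).map (· + 1)).sum = (s.erase s.sup).sum + (s.erase s.sup).card := by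
    rw [Multiset.sum_map_add]
    simp
  rw [dysonInv, Multiset.sum_add, Multiset.sum_replicate, h3, smul_eq_mul, mul_one]
  omega

theorem dysonInv_sup_le : (dysonInv k s).sup ≤ s.sup + 1 := by
  refine Multiset.sup_le.mpr fun x hx => ?_
  rcases Multiset.mem_add.mp hx with h | h
  · obtain ⟨y, hy, rfl⟩ := Multiset.mem_map.mp h
    have := Multiset.le_sup (Multiset.mem_of_mem_erase hy)
    omega
  · rw [Multiset.eq_of_mem_replicate h]
    omega

theorem dysonMap_dysonInv (hs : ∀ x ∈ s, 0 < x) (hr : k - 1 ≤ (s.sup : ℤ) - s.card)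
    (hk : s = 0 → k ≤ 0) : dysonMap k (dysonInv k s) = s := by
  rw [dysonMap, dysonInv_card hr hk]
  have : ((s.sup : ℤ) - k + k).toNat = s.sup := by omega
  rw [this, dysonInv, Multiset.map_add, Multiset.map_map, Multiset.map_replicate]
  simp only [Function.comp_def, Nat.add_sub_cancel, Multiset.map_id', Nat.sub_self]
  rw [← Multiset.cons_add, Multiset.filter_add, cons_erase_filter hs]
  simpa using fun a => Multiset.eq_of_mem_replicate

end

/-- Dyson's adjoint. The image has largest part `card + k` and at most `card + 1` parts, whence rank
at least `k - 1`; conversely the inverse produces `sup - k` parts, none exceeding `sup + 1`. -/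
theorem card_rank_le_eq_card_le_rank (k : ℤ) {a b : ℕ} (hab : (b : ℤ) = a + k) :
    (Finset.univ.filter fun p : a.Partition => partitionRank p ≤ k + 1).card =
      (Finset.univ.filter fun p : b.Partition => k - 1 ≤ partitionRank p).card := by
  have hf : ∀ p : a.Partition, partitionRank p ≤ k + 1 → 0 ≤ (p.parts.card : ℤ) + k := by
    intro p hp
    rw [partitionRank] at hp
    by_cases h : p.parts = 0
    · have := p.parts_sum
      simp only [h, Multiset.sum_zero] at this
      omega
    · have := p.parts_pos (multiset_sup_mem h)
      omega
  have hb : ∀ p : b.Partition, p.parts = 0 → k ≤ 0 := by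
    intro p h
    have := p.parts_sum
    simp only [h, Multiset.sum_zero] at this
    omega
  refine Finset.card_bij'
    (fun p hp => ⟨dysonMap k p.parts, fun {i} hi => dysonMap_pos i hi, ?_⟩)
    (fun p hp => ⟨dysonInv k p.parts, fun {i} hi => dysonInv_pos i hi, ?_⟩) ?_ ?_ ?_ ?_
  · have hp' := (Finset.mem_filter.mp hp).2
    have := dysonMap_sum (fun x hx => p.parts_pos hx) (hf p hp')
    rw [p.parts_sum] at this
    omega
  · have hp' := (Finset.mem_filter.mp hp).2
    have := dysonInv_sum hp' (hb p)
    rw [p.parts_sum] at this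
    omega
  · intro p hp
    have hp' := (Finset.mem_filter.mp hp).2
    refine Finset.mem_filter.mpr ⟨Finset.mem_univ _, ?_⟩
    have h1 := dysonMap_sup hp' (hf p hp')
    have h2 := dysonMap_card_le (k := k) (s := p.parts)
    have h3 := hf p hp'
    simp only [partitionRank]
    omega
  · intro p hp
    have hp' := (Finset.mem_filter.mp hp).2
    refine Finset.mem_filter.mpr ⟨Finset.mem_univ _, ?_⟩
    have h1 := dysonInv_sup_le (k := k) (s := p.parts)
    have h2 := dysonInv_card hp' (hb p)
    simp only [partitionRank]
    omega
  · intro p hp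
    have hp' := (Finset.mem_filter.mp hp).2
    exact Nat.Partition.ext (dysonInv_dysonMap (fun x hx => p.parts_pos hx) hp' (hf p hp'))
  · intro p hp
    have hp' := (Finset.mem_filter.mp hp).2
    exact Nat.Partition.ext (dysonMap_dysonInv (fun x hx => p.parts_pos hx) hp' (hb p))

/-! ### Counting partitions by rank -/

/-- The number of partitions of `n`. -/
def partitionCount (n : ℕ) : ℕ := Fintype.card n.Partition

/-- The number of partitions of `n` with rank at least `m`. -/
def rankGeCount (m n : ℕ) : ℕ :=
  (Finset.univ.filter fun p : n.Partition => (m : ℤ) ≤ partitionRank p).card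

/-- The number of partitions of `n` with rank at most `-m`. -/
def rankLeNegCount (m n : ℕ) : ℕ :=
  (Finset.univ.filter fun p : n.Partition => partitionRank p ≤ -(m : ℤ)).card

theorem card_filter_add_card_filter_not_partition {n : ℕ} (P Q : n.Partition → Prop)
    [DecidablePred P] [DecidablePred Q] (h : ∀ p, Q p ↔ ¬ P p) :
    (Finset.univ.filter P).card + (Finset.univ.filter Q).card = partitionCount n := by
  rw [partitionCount, ← Finset.card_univ, ← Finset.card_filter_add_card_filter_not (s := Finset.univ) P]
  congr 2
  ext p
  simp [h]

/-- The adjoint with `k = m + 1` matches the first count with partitions of `n` of rank at most `m +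
2`, the complement of the second. -/
theorem rankGeCount_add (m n : ℕ) :
    rankGeCount m (n + m + 1) + rankGeCount (m + 3) n = partitionCount n := by
  have h := card_rank_le_eq_card_le_rank (m + 1 : ℤ) (a := n) (b := n + m + 1)
    (by push_cast; ring)
  rw [rankGeCount, show (m : ℤ) = m + 1 - 1 by ring, ← h, rankGeCount]
  refine card_filter_add_card_filter_not_partition _ _ fun p => ?_
  push_cast
  omega

theorem rankLeNegCount_add (m n : ℕ) :
    rankLeNegCount m (n + m + 1) + rankLeNegCount (m + 3) n = partitionCount n := by
  have h := card_rank_le_eq_card_le_rank (-(m + 1 : ℤ)) (a := n + m + 1) (b := n)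
    (by push_cast; ring)
  rw [rankLeNegCount, show -(m : ℤ) = -(m + 1 : ℤ) + 1 by ring, h, rankLeNegCount]
  refine card_filter_add_card_filter_not_partition _ _ fun p => ?_
  push_cast
  omega

theorem multiset_card_le_sum {s : Multiset ℕ} (hs : ∀ x ∈ s, 0 < x) : s.card ≤ s.sum := by
  have := sum_map_pred hs
  omega

theorem partitionRank_lt {n : ℕ} (hn : 0 < n) (p : n.Partition) : |partitionRank p| < n := by
  have h0 : p.parts ≠ 0 := fun h => by
    have := p.parts_sum
    simp only [h, Multiset.sum_zero] at this
    omega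
  have h1 := p.le_of_mem_parts (multiset_sup_mem h0)
  have h2 := multiset_card_le_sum fun x hx => p.parts_pos hx
  have h3 := p.parts_pos (multiset_sup_mem h0)
  have h4 := Multiset.card_pos.mpr h0
  rw [p.parts_sum] at h2
  rw [partitionRank, abs_lt]
  omega

theorem partitionRank_zero (p : (0 : ℕ).Partition) : partitionRank p = 0 := by
  simp [partitionRank]

theorem abs_partitionRank_le {n : ℕ} (p : n.Partition) : |partitionRank p| ≤ n := by
  rcases Nat.eq_zero_or_pos n with rfl | hn
  · simp [partitionRank_zero]
  · exact (partitionRank_lt hn p).le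

theorem rankGeCount_of_le {m n : ℕ} (hm : 0 < m) (h : n ≤ m) : rankGeCount m n = 0 := by
  rw [rankGeCount, Finset.card_eq_zero, Finset.filter_eq_empty_iff]
  intro p _ hp
  rcases Nat.eq_zero_or_pos n with rfl | hn
  · rw [partitionRank_zero] at hp
    omega
  · have := abs_lt.mp (partitionRank_lt hn p)
    omega

theorem rankLeNegCount_of_le {m n : ℕ} (hm : 0 < m) (h : n ≤ m) : rankLeNegCount m n = 0 := by
  rw [rankLeNegCount, Finset.card_eq_zero, Finset.filter_eq_empty_iff]
  intro p _ hp
  rcases Nat.eq_zero_or_pos n with rfl | hn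
  · rw [partitionRank_zero] at hp
    omega
  · have := abs_lt.mp (partitionRank_lt hn p)
    omega

theorem rankGeCount_zero_zero : rankGeCount 0 0 = 1 := by
  simp [rankGeCount, partitionRank_zero]

theorem rankGeCount_le (m n : ℕ) : rankGeCount m n ≤ partitionCount n :=
  Finset.card_le_univ _

/-- Symmetry of the rank without conjugating diagrams: both counts satisfy the same recursion and
vanish for `n ≤ m`. -/
theorem rankLeNegCount_eq (n : ℕ) : ∀ m : ℕ, 0 < m → rankLeNegCount m n = rankGeCount m n := by
  induction n using Nat.strong_induction_on with
  | _ n ih =>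
    intro m hm
    rcases le_or_gt n m with h | h
    · rw [rankGeCount_of_le hm h, rankLeNegCount_of_le hm h]
    · obtain ⟨j, rfl⟩ : ∃ j, n = j + m + 1 := ⟨n - m - 1, by omega⟩
      have h1 := rankGeCount_add m j
      have h2 := rankLeNegCount_add m j
      have h3 := ih j (by omega) (m + 3) (by omega)
      omega

theorem rankGeCount_zero_add_one (n : ℕ) :
    rankGeCount 0 n + rankGeCount 1 n = partitionCount n := by
  rw [← rankLeNegCount_eq n 1 one_pos, rankGeCount, rankLeNegCount]
  refine card_filter_add_card_filter_not_partition _ _ fun p => ?_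
  push_cast
  omega

/-- A square is a sum of consecutive odd numbers; the indicators stop the sum at `|r|`. Summed over
partitions, this turns the second moment into tail counts of the rank. -/
theorem sq_eq_sum_rank {N : ℕ} {r : ℤ} (h : |r| ≤ N) :
    r ^ 2 = ∑ m ∈ Finset.range N, (2 * (m : ℤ) + 1) *
      ((if ((m + 1 : ℕ) : ℤ) ≤ r then 1 else 0) + (if r ≤ -((m + 1 : ℕ) : ℤ) then 1 else 0)) := by
  have key : ∀ N j : ℕ, j ≤ N → (j : ℤ) ^ 2 =
      ∑ m ∈ Finset.range N, (2 * (m : ℤ) + 1) * (if m + 1 ≤ j then 1 else 0) := by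
    intro N j hj
    induction N with
    | zero => simp [Nat.le_zero.mp hj]
    | succ N ih =>
      rw [Finset.sum_range_succ]
      rcases Nat.lt_or_ge j (N + 1) with h | h
      · rw [← ih (by omega), if_neg (by omega)]
        ring
      · have : j = N + 1 := by omega
        subst this
        have h2 : ∀ M : ℕ, ∑ m ∈ Finset.range M, (2 * (m : ℤ) + 1) = (M : ℤ) ^ 2 := by
          intro M
          induction M with
          | zero => simp
          | succ M ih => rw [Finset.sum_range_succ, ih]; push_cast; ring
        rw [Finset.sum_congr rfl (g := fun m : ℕ => 2 * (m : ℤ) + 1), h2]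
        · simp
          ring
        · intro m hm
          have := Finset.mem_range.mp hm
          rw [if_pos (by omega), mul_one]
  rw [← sq_abs, show |r| = ((r.natAbs : ℕ) : ℤ) by simp, key N r.natAbs (by zify; exact h)]
  refine Finset.sum_congr rfl fun m _ => ?_
  congr 1
  split_ifs <;> omega

theorem rankMoment_two (n : ℕ) :
    rankMoment 2 n = 2 * ∑ m ∈ Finset.range n, (2 * (m : ℤ) + 1) * rankGeCount (m + 1) n := by
  rw [rankMoment_eq_sum, Finset.sum_congr rfl fun p _ => sq_eq_sum_rank (abs_partitionRank_le p),
    Finset.sum_comm, Finset.mul_sum]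
  refine Finset.sum_congr rfl fun m _ => ?_
  rw [← Finset.mul_sum, Finset.sum_add_distrib, Finset.sum_boole, Finset.sum_boole]
  have h := rankLeNegCount_eq n (m + 1) (by omega)
  simp only [rankGeCount, rankLeNegCount] at h ⊢
  rw [h]
  push_cast
  ring

/-! ### The partition generating function and the rank generating functions -/

theorem sum_add_one_mul_count {n M : ℕ} (h : n < M) (p : n.Partition) :
    ∑ i : Fin M, ((i : ℕ) + 1) * p.parts.count ((i : ℕ) + 1) = n := by
  have hsub : p.parts.toFinset ⊆ Finset.range (M + 1) := fun x hx => by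
    have := p.le_of_mem_parts (Multiset.mem_toFinset.mp hx)
    exact Finset.mem_range.mpr (by omega)
  have h1 := Finset.sum_multiset_count_of_subset p.parts _ hsub
  rw [p.parts_sum, Finset.sum_range_succ'] at h1
  rw [Finset.sum_fin_eq_sum_range]
  conv_rhs => rw [h1]
  simp only [smul_eq_mul, mul_zero, add_zero]
  refine Finset.sum_congr rfl fun i hi => ?_
  rw [dif_pos (Finset.mem_range.mp hi), mul_comm]

/-- A partition of `n < M` is determined by the multiplicities of the parts `1, …, M`, each less
than `M`. So the left side is a subsum of the expanded product. -/
theorem sum_range_partitionCount_le {x : ℝ} (h0 : 0 ≤ x) (M : ℕ) :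
    ∑ n ∈ Finset.range M, (partitionCount n : ℝ) * x ^ n ≤
      ∏ i : Fin M, ∑ j ∈ Finset.range M, (x ^ ((i : ℕ) + 1)) ^ j := by
  classical
  rw [Finset.prod_univ_sum]
  have h1 : ∀ n ∈ Finset.range M, (partitionCount n : ℝ) * x ^ n =
      ∑ _p : n.Partition, x ^ n := fun n _ => by
    rw [Finset.sum_const, nsmul_eq_mul, Finset.card_univ, partitionCount]
  rw [Finset.sum_congr rfl h1, Finset.sum_sigma']
  set g : (Σ n : ℕ, n.Partition) → Fin M → ℕ := fun p i => p.2.parts.count ((i : ℕ) + 1) with hg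
  have hinj : Set.InjOn g ((Finset.range M).sigma fun n => (Finset.univ : Finset n.Partition) :
      Finset (Σ n : ℕ, n.Partition)) := by
    rintro ⟨n, p⟩ hp ⟨n', p'⟩ hp' hpp
    simp only [Finset.coe_sigma, Set.mem_sigma_iff, Finset.coe_range, Set.mem_Iio] at hp hp'
    have hparts : p.parts = p'.parts := by
      ext a
      rcases Nat.eq_zero_or_pos a with rfl | ha
      · rw [Multiset.count_eq_zero_of_notMem fun h => (p.parts_pos h).ne rfl,
          Multiset.count_eq_zero_of_notMem fun h => (p'.parts_pos h).ne rfl]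
      · by_cases haM : a ≤ M
        · have := congrFun hpp ⟨a - 1, by omega⟩
          simpa [hg, Nat.sub_add_cancel ha] using this
        · rw [Multiset.count_eq_zero_of_notMem fun h => by have := p.le_of_mem_parts h; omega,
            Multiset.count_eq_zero_of_notMem fun h => by have := p'.le_of_mem_parts h; omega]
    have hn : n = n' := by rw [← p.parts_sum, ← p'.parts_sum, hparts]
    subst hn
    rw [Nat.Partition.ext hparts]
  have hval : ∀ p ∈ (Finset.range M).sigma fun n => (Finset.univ : Finset n.Partition),
      x ^ p.1 = ∏ i : Fin M, (x ^ ((i : ℕ) + 1)) ^ g p i := by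
    rintro ⟨n, p⟩ hp
    have hn : n < M := by simpa using hp
    simp only [← pow_mul, Finset.prod_pow_eq_pow_sum, hg]
    rw [sum_add_one_mul_count hn p]
  rw [Finset.sum_congr rfl hval,
    ← Finset.sum_image (g := g) (f := fun c => ∏ i : Fin M, (x ^ ((i : ℕ) + 1)) ^ c i) hinj]
  refine Finset.sum_le_sum_of_subset_of_nonneg ?_ fun c _ _ =>
    Finset.prod_nonneg fun i _ => by positivity
  intro c hc
  obtain ⟨⟨n, p⟩, hp, rfl⟩ := Finset.mem_image.mp hc
  have hn : n < M := by simpa using hp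
  refine Fintype.mem_piFinset.mpr fun i => Finset.mem_range.mpr ?_
  have h2 := sum_add_one_mul_count hn p
  have h3 := Finset.single_le_sum (f := fun i : Fin M => ((i : ℕ) + 1) *
    p.parts.count ((i : ℕ) + 1)) (fun i _ => Nat.zero_le _) (Finset.mem_univ i)
  simp only [hg]
  nlinarith [Nat.zero_le ((i : ℕ) * p.parts.count ((i : ℕ) + 1))]

theorem summable_partitionCount_mul_pow {x : ℝ} (h0 : 0 ≤ x) (h1 : x < 1) :
    Summable fun n : ℕ => (partitionCount n : ℝ) * x ^ n := by
  have hx : 0 < 1 - x := by linarith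
  have hsum : Summable fun i : ℕ => x ^ (i + 1) / (1 - x) :=
    ((summable_nat_add_iff 1).mpr (summable_geometric_of_lt_one h0 h1)).div_const _
  refine summable_of_sum_range_le (c := Real.exp (∑' i : ℕ, x ^ (i + 1) / (1 - x)))
    (fun n => by positivity) fun M => (sum_range_partitionCount_le h0 M).trans ?_
  calc ∏ i : Fin M, ∑ j ∈ Finset.range M, (x ^ ((i : ℕ) + 1)) ^ j
      ≤ ∏ i : Fin M, Real.exp (x ^ ((i : ℕ) + 1) / (1 - x)) := by
        refine Finset.prod_le_prod (fun i _ => Finset.sum_nonneg fun j _ => by positivity)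
          fun i _ => ?_
        have hy0 : 0 ≤ x ^ ((i : ℕ) + 1) := by positivity
        have hyx : x ^ ((i : ℕ) + 1) ≤ x := pow_le_of_le_one h0 h1.le (by omega)
        have hy1 : x ^ ((i : ℕ) + 1) < 1 := hyx.trans_lt h1
        have hs := (summable_geometric_of_lt_one hy0 hy1).sum_le_tsum (Finset.range M)
          (fun j _ => by positivity)
        rw [tsum_geometric_of_lt_one hy0 hy1] at hs
        refine hs.trans ?_
        -- Here `1 / (1 - y) = 1 + y / (1 - y)` and `y ≤ x`, so the infinite product is dominated by
        -- the exponential of a geometric series.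
        have h2 : (1 - x ^ ((i : ℕ) + 1))⁻¹ ≤ 1 + x ^ ((i : ℕ) + 1) / (1 - x) := by
          rw [inv_le_iff_one_le_mul₀ (by linarith), add_mul, one_mul, div_mul_eq_mul_div,
            ← sub_le_iff_le_add', le_div_iff₀ hx]
          nlinarith
        refine h2.trans ?_
        rw [add_comm]
        exact Real.add_one_le_exp _
    _ = Real.exp (∑ i ∈ Finset.range M, x ^ (i + 1) / (1 - x)) := by
        rw [Real.exp_sum, Finset.prod_range]
    _ ≤ _ := Real.exp_le_exp.mpr (hsum.sum_le_tsum _ fun i _ => by positivity)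

/-- The generating function of the partition function. -/
def partitionSeries (q : ℂ) : ℂ := ∑' n : ℕ, (partitionCount n : ℂ) * q ^ n

/-- The generating function of the partitions with rank at least `m`. -/
def rankGeSeries (m : ℕ) (q : ℂ) : ℂ := ∑' n : ℕ, (rankGeCount m n : ℂ) * q ^ n

section

variable {q : ℂ}

theorem summable_partitionSeries (hq : ‖q‖ < 1) :
    Summable fun n : ℕ => (partitionCount n : ℂ) * q ^ n :=
  Summable.of_norm (by simpa using summable_partitionCount_mul_pow (norm_nonneg q) hq)

theorem norm_rankGeCount_mul_pow_le (m n : ℕ) :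
    ‖(rankGeCount m n : ℂ) * q ^ n‖ ≤ partitionCount n * ‖q‖ ^ n := by
  rw [norm_mul, norm_pow, Complex.norm_natCast]
  gcongr
  exact rankGeCount_le m n

theorem summable_rankGeSeries (hq : ‖q‖ < 1) (m : ℕ) :
    Summable fun n : ℕ => (rankGeCount m n : ℂ) * q ^ n :=
  Summable.of_norm_bounded (summable_partitionCount_mul_pow (norm_nonneg q) hq)
    fun n => norm_rankGeCount_mul_pow_le m n

theorem norm_rankGeSeries_le (hq : ‖q‖ < 1) (m : ℕ) :
    ‖rankGeSeries m q‖ ≤ ∑' n : ℕ, (partitionCount n : ℝ) * ‖q‖ ^ n :=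
  tsum_of_norm_bounded (summable_partitionCount_mul_pow (norm_nonneg q) hq).hasSum
    fun n => norm_rankGeCount_mul_pow_le m n

/-- The recursion accounts for all coefficients from index `m + 1` on. Below that only the empty
partition, of rank 0, can contribute, hence the term for `m = 0`. -/
theorem rankGeSeries_eq (hq : ‖q‖ < 1) (m : ℕ) :
    rankGeSeries m q = (if m = 0 then 1 else 0) +
      q ^ (m + 1) * (partitionSeries q - rankGeSeries (m + 3) q) := by
  rw [rankGeSeries, ← (summable_rankGeSeries hq m).sum_add_tsum_nat_add (m + 1)]
  congr 1
  · split_ifs with h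
    · subst h
      simp [rankGeCount_zero_zero]
    · refine Finset.sum_eq_zero fun n hn => ?_
      rw [rankGeCount_of_le (Nat.pos_of_ne_zero h) (by have := Finset.mem_range.mp hn; omega)]
      simp
  · rw [partitionSeries, rankGeSeries,
      ← (summable_partitionSeries hq).tsum_sub (summable_rankGeSeries hq _), ← tsum_mul_left]
    refine tsum_congr fun n => ?_
    rw [← rankGeCount_add m n, ← add_assoc]
    push_cast
    ring

theorem partitionSeries_eq_add (hq : ‖q‖ < 1) :
    partitionSeries q = rankGeSeries 0 q + rankGeSeries 1 q := by
  rw [partitionSeries, rankGeSeries, rankGeSeries,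
    ← (summable_rankGeSeries hq 0).tsum_add (summable_rankGeSeries hq 1)]
  refine tsum_congr fun n => ?_
  rw [← rankGeCount_zero_add_one n]
  push_cast
  ring

/-! ### The partial theta series solving the rank recursion -/

/-- The exponents `(j + 1) (3 j + 2) / 2`. -/
def pentExp (j : ℕ) : ℕ := (j + 1) * (3 * j + 2) / 2

theorem two_mul_pentExp (j : ℕ) : 2 * pentExp j = (j + 1) * (3 * j + 2) := by
  refine Nat.mul_div_cancel' ?_
  rcases Nat.even_or_odd j with h | h
  · exact ((h.mul_left 3).add even_two).two_dvd.mul_left _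
  · exact (h.add_one).two_dvd.mul_right _

theorem pentExp_succ (j : ℕ) : pentExp (j + 1) = pentExp j + 3 * j + 4 := by
  have h1 := two_mul_pentExp j
  have h2 := two_mul_pentExp (j + 1)
  nlinarith

theorem lt_pentExp (j : ℕ) : j < pentExp j := by
  have h1 := two_mul_pentExp j
  nlinarith

/-- The series `∑_{j ≥ 1} (-1) ^ (j - 1) q ^ (j m + j (3 j - 1) / 2)`. -/
def rankTheta (m : ℕ) (q : ℂ) : ℂ :=
  ∑' j : ℕ, (-1) ^ j * q ^ ((j + 1) * m + pentExp j)

theorem norm_rankTheta_term_le (hq : ‖q‖ < 1) (m j : ℕ) :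
    ‖(-1) ^ j * q ^ ((j + 1) * m + pentExp j)‖ ≤ ‖q‖ ^ j := by
  rw [norm_mul, norm_pow, norm_pow, norm_neg, norm_one, one_pow, one_mul]
  exact pow_le_pow_of_le_one (norm_nonneg q) hq.le ((lt_pentExp j).le.trans (Nat.le_add_left _ _))

theorem summable_rankTheta (hq : ‖q‖ < 1) (m : ℕ) :
    Summable fun j : ℕ => (-1) ^ j * q ^ ((j + 1) * m + pentExp j) :=
  Summable.of_norm_bounded (summable_geometric_of_lt_one (norm_nonneg q) hq)
    fun j => norm_rankTheta_term_le hq m j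

theorem norm_rankTheta_le (hq : ‖q‖ < 1) (m : ℕ) : ‖rankTheta m q‖ ≤ (1 - ‖q‖)⁻¹ := by
  rw [← tsum_geometric_of_lt_one (norm_nonneg q) hq]
  exact tsum_of_norm_bounded (summable_geometric_of_lt_one (norm_nonneg q) hq).hasSum
    fun j => norm_rankTheta_term_le hq m j

theorem rankTheta_eq (hq : ‖q‖ < 1) (m : ℕ) :
    rankTheta m q = q ^ (m + 1) * (1 - rankTheta (m + 3) q) := by
  rw [rankTheta, (summable_rankTheta hq m).tsum_eq_zero_add, mul_sub, sub_eq_add_neg, rankTheta,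
    ← tsum_mul_left, ← tsum_neg]
  congr 1
  · simp [pentExp]
  · refine tsum_congr fun j => ?_
    rw [pentExp_succ]
    ring

/-- The difference `D_m` of the two sides satisfies `D_m = -q^(m+1) D_(m+3)`. Since it is bounded
independently of `m`, iterating the relation forces it to vanish. -/
theorem rankGeSeries_eq_mul (hq : ‖q‖ < 1) {m : ℕ} (hm : 0 < m) :
    rankGeSeries m q = partitionSeries q * rankTheta m q := by
  set B : ℝ := (∑' n : ℕ, (partitionCount n : ℝ) * ‖q‖ ^ n) +
    ‖partitionSeries q‖ * (1 - ‖q‖)⁻¹ with hB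
  have key : ∀ N m : ℕ, 0 < m →
      ‖rankGeSeries m q - partitionSeries q * rankTheta m q‖ ≤ ‖q‖ ^ N * B := by
    intro N
    induction N with
    | zero =>
      intro m _
      rw [pow_zero, one_mul, hB]
      refine (norm_sub_le _ _).trans (add_le_add (norm_rankGeSeries_le hq m) ?_)
      rw [norm_mul]
      exact mul_le_mul_of_nonneg_left (norm_rankTheta_le hq m) (norm_nonneg _)
    | succ N ih =>
      intro m hm
      have h1 : rankGeSeries m q - partitionSeries q * rankTheta m q =
          q ^ (m + 1) * -(rankGeSeries (m + 3) q - partitionSeries q * rankTheta (m + 3) q) := by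
        rw [rankGeSeries_eq hq m, rankTheta_eq hq m, if_neg hm.ne']
        ring
      rw [h1, norm_mul, norm_neg, norm_pow, pow_succ' ‖q‖ N, mul_assoc ‖q‖ (‖q‖ ^ N) B]
      refine mul_le_mul (pow_le_of_le_one (norm_nonneg q) hq.le (by omega)) (ih (m + 3) (by omega))
        (norm_nonneg _) (norm_nonneg _)
  have hlim : Filter.Tendsto (fun N : ℕ => ‖q‖ ^ N * B) Filter.atTop (nhds 0) := by
    simpa using (tendsto_pow_atTop_nhds_zero_of_lt_one (norm_nonneg q) hq).mul_const B
  have := ge_of_tendsto' hlim fun N => key N m hm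
  exact sub_eq_zero.mp (norm_le_zero_iff.mp this)

/-- By symmetry `P = G_0 + G_1`. The inhomogeneous 1 in the recursion for `G_0`, coming from the
empty partition, is what remains on the right. -/
theorem partitionSeries_mul_eq_one (hq : ‖q‖ < 1) :
    partitionSeries q * (1 - rankTheta 0 q - rankTheta 1 q) = 1 := by
  have h1 := partitionSeries_eq_add hq
  have h2 := rankTheta_eq hq 0
  rw [rankGeSeries_eq hq 0, rankGeSeries_eq_mul hq one_pos,
    rankGeSeries_eq_mul hq (m := 0 + 3) (by omega), if_pos rfl] at h1
  rw [h2]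
  linear_combination h1

/-! ### The second rank moment -/

theorem summable_mul_of_le_mul {f : ℕ × ℕ → ℂ} {a b : ℕ → ℝ} (ha : Summable a) (hb : Summable b)
    (ha0 : 0 ≤ a) (hb0 : 0 ≤ b) (h : ∀ m n, ‖f (m, n)‖ ≤ a m * b n) : Summable f :=
  Summable.of_norm_bounded (ha.mul_of_nonneg hb ha0 hb0) fun p => h p.1 p.2

theorem summable_odd_mul_pow {x : ℝ} (h0 : 0 ≤ x) (h1 : x < 1) :
    Summable fun m : ℕ => (2 * (m : ℝ) + 1) * x ^ m := by
  have h := summable_pow_mul_geometric_of_norm_lt_one 1 (r := x) (by rwa [Real.norm_of_nonneg h0])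
  refine ((h.mul_left 2).add (summable_geometric_of_lt_one h0 h1)).congr fun m => ?_
  ring

theorem norm_odd (m : ℕ) : ‖(2 * (m : ℂ) + 1)‖ = 2 * (m : ℝ) + 1 := by
  have := Complex.norm_natCast (2 * m + 1)
  push_cast at this
  exact this

theorem tsum_odd_mul_pow {x : ℂ} (hx : ‖x‖ < 1) :
    ∑' m : ℕ, (2 * (m : ℂ) + 1) * x ^ (m + 1) = x * (1 + x) / (1 - x) ^ 2 := by
  have h1 := hasSum_coe_mul_geometric_of_norm_lt_one hx
  have h2 := hasSum_geometric_of_norm_lt_one hx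
  have hx1 : 1 - x ≠ 0 := sub_ne_zero.mpr fun h => by simp [← h] at hx
  have h3 := (((h1.mul_left 2).add h2).mul_left x).tsum_eq
  rw [show x * (1 + x) / (1 - x) ^ 2 = x * (2 * (x / (1 - x) ^ 2) + (1 - x)⁻¹) by
    field_simp; ring, ← h3]
  refine tsum_congr fun m => ?_
  ring

/-- A nonzero term has `n > m + 1`, so `‖q‖^n = √‖q‖^n √‖q‖^n` is at most `√‖q‖^m √‖q‖^n`, which
separates the two variables. -/
theorem summable_rank_pairs (hq : ‖q‖ < 1) : Summable fun p : ℕ × ℕ =>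
    (2 * (p.1 : ℂ) + 1) * (rankGeCount (p.1 + 1) p.2 * q ^ p.2) := by
  have hs0 : 0 ≤ √‖q‖ := Real.sqrt_nonneg _
  have hs1 : √‖q‖ < 1 := by rwa [Real.sqrt_lt' one_pos, one_pow]
  refine summable_mul_of_le_mul (summable_odd_mul_pow hs0 hs1)
    (summable_partitionCount_mul_pow hs0 hs1) (fun m => by positivity) (fun n => by positivity)
    fun m n => ?_
  dsimp only
  rw [norm_mul, norm_odd]
  rcases le_or_gt n (m + 1) with h | h
  · rw [rankGeCount_of_le (Nat.succ_pos m) h]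
    simp only [Nat.cast_zero, zero_mul, norm_zero, mul_zero]
    positivity
  · rw [mul_assoc]
    refine mul_le_mul_of_nonneg_left ((norm_rankGeCount_mul_pow_le _ _).trans ?_) (by positivity)
    rw [mul_left_comm]
    refine mul_le_mul_of_nonneg_left ?_ (by positivity)
    rw [← Real.sq_sqrt (norm_nonneg q), Real.sqrt_sq hs0, ← pow_mul, ← pow_add]
    exact pow_le_pow_of_le_one hs0 hs1.le (by omega)

theorem rankMoment_two_mul_eq (n : ℕ) : (rankMoment 2 n : ℂ) * q ^ n =
    2 * ∑' m : ℕ, (2 * (m : ℂ) + 1) * (rankGeCount (m + 1) n * q ^ n) := by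
  rw [rankMoment_two, tsum_eq_sum (s := Finset.range n)]
  · push_cast
    rw [mul_assoc, Finset.sum_mul]
    simp only [mul_assoc]
  · intro m hm
    rw [rankGeCount_of_le (Nat.succ_pos m) (by simp at hm; omega)]
    simp

theorem summable_rankMoment_two (hq : ‖q‖ < 1) :
    Summable fun n : ℕ => (rankMoment 2 n : ℂ) * q ^ n := by
  simp only [rankMoment_two_mul_eq]
  exact Summable.mul_left 2 ((summable_rank_pairs hq).prod_symm.prod)

/-- Insert `G_(m+1) = P θ_(m+1)`, exchange the sums, and evaluate the sum over `m` by
`tsum_odd_mul_pow` at `q^(j+1)`. -/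
theorem rankMomentSeries_two (hq : ‖q‖ < 1) :
    rankMomentSeries 2 q = 2 * partitionSeries q *
      ∑' j : ℕ, (-1) ^ j * q ^ (pentExp j + (j + 1)) * (1 + q ^ (j + 1)) /
        (1 - q ^ (j + 1)) ^ 2 := by
  have h1 : rankMomentSeries 2 q = 2 * ∑' m : ℕ, (2 * (m : ℂ) + 1) * rankGeSeries (m + 1) q := by
    simp only [rankMomentSeries, rankMoment_two_mul_eq]
    rw [tsum_mul_left, Summable.tsum_comm (f := fun m n : ℕ =>
      (2 * (m : ℂ) + 1) * (rankGeCount (m + 1) n * q ^ n)) (summable_rank_pairs hq)]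
    simp only [tsum_mul_left, rankGeSeries]
  have h2 : Summable fun p : ℕ × ℕ => (2 * (p.1 : ℂ) + 1) *
      ((-1) ^ p.2 * q ^ ((p.2 + 1) * (p.1 + 1) + pentExp p.2)) := by
    refine summable_mul_of_le_mul (summable_odd_mul_pow (norm_nonneg q) hq)
      (summable_geometric_of_lt_one (norm_nonneg q) hq) (fun m => by positivity)
      (fun n => by positivity) fun m j => ?_
    dsimp only
    rw [norm_mul, norm_odd, mul_assoc]
    refine mul_le_mul_of_nonneg_left ?_ (by positivity)
    rw [norm_mul, norm_pow, norm_pow, norm_neg, norm_one, one_pow, one_mul, ← pow_add]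
    exact pow_le_pow_of_le_one (norm_nonneg q) hq.le (by have := lt_pentExp j; nlinarith)
  rw [h1, mul_assoc]
  congr 1
  rw [← tsum_mul_left (a := partitionSeries q)]
  calc ∑' m : ℕ, (2 * (m : ℂ) + 1) * rankGeSeries (m + 1) q
      = ∑' m : ℕ, partitionSeries q * ∑' j : ℕ, (2 * (m : ℂ) + 1) *
          ((-1) ^ j * q ^ ((j + 1) * (m + 1) + pentExp j)) := by
        refine tsum_congr fun m => ?_
        rw [rankGeSeries_eq_mul hq (Nat.succ_pos m), tsum_mul_left, rankTheta]
        ring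
    _ = ∑' j : ℕ, partitionSeries q * ((-1) ^ j * q ^ (pentExp j + (j + 1)) * (1 + q ^ (j + 1)) /
          (1 - q ^ (j + 1)) ^ 2) := by
        rw [tsum_mul_left, ← Summable.tsum_comm (f := fun m j : ℕ => (2 * (m : ℂ) + 1) *
          ((-1) ^ j * q ^ ((j + 1) * (m + 1) + pentExp j))) h2, tsum_mul_left]
        congr 1
        refine tsum_congr fun j => ?_
        have hx : ‖q ^ (j + 1)‖ < 1 := by
          rw [norm_pow]
          exact pow_lt_one₀ (norm_nonneg q) hq (by omega)
        rw [pow_add q (pentExp j), mul_assoc, mul_assoc, mul_div_assoc, mul_div_assoc,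
          ← tsum_odd_mul_pow hx, ← tsum_mul_left, ← tsum_mul_left]
        refine tsum_congr fun m => ?_
        ring

end

/-! ### The pentagonal number theorem and the theta series of the eta function -/

section

variable {q : ℂ}

theorem pentagonal_natCast_add_one (k : ℕ) : pentagonal ((k : ℤ) + 1) = pentExp k := by
  have h1 := two_mul_natCast_pentagonal ((k : ℤ) + 1)
  have h2 := two_mul_pentExp k
  zify at h2
  nlinarith

theorem pentagonal_neg_natCast_add_one (k : ℕ) :
    pentagonal (-((k : ℤ) + 1)) = pentExp k + (k + 1) := by
  have h1 := two_mul_natCast_pentagonal_neg ((k : ℤ) + 1)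
  have h2 := two_mul_pentExp k
  zify at h2 ⊢
  nlinarith

theorem norm_prod_one_sub_pow_le (hq : ‖q‖ < 1) (k n : ℕ) :
    ‖∏ i ∈ Finset.range n, (1 - q ^ (k + i + 1))‖ ≤ Real.exp (1 - ‖q‖)⁻¹ := by
  have h1 : ∀ i ∈ Finset.range n, ‖1 - q ^ (k + i + 1)‖ ≤ Real.exp (‖q‖ ^ i) := fun i _ => by
    refine (norm_sub_le _ _).trans ?_
    rw [norm_one, norm_pow, add_comm]
    refine le_trans ?_ (Real.add_one_le_exp _)
    gcongr ?_ + 1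
    exact pow_le_pow_of_le_one (norm_nonneg q) hq.le (by omega)
  rw [norm_prod]
  refine (Finset.prod_le_prod (fun i _ => norm_nonneg _) h1).trans ?_
  rw [← Real.exp_sum, ← tsum_geometric_of_lt_one (norm_nonneg q) hq]
  exact Real.exp_le_exp.mpr ((summable_geometric_of_lt_one (norm_nonneg q) hq).sum_le_tsum _
    fun i _ => by positivity)

theorem norm_pentagonal_tail_term_le (hq : ‖q‖ < 1) (k n : ℕ) :
    ‖q ^ ((k + 1) * n) * ∏ i ∈ Finset.range (n + 1), (1 - q ^ (k + i + 1))‖ ≤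
      ‖q‖ ^ n * Real.exp (1 - ‖q‖)⁻¹ := by
  rw [norm_mul, norm_pow]
  exact mul_le_mul (pow_le_pow_of_le_one (norm_nonneg q) hq.le (by nlinarith))
    (norm_prod_one_sub_pow_le hq k _) (norm_nonneg _) (by positivity)

/-- `rankTheta 0` collects the pentagonal numbers of positive index and `rankTheta 1` those of
negative index. The rest verifies the convergence hypotheses of `Pentagonal.tprod_one_sub_pow`,
through a bound on the tail products that is uniform in `k`. -/
theorem tprod_one_sub_pow_eq (hq : ‖q‖ < 1) :
    ∏' n : ℕ, (1 - q ^ (n + 1)) = 1 - rankTheta 0 q - rankTheta 1 q := by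
  have hgeo := summable_geometric_of_lt_one (norm_nonneg q) hq
  have hA : HasSum (fun k : ℕ => (-1) ^ k * q ^ pentagonal (-k)) (1 - rankTheta 1 q) := by
    refine (hasSum_nat_add_iff' 1).mp ?_
    have := (summable_rankTheta hq 1).hasSum.neg
    simp only [Finset.range_one, Finset.sum_singleton, pow_zero, Nat.cast_zero, neg_zero]
    convert! this using 1
    · ext k
      push_cast
      rw [pentagonal_neg_natCast_add_one]
      ring
    · rw [pentagonal_def, rankTheta]
      norm_num
  have hB : HasSum (fun k : ℕ => (-1) ^ k * q ^ pentagonal (k + 1)) (rankTheta 0 q) := by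
    have := (summable_rankTheta hq 0).hasSum
    simpa [pentagonal_natCast_add_one, rankTheta] using this
  have hAB : HasSum (fun k : ℕ => (-1) ^ k * (q ^ pentagonal (-k) - q ^ pentagonal (k + 1)))
      (1 - rankTheta 0 q - rankTheta 1 q) := by
    have := hA.sub hB
    simp only [← mul_sub] at this
    convert! this using 1
    ring
  have hC := hgeo.mul_right (Real.exp (1 - ‖q‖)⁻¹)
  have hsum : ∀ k, Summable
      (fun n ↦ q ^ ((k + 1) * n) * ∏ i ∈ Finset.range (n + 1), (1 - q ^ (k + i + 1))) := fun k =>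
    Summable.of_norm_bounded hC fun n => norm_pentagonal_tail_term_le hq k n
  rw [Pentagonal.tprod_one_sub_pow _ hsum _ hAB.summable _, hAB.tsum_eq]
  · exact tendsto_pow_atTop_nhds_zero_of_norm_lt_one hq
  · intro k
    have : Summable fun n : ℕ => ‖-q ^ (n + k + 1)‖ := by
      simpa [add_assoc] using (summable_nat_add_iff (k + 1)).mpr hgeo
    simpa [sub_eq_add_neg] using multipliable_one_add_of_summable this
  · refine squeeze_zero_norm (a := fun k : ℕ => ‖q‖ ^ k *
      ∑' n : ℕ, ‖q‖ ^ n * Real.exp (1 - ‖q‖)⁻¹) (fun k => ?_) ?_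
    · rw [norm_mul, norm_mul, norm_pow, norm_pow, norm_neg, norm_one, one_pow, one_mul]
      refine mul_le_mul (pow_le_pow_of_le_one (norm_nonneg q) hq.le ?_)
        (tsum_of_norm_bounded hC.hasSum fun n => norm_pentagonal_tail_term_le hq k n)
        (norm_nonneg _) (by positivity)
      rw [Nat.le_div_iff_mul_le two_pos]
      nlinarith
    · simpa using (tendsto_pow_atTop_nhds_zero_of_lt_one (norm_nonneg q) hq).mul_const
        (∑' n : ℕ, ‖q‖ ^ n * Real.exp (1 - ‖q‖)⁻¹)

/-- Both Euler's product and the inverse of `P` equal `1 - rankTheta 0 - rankTheta 1`, the former by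
the pentagonal number theorem and the latter by rank counting. -/
theorem partitionSeries_mul_tprod (hq : ‖q‖ < 1) :
    partitionSeries q * ∏' n : ℕ, (1 - q ^ (n + 1)) = 1 := by
  rw [tprod_one_sub_pow_eq hq, partitionSeries_mul_eq_one hq]

end

theorem norm_exp_two_pi_I_mul_lt_one {z : ℂ} (hz : 0 < z.im) :
    ‖Complex.exp (2 * Real.pi * Complex.I * z)‖ < 1 := by
  simpa using UpperHalfPlane.norm_exp_two_pi_I_lt_one ⟨z, hz⟩

theorem eta_eq_mul_tprod (z : ℂ) : ModularForm.eta z =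
    Complex.exp (Real.pi * Complex.I * z / 12) *
      ∏' n : ℕ, (1 - Complex.exp (2 * Real.pi * Complex.I * z) ^ (n + 1)) := by
  simp only [ModularForm.eta, ModularForm.eta_q_eq_pow, Function.Periodic.qParam]
  congr 2
  push_cast
  ring

/-- The theta series of the eta function, as a consequence of the pentagonal number theorem. -/
theorem hasSum_eta {z : ℂ} (hz : 0 < z.im) :
    HasSum (fun l : ℤ => (-1 : ℂ) ^ l *
      Complex.exp (Real.pi * Complex.I * z * (6 * l + 1) ^ 2 / 12)) (ModularForm.eta z) := by
  have hq := norm_exp_two_pi_I_mul_lt_one hz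
  set q := Complex.exp (2 * Real.pi * Complex.I * z) with hqdef
  set e := Complex.exp (Real.pi * Complex.I * z / 12) with he
  rw [eta_eq_mul_tprod, ← hqdef, ← he, tprod_one_sub_pow_eq hq]
  have hpow : ∀ n : ℕ, q ^ n = Complex.exp (2 * Real.pi * Complex.I * z * n) := fun n => by
    rw [hqdef, ← Complex.exp_nat_mul, mul_comm]
  have h2 : ∀ j : ℕ, (2 : ℂ) * pentExp j = (j + 1) * (3 * j + 2) := fun j => by
    exact_mod_cast two_mul_pentExp j
  have hA : HasSum (fun n : ℕ => (-1 : ℂ) ^ (n : ℤ) *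
      Complex.exp (Real.pi * Complex.I * z * (6 * (n : ℤ) + 1) ^ 2 / 12))
      (e * (1 - rankTheta 1 q)) := by
    refine (hasSum_nat_add_iff' 1).mp ?_
    have := ((summable_rankTheta hq 1).hasSum.mul_left e).neg
    convert! this using 1
    · ext j
      rw [hpow, he, ← mul_left_comm, ← Complex.exp_add, zpow_natCast, pow_succ]
      rw [show Real.pi * Complex.I * z / 12 +
        2 * Real.pi * Complex.I * z * ((((j + 1) * 1 + pentExp j : ℕ)) : ℂ) =
        Real.pi * Complex.I * z * (6 * ((j + 1 : ℕ) : ℤ) + 1) ^ 2 / 12 by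
          push_cast
          linear_combination (Real.pi * Complex.I * z) * h2 j]
      ring
    · rw [rankTheta, he]
      simp
      ring
  have hB : HasSum (fun n : ℕ => (-1 : ℂ) ^ (-((n : ℤ) + 1)) *
      Complex.exp (Real.pi * Complex.I * z * (6 * ((-((n : ℤ) + 1) : ℤ) : ℂ) + 1) ^ 2 / 12))
      (-(e * rankTheta 0 q)) := by
    have := ((summable_rankTheta hq 0).hasSum.mul_left e).neg
    convert! this using 1
    ext j
    rw [hpow, he, ← mul_left_comm, ← Complex.exp_add, zpow_neg, ← inv_zpow]
    rw [show Real.pi * Complex.I * z / 12 +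
      2 * Real.pi * Complex.I * z * ((((j + 1) * 0 + pentExp j : ℕ)) : ℂ) =
      Real.pi * Complex.I * z * (6 * ((-((j : ℤ) + 1) : ℤ) : ℂ) + 1) ^ 2 / 12 by
        push_cast
        linear_combination (Real.pi * Complex.I * z) * h2 j]
    rw [show (-1 : ℂ)⁻¹ = -1 by norm_num, show ((j : ℤ) + 1) = ((j + 1 : ℕ) : ℤ) by push_cast; rfl,
      zpow_natCast, pow_succ]
    ring
  have := HasSum.of_nat_of_neg_add_one (f := fun l : ℤ => (-1 : ℂ) ^ l *
      Complex.exp (Real.pi * Complex.I * z * (6 * l + 1) ^ 2 / 12)) hA hB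
  convert! this using 1
  ring

theorem neg_one_zpow_neg (l : ℤ) : (-1 : ℂ) ^ (-l) = (-1) ^ l := by
  rw [zpow_neg, ← inv_zpow]
  norm_num

/-- The three theta series `∑ (-1) ^ l exp (π i z (3 l + c - 1/2)² / 3)`, `c = 0, 1, 2`. -/
def etaTheta (c : ℕ) (z : ℂ) (l : ℤ) : ℂ :=
  (-1 : ℂ) ^ l * Complex.exp (Real.pi * Complex.I * z * (3 * l + c - 1 / 2) ^ 2 / 3)

theorem hasSum_etaTheta_one {z : ℂ} (hz : 0 < z.im) :
    HasSum (etaTheta 1 z) (ModularForm.eta z) := by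
  refine (hasSum_eta hz).congr_fun ?_
  intro l
  simp only [etaTheta]
  congr 2
  push_cast
  ring

theorem hasSum_etaTheta_zero {z : ℂ} (hz : 0 < z.im) :
    HasSum (etaTheta 0 z) (ModularForm.eta z) := by
  rw [← (Equiv.neg ℤ).hasSum_iff]
  refine (hasSum_eta hz).congr_fun ?_
  intro l
  simp only [etaTheta, Function.comp_apply, Equiv.neg_apply, neg_one_zpow_neg]
  congr 2
  push_cast
  ring

/-- The reflection `l ↦ -1 - l` fixes `(3l + 3/2)²` and flips the sign, so this residue class drops
out of the theta kernel. -/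
theorem etaTheta_two_neg (z : ℂ) (l : ℤ) : etaTheta 2 z (-1 - l) = -etaTheta 2 z l := by
  simp only [etaTheta]
  rw [show (-1 - l : ℤ) = -(l + 1) by ring, neg_one_zpow_neg, zpow_add_one₀ (by norm_num)]
  rw [show (3 * ((-(l + 1) : ℤ) : ℂ) + (2 : ℕ) - 1 / 2) ^ 2 = (3 * (l : ℂ) + (2 : ℕ) - 1 / 2) ^ 2 by
    push_cast; ring]
  ring

theorem tsum_etaTheta_two (z : ℂ) : ∑' l : ℤ, etaTheta 2 z l = 0 := by
  have h := (Equiv.subLeft (-1 : ℤ)).tsum_eq (etaTheta 2 z)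
  simp only [Equiv.subLeft_apply, etaTheta_two_neg, tsum_neg] at h
  exact self_eq_neg.mp h.symm

/-! ### Lattice sums -/

/-- The point `n τ + m` of the lattice `ℤ τ + ℤ`. -/
def latticePt (τ : ℍ) (p : ℤ × ℤ) : ℂ := p.1 * (τ : ℂ) + p.2

/-- The sign which is `1` on `2 Λ` and `-1` on the rest of the lattice `Λ`. -/
def latticeSign (p : ℤ × ℤ) : ℂ := if Even p.1 ∧ Even p.2 then 1 else -1

theorem norm_latticeSign (p : ℤ × ℤ) : ‖latticeSign p‖ = 1 := by
  unfold latticeSign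
  split_ifs <;> simp

theorem latticePt_neg (τ : ℍ) (p : ℤ × ℤ) : latticePt τ (-p) = -latticePt τ p := by
  simp only [latticePt, Prod.fst_neg, Prod.snd_neg]
  push_cast
  ring

theorem latticeSign_neg (p : ℤ × ℤ) : latticeSign (-p) = latticeSign p := by
  simp [latticeSign]

theorem latticePt_im (τ : ℍ) (p : ℤ × ℤ) : (latticePt τ p).im = p.1 * τ.im := by
  simp [latticePt]

theorem latticePt_re (τ : ℍ) (p : ℤ × ℤ) : (latticePt τ p).re = p.1 * τ.re + p.2 := by
  simp [latticePt]

theorem latticePt_zero (τ : ℍ) : latticePt τ 0 = 0 := by simp [latticePt]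

theorem latticePt_eq_zero_iff (τ : ℍ) (p : ℤ × ℤ) : latticePt τ p = 0 ↔ p = 0 := by
  refine ⟨fun h => ?_, fun h => by rw [h, latticePt_zero]⟩
  have h1 : p.1 = 0 := by
    have := congrArg Complex.im h
    rw [latticePt_im] at this
    simpa [τ.im_pos.ne'] using this
  have h2 := congrArg Complex.re h
  rw [latticePt_re, h1] at h2
  exact Prod.ext h1 (by simpa using h2)

theorem summable_int_natAbs {f : ℕ → ℝ} (hf : Summable f) :
    Summable fun n : ℤ => f n.natAbs :=
  Summable.of_nat_of_neg (by simpa using hf) (by simpa using hf)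

theorem summable_exp_neg_mul_int_sq {c : ℝ} (hc : 0 < c) :
    Summable fun n : ℤ => Real.exp (-c * (n : ℝ) ^ 2) := by
  have h1 : Summable fun n : ℕ => Real.exp (-c) ^ n :=
    summable_geometric_of_lt_one (Real.exp_pos _).le (by simpa using hc)
  refine Summable.of_nonneg_of_le (fun n => (Real.exp_pos _).le) (fun n => ?_)
    (summable_int_natAbs h1)
  rw [← Real.exp_nat_mul]
  refine Real.exp_le_exp.mpr ?_
  have h2 : (n.natAbs : ℝ) ≤ (n : ℝ) ^ 2 := by
    have : (n.natAbs : ℤ) ≤ n ^ 2 := by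
      rw [← Int.natAbs_sq]
      exact_mod_cast Nat.le_self_pow two_ne_zero _
    calc (n.natAbs : ℝ) = ((n.natAbs : ℤ) : ℝ) := (Int.cast_natCast _).symm
      _ ≤ ((n ^ 2 : ℤ) : ℝ) := Int.cast_le.mpr this
      _ = _ := by push_cast; rfl
  nlinarith

theorem summable_inv_one_add_natAbs_sq :
    Summable fun m : ℤ => ((1 + (m.natAbs : ℝ)) ^ 2)⁻¹ := by
  refine summable_int_natAbs (f := fun m : ℕ => ((1 + (m : ℝ)) ^ 2)⁻¹) ?_
  have := (summable_nat_add_iff 1).mpr (Real.summable_nat_pow_inv.mpr one_lt_two)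
  refine this.congr fun m => ?_
  push_cast
  rw [add_comm]

/-- `EisensteinSeries.r` bounds `‖nτ + m‖` below by a multiple of `max |n| |m|`; the factor 2
absorbs the added 1, as a nonzero lattice index has maximum at least 1. -/
theorem one_add_natAbs_mul_le_norm_latticePt (τ : ℍ) {p : ℤ × ℤ} (hp : p ≠ 0) :
    EisensteinSeries.r τ * (1 + (p.2.natAbs : ℝ)) ≤ 2 * ‖latticePt τ p‖ := by
  have hx : (![p.1, p.2] : Fin 2 → ℤ) ≠ 0 := fun h => hp (Prod.ext
    (by simpa using congrFun h 0) (by simpa using congrFun h 1))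
  have h1 := EisensteinSeries.r_mul_max_le τ hx
  rw [EisensteinSeries.norm_eq_max_natAbs] at h1
  simp only [Matrix.cons_val_zero, Matrix.cons_val_one] at h1
  have h2 : 1 + p.2.natAbs ≤ 2 * max p.1.natAbs p.2.natAbs := by
    by_cases h : p.2 = 0
    · have : p.1 ≠ 0 := fun h' => hp (Prod.ext h' h)
      omega
    · omega
  have h3 : (1 + p.2.natAbs : ℝ) ≤ 2 * (max p.1.natAbs p.2.natAbs : ℕ) := by exact_mod_cast h2
  have h4 := mul_le_mul_of_nonneg_left h3 (EisensteinSeries.r_pos τ).le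
  simp only [latticePt]
  linarith

/-- The basic convergent lattice sum. -/
theorem summable_lattice (τ : ℍ) {c : ℝ} (hc : 0 < c) :
    Summable fun p : ℤ × ℤ => Real.exp (-c * (p.1 : ℝ) ^ 2) / ‖latticePt τ p‖ ^ 2 := by
  have hr := EisensteinSeries.r_pos τ
  have h := ((summable_exp_neg_mul_int_sq hc).mul_of_nonneg summable_inv_one_add_natAbs_sq
    (fun n => (Real.exp_pos _).le) (fun n => by positivity)).mul_left
    (4 / EisensteinSeries.r τ ^ 2)
  refine Summable.of_nonneg_of_le (fun p => by positivity) (fun p => ?_) h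
  by_cases hp : p = 0
  · rw [hp, latticePt_zero]
    simp only [norm_zero, ne_eq, OfNat.ofNat_ne_zero, not_false_eq_true, zero_pow, div_zero]
    positivity
  · have h1 := one_add_natAbs_mul_le_norm_latticePt τ hp
    have h2 : (0 : ℝ) < 1 + (p.2.natAbs : ℝ) := by positivity
    have h3 : 0 < EisensteinSeries.r τ * (1 + (p.2.natAbs : ℝ)) := by positivity
    have h4 := pow_le_pow_left₀ h3.le h1 2
    have hn : 0 < ‖latticePt τ p‖ := by linarith
    rw [mul_left_comm, div_eq_mul_inv]
    refine mul_le_mul_of_nonneg_left ?_ (Real.exp_pos _).le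
    rw [← div_eq_mul_inv, div_div, inv_eq_one_div, div_le_div_iff₀ (by positivity) (by positivity)]
    linarith

theorem summable_of_norm_le_lattice (τ : ℍ) {c C : ℝ} (hc : 0 < c) {f : ℤ × ℤ → ℂ}
    (h : ∀ p, p ≠ 0 → ‖f p‖ ≤ C * (Real.exp (-c * (p.1 : ℝ) ^ 2) / ‖latticePt τ p‖ ^ 2)) :
    Summable f := by
  refine Summable.of_norm_bounded_eventually ((summable_lattice τ hc).mul_left C) ?_
  exact (Set.finite_singleton (0 : ℤ × ℤ)).subset fun p hp => by
    by_contra h0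
    exact hp (h p h0)

/-! ### Alternating sums over `ℤ` and the Lipschitz formula -/

theorem tsum_alternating {f : ℤ → ℂ} (hf : Summable f) :
    ∑' m : ℤ, (-1 : ℂ) ^ m * f m = 2 * ∑' j : ℤ, f (2 * j) - ∑' m : ℤ, f m := by
  have hinj : Function.Injective fun j : ℤ => 2 * j := mul_right_injective₀ two_ne_zero
  have h1 : Summable fun m : ℤ => (-1 : ℂ) ^ m * f m :=
    Summable.of_norm (by simpa using hf.norm)
  have h2 : Function.support (fun m : ℤ => (-1 : ℂ) ^ m * f m + f m) ⊆
      Set.range fun j : ℤ => 2 * j := by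
    intro m hm
    rcases Int.even_or_odd m with h | h
    · obtain ⟨j, hj⟩ := h
      exact ⟨j, by simp only; omega⟩
    · exact absurd (by simp [h.neg_one_zpow]) hm
  have h3 := hinj.tsum_eq h2
  rw [h1.tsum_add hf] at h3
  rw [eq_sub_iff_add_eq, ← h3, ← tsum_mul_left]
  refine tsum_congr fun j => ?_
  rw [(even_two_mul j).neg_one_zpow]
  ring

theorem summable_inv_add_int_sq (z : ℍ) : Summable fun m : ℤ => 1 / ((z : ℂ) + m) ^ 2 := by
  have := EisensteinSeries.e2Summand_summable 1 z
  refine this.congr fun m => ?_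
  simp [EisensteinSeries.eisSummand]

/-- The alternating Lipschitz formula. -/
theorem tsum_alternating_inv_sq (z : ℍ) :
    ∑' m : ℤ, (-1 : ℂ) ^ m * (1 / ((z : ℂ) + m) ^ 2) =
      -2 * Real.pi ^ 2 * (Complex.exp (Real.pi * Complex.I * z) *
        (1 + Complex.exp (2 * Real.pi * Complex.I * z)) /
          (1 - Complex.exp (2 * Real.pi * Complex.I * z)) ^ 2) := by
  have hz2 : 0 < ((z : ℂ) / 2).im := by
    have := z.im_pos
    rw [show (z : ℂ) / 2 = ((1 / 2 : ℝ) : ℂ) * z by push_cast; ring, Complex.im_ofReal_mul]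
    simpa using this
  set w : ℍ := ⟨(z : ℂ) / 2, hz2⟩ with hw
  have hwc : (w : ℂ) = (z : ℂ) / 2 := rfl
  have key : ∀ z : ℍ, ∑' m : ℤ, 1 / ((z : ℂ) + m) ^ 2 = -4 * Real.pi ^ 2 *
      (Complex.exp (2 * Real.pi * Complex.I * z) /
        (1 - Complex.exp (2 * Real.pi * Complex.I * z)) ^ 2) := fun z => by
    have h := EisensteinSeries.qExpansion_identity le_rfl z
    simp only [pow_one, Nat.factorial_one, Nat.cast_one, div_one] at h
    rw [tsum_coe_mul_geometric_of_norm_lt_one (UpperHalfPlane.norm_exp_two_pi_I_lt_one z)] at h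
    rw [show (1 + 1 : ℕ) = 2 from rfl] at h
    rw [h]
    congr 1
    linear_combination (4 * Real.pi ^ 2) * Complex.I_sq
  rw [tsum_alternating (summable_inv_add_int_sq z), key z]
  have h1 : ∑' j : ℤ, 1 / ((z : ℂ) + ((2 * j : ℤ) : ℂ)) ^ 2 =
      1 / 4 * ∑' j : ℤ, 1 / ((w : ℂ) + j) ^ 2 := by
    rw [← tsum_mul_left]
    refine tsum_congr fun j => ?_
    rw [hwc, show (z : ℂ) + ((2 * j : ℤ) : ℂ) = 2 * ((z : ℂ) / 2 + j) by push_cast; ring, mul_pow]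
    rw [one_div_mul_one_div]
    norm_num
  have hy : Complex.exp (2 * Real.pi * Complex.I * z) =
      Complex.exp (Real.pi * Complex.I * z) ^ 2 := by
    rw [← Complex.exp_nat_mul]
    congr 1
    push_cast
    ring
  have hy1 : ‖Complex.exp (2 * Real.pi * Complex.I * w)‖ < 1 :=
    UpperHalfPlane.norm_exp_two_pi_I_lt_one w
  rw [h1, key w, hy]
  rw [show 2 * Real.pi * Complex.I * (w : ℂ) = Real.pi * Complex.I * z by rw [hwc]; ring] at hy1 ⊢
  set y := Complex.exp (Real.pi * Complex.I * z) with hydef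
  have ha : 1 - y ≠ 0 := sub_ne_zero.mpr fun h => by simp [← h] at hy1
  have hb : 1 + y ≠ 0 := fun h => by
    rw [show y = -1 by linear_combination h] at hy1
    simp at hy1
  rw [show 1 - y ^ 2 = (1 - y) * (1 + y) by ring]
  field_simp
  ring

/-- The term `m = 0` is `1 / 0 = 0`. Separating even indices leaves `(1/2 - 1) · 2ζ(2) = -ζ(2)`. -/
theorem tsum_alternating_inv_int_sq :
    ∑' m : ℤ, (-1 : ℂ) ^ m * (1 / (m : ℂ) ^ 2) = -(Real.pi : ℂ) ^ 2 / 6 := by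
  have h0 := two_mul_riemannZeta_eq_tsum_int_inv_pow_of_even (k := 2) (by norm_num) even_two
  have hs : Summable fun m : ℤ => 1 / (m : ℂ) ^ 2 := by
    have := (Real.summable_one_div_int_pow (p := 2)).mpr one_lt_two
    exact Summable.of_norm (by simpa using this.norm)
  rw [tsum_alternating hs]
  have h1 : ∑' j : ℤ, 1 / (((2 * j : ℤ) : ℂ)) ^ 2 = 1 / 4 * ∑' j : ℤ, 1 / (j : ℂ) ^ 2 := by
    rw [← tsum_mul_left]
    refine tsum_congr fun j => ?_
    push_cast
    rw [mul_pow, one_div_mul_one_div]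
    norm_num
  rw [h1]
  simp only [one_div, Nat.cast_ofNat] at h0 ⊢
  rw [← h0, riemannZeta_two]
  ring

/-- Since `exp(3πi n m) = (-1)^(nm)`, an `SL₂(ℤ)`-invariant sign times this factor becomes
`(-1)^(n+m)`, the sign required by the alternating Lipschitz formula. -/
theorem latticeSign_mul_exp (τ : ℍ) (n m : ℤ) :
    latticeSign (n, m) * Complex.exp (3 * Real.pi * Complex.I * n * latticePt τ (n, m)) =
      (-1) ^ n * Complex.exp (3 * Real.pi * Complex.I * n ^ 2 * τ) * (-1) ^ m := by
  have h1 : Complex.exp (3 * Real.pi * Complex.I * n * latticePt τ (n, m)) =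
      Complex.exp (3 * Real.pi * Complex.I * n ^ 2 * τ) * (-1) ^ (n * m) := by
    rw [latticePt, show 3 * (Real.pi : ℂ) * Complex.I * n * (n * τ + m) =
      3 * Real.pi * Complex.I * n ^ 2 * τ +
        ((n * m : ℤ) * (Real.pi * Complex.I) + (n * m : ℤ) * (2 * Real.pi * Complex.I)) by
          push_cast; ring, Complex.exp_add, Complex.exp_add, Complex.exp_int_mul_two_pi_mul_I,
      mul_one, Complex.exp_int_mul, Complex.exp_pi_mul_I]
  rw [h1, latticeSign]
  rcases Int.even_or_odd n with hn | hn <;> rcases Int.even_or_odd m with hm | hm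
  · simp [hn, hm, hn.neg_one_zpow, hm.neg_one_zpow, (hn.mul_right m).neg_one_zpow]
  · simp [hn, hm, hn.neg_one_zpow, hm.neg_one_zpow, (hn.mul_right _).neg_one_zpow]
  · simp [hn, hm, hn.neg_one_zpow, hm.neg_one_zpow, (hm.mul_left _).neg_one_zpow]
  · simp [Int.not_even_iff_odd.mpr hn, hn.neg_one_zpow, hm.neg_one_zpow, (hn.mul hm).neg_one_zpow]

theorem norm_exp_three_pi_mul_latticePt (τ : ℍ) (p : ℤ × ℤ) :
    ‖Complex.exp (3 * Real.pi * Complex.I * p.1 * latticePt τ p)‖ =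
      Real.exp (-(3 * Real.pi * τ.im) * (p.1 : ℝ) ^ 2) := by
  rw [Complex.norm_exp]
  congr 1
  rw [show 3 * (Real.pi : ℂ) * Complex.I * p.1 * latticePt τ p =
    ((3 * Real.pi * p.1 : ℝ) : ℂ) * (Complex.I * latticePt τ p) by push_cast; ring,
    Complex.re_ofReal_mul, Complex.I_mul_re, latticePt_im]
  ring

/-! ### The second rank moment as a lattice sum -/

/-- The summand of the lattice sum that represents the second rank moment. -/
def rankSummand (τ : ℍ) (p : ℤ × ℤ) : ℂ :=
  latticeSign p * Complex.exp (3 * Real.pi * Complex.I * p.1 * latticePt τ p) / latticePt τ p ^ 2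

theorem summable_rankSummand (τ : ℍ) : Summable (rankSummand τ) := by
  have := τ.im_pos
  refine summable_of_norm_le_lattice τ (c := 3 * Real.pi * τ.im) (C := 1) (by positivity)
    fun p _ => ?_
  rw [rankSummand, norm_div, norm_mul, norm_latticeSign, norm_exp_three_pi_mul_latticePt, norm_pow,
    one_mul, one_mul]

theorem tsum_rankSummand_zero (τ : ℍ) :
    ∑' m : ℤ, rankSummand τ (0, m) = -(Real.pi : ℂ) ^ 2 / 6 := by
  rw [← tsum_alternating_inv_int_sq]
  refine tsum_congr fun m => ?_
  rw [rankSummand, latticeSign_mul_exp]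
  simp [latticePt, div_eq_mul_inv]

/-- Row `n = j + 1` is the alternating Lipschitz formula at `nτ`. The exponents of `q` add up to
`3n²/2 + n/2 = n(3n + 1)/2`, which is `pentExp j + n`. -/
theorem tsum_rankSummand_succ (τ : ℍ) (j : ℕ) :
    ∑' m : ℤ, rankSummand τ (((j + 1 : ℕ) : ℤ), m) =
      2 * Real.pi ^ 2 * ((-1) ^ j *
        Complex.exp (2 * Real.pi * Complex.I * τ) ^ (pentExp j + (j + 1)) *
          (1 + Complex.exp (2 * Real.pi * Complex.I * τ) ^ (j + 1)) /
          (1 - Complex.exp (2 * Real.pi * Complex.I * τ) ^ (j + 1)) ^ 2) := by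
  have hz : 0 < (((j + 1 : ℕ) : ℂ) * (τ : ℂ)).im := by
    rw [← Complex.ofReal_natCast, Complex.im_ofReal_mul]
    have := τ.im_pos
    rw [coe_im]
    positivity
  have h := tsum_alternating_inv_sq ⟨((j + 1 : ℕ) : ℂ) * (τ : ℂ), hz⟩
  simp only at h
  have h1 : ∀ m : ℤ, rankSummand τ (((j + 1 : ℕ) : ℤ), m) =
      ((-1) ^ (j + 1) * Complex.exp (3 * Real.pi * Complex.I * ((j + 1 : ℕ) : ℂ) ^ 2 * τ)) *
        ((-1) ^ m * (1 / (((j + 1 : ℕ) : ℂ) * (τ : ℂ) + m) ^ 2)) := fun m => by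
    rw [rankSummand, latticeSign_mul_exp, latticePt, zpow_natCast]
    push_cast
    ring
  simp only [h1]
  rw [tsum_mul_left, h]
  have h2 : Complex.exp (2 * Real.pi * Complex.I * (((j + 1 : ℕ) : ℂ) * (τ : ℂ))) =
      Complex.exp (2 * Real.pi * Complex.I * τ) ^ (j + 1) := by
    rw [← Complex.exp_nat_mul]
    congr 1
    ring
  have h3 : Complex.exp (3 * Real.pi * Complex.I * ((j + 1 : ℕ) : ℂ) ^ 2 * τ) *
      Complex.exp (Real.pi * Complex.I * (((j + 1 : ℕ) : ℂ) * (τ : ℂ))) =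
      Complex.exp (2 * Real.pi * Complex.I * τ) ^ (pentExp j + (j + 1)) := by
    have h4 : (2 : ℂ) * pentExp j = (j + 1) * (3 * j + 2) := by exact_mod_cast two_mul_pentExp j
    rw [← Complex.exp_nat_mul, ← Complex.exp_add]
    congr 1
    push_cast
    linear_combination (-Real.pi * Complex.I * τ) * h4
  rw [h2, ← h3]
  ring

theorem rankSummand_neg (τ : ℍ) (p : ℤ × ℤ) : rankSummand τ (-p) = rankSummand τ p := by
  simp only [rankSummand, latticePt_neg, latticeSign_neg, Prod.fst_neg]
  push_cast
  simp

/-- The second rank moment as a lattice sum. -/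
theorem tsum_rankSummand (τ : ℍ) : ∑' p : ℤ × ℤ, rankSummand τ p =
    4 * Real.pi ^ 2 * (1 / 2 * rankMomentSeries 2 (Complex.exp (2 * Real.pi * Complex.I * τ)) *
      ∏' n : ℕ, (1 - Complex.exp (2 * Real.pi * Complex.I * τ) ^ (n + 1)) - 1 / 24) := by
  have hq := UpperHalfPlane.norm_exp_two_pi_I_lt_one τ
  set q := Complex.exp (2 * Real.pi * Complex.I * τ) with hqdef
  have hs := summable_rankSummand τ
  rw [hs.tsum_prod]
  set F : ℤ → ℂ := fun n => ∑' m : ℤ, rankSummand τ (n, m) with hF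
  have hFs : Summable F := hs.prod
  have hFneg : ∀ n, F (-n) = F n := fun n => by
    simp only [hF]
    rw [← (Equiv.neg ℤ).tsum_eq]
    refine tsum_congr fun m => ?_
    exact rankSummand_neg τ (n, m)
  -- Rows `n` and `-n` agree, and row 0 is `-π²/6 = 4π² · (-1/24)`, the constant in the statement.
  have h1 : ∑' n : ℤ, F n = F 0 + 2 * ∑' j : ℕ, F ((j + 1 : ℕ) : ℤ) := by
    have hnat : Summable fun n : ℕ => F n := hFs.comp_injective Nat.cast_injective
    have hneg : HasSum (fun n : ℕ => F (-(n : ℤ))) (∑' n : ℕ, F n) := by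
      simpa only [hFneg] using hnat.hasSum
    rw [(HasSum.of_nat_of_neg hnat.hasSum hneg).tsum_eq, hnat.tsum_eq_zero_add]
    simp only [Nat.cast_zero]
    ring
  rw [h1]
  simp only [hF, tsum_rankSummand_succ, tsum_rankSummand_zero, ← hqdef]
  rw [tsum_mul_left, rankMomentSeries_two hq]
  have := partitionSeries_mul_tprod hq
  linear_combination (-4 * Real.pi ^ 2 * ∑' j : ℕ, (-1) ^ j * q ^ (pentExp j + (j + 1)) *
    (1 + q ^ (j + 1)) / (1 - q ^ (j + 1)) ^ 2) * this

/-! ### The theta kernel -/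

theorem summable_etaTheta (c : ℕ) {z : ℂ} (hz : 0 < z.im) : Summable (etaTheta c z) := by
  have h3 : 0 < (3 * z).im := by
    rw [show (3 : ℂ) * z = ((3 : ℝ) : ℂ) * z by push_cast; rfl, Complex.im_ofReal_mul]
    positivity
  have h := ((summable_jacobiTheta₂_term_iff (z * (c - 1 / 2)) (3 * z)).mpr h3).norm.mul_left
    ‖Complex.exp (Real.pi * Complex.I * z * (c - 1 / 2) ^ 2 / 3)‖
  refine Summable.of_norm (h.congr fun l => ?_)
  rw [etaTheta, norm_mul, norm_zpow, norm_neg, norm_one, one_zpow, one_mul, ← norm_mul,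
    jacobiTheta₂_term, ← Complex.exp_add]
  congr 2
  ring

/-- The dual summand of the theta kernel. -/
def dualKernel (z w : ℂ) (p : ℤ × ℤ) : ℂ :=
  (-1) ^ p.1 * Complex.exp (Real.pi * Complex.I / 3 *
    (z * (p.2 + 3 * p.1 - 1 / 2) ^ 2 + w * (p.2 - 1 / 2) ^ 2))

/-- Writing the dual variable as `k = 3l + c` decouples the quadratic form into two theta series of
the same class modulo 3. -/
theorem dualKernel_eq (z w : ℂ) (c : ℕ) (n l : ℤ) :
    dualKernel z w (n, 3 * l + c) = etaTheta c z (l + n) * etaTheta c w l := by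
  rw [dualKernel, etaTheta, etaTheta, mul_mul_mul_comm, ← Complex.exp_add,
    zpow_add₀ (by norm_num : (-1 : ℂ) ≠ 0)]
  have h : (-1 : ℂ) ^ l * (-1) ^ l = 1 := by
    rw [← mul_zpow]
    simp
  rw [show (-1 : ℂ) ^ l * (-1) ^ n * (-1) ^ l = (-1) ^ n by linear_combination ((-1) ^ n) * h]
  congr 2
  push_cast
  ring

theorem hasSum_dualKernel_residue {z w : ℂ} (hz : 0 < z.im) (hw : 0 < w.im) {c : ℕ} (hc : c < 3) :
    HasSum (fun p : ℤ × ℤ => if p.2 % 3 = c then dualKernel z w p else 0)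
      ((∑' l, etaTheta c z l) * ∑' l, etaTheta c w l) := by
  have h1 := (summable_etaTheta c hz).hasSum.mul (summable_etaTheta c hw).hasSum
    (summable_mul_of_summable_norm (summable_etaTheta c hz).norm (summable_etaTheta c hw).norm)
  have hsh : Function.Bijective fun p : ℤ × ℤ => (p.2 + p.1, p.2) := by
    refine ⟨fun p p' h => ?_, fun p => ⟨(p.1 - p.2, p.2), by simp⟩⟩
    simp only [Prod.mk.injEq] at h
    exact Prod.ext (by omega) h.2
  rw [← (Equiv.ofBijective _ hsh).hasSum_iff] at h1
  have hinj : Function.Injective fun p : ℤ × ℤ => (p.1, 3 * p.2 + (c : ℤ)) := fun p p' h => by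
    simp only [Prod.mk.injEq] at h
    exact Prod.ext h.1 (by omega)
  refine (hinj.hasSum_iff ?_).mp (h1.congr_fun fun p => ?_)
  · rintro ⟨n, k⟩ hk
    refine if_neg fun h => hk ⟨(n, k / 3), Prod.ext rfl ?_⟩
    simp only at h ⊢
    omega
  · simp only [Function.comp_apply, Equiv.ofBijective_apply]
    rw [if_pos (by omega), dualKernel_eq]

/-- Residues 0 and 1 modulo 3 each contribute `η(z) η(w)`, while residue 2 vanishes by antisymmetry;
hence the factor 2. -/
theorem hasSum_dualKernel {z w : ℂ} (hz : 0 < z.im) (hw : 0 < w.im) :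
    HasSum (dualKernel z w) (2 * ModularForm.eta z * ModularForm.eta w) := by
  have h0 := hasSum_dualKernel_residue hz hw (c := 0) (by norm_num)
  have h1 := hasSum_dualKernel_residue hz hw (c := 1) (by norm_num)
  have h2 := hasSum_dualKernel_residue hz hw (c := 2) (by norm_num)
  rw [(hasSum_etaTheta_zero hz).tsum_eq, (hasSum_etaTheta_zero hw).tsum_eq] at h0
  rw [(hasSum_etaTheta_one hz).tsum_eq, (hasSum_etaTheta_one hw).tsum_eq] at h1
  rw [tsum_etaTheta_two, zero_mul] at h2
  have h := (h0.add h1).add h2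
  rw [show ModularForm.eta z * ModularForm.eta w + ModularForm.eta z * ModularForm.eta w + 0 =
    2 * ModularForm.eta z * ModularForm.eta w by ring] at h
  refine h.congr_fun fun p => ?_
  have : p.2 % 3 = 0 ∨ p.2 % 3 = 1 ∨ p.2 % 3 = 2 := by omega
  rcases this with h | h | h <;> simp [h]

/-- The summand of the theta kernel. -/
def thetaKernel (τ : ℍ) (ρ : ℝ) (p : ℤ × ℤ) : ℂ :=
  latticeSign p * Complex.exp (3 * Real.pi * Complex.I * p.1 * latticePt τ p -
    3 * Real.pi / ρ * latticePt τ p ^ 2)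

/-- Poisson summation in `m` for fixed `n`. -/
theorem tsum_thetaKernel_fiber (τ : ℍ) {ρ : ℝ} (hρ : 0 < ρ) (n : ℤ) :
    ∑' m : ℤ, thetaKernel τ ρ (n, m) =
      (√(ρ / 3) : ℝ) * ∑' k : ℤ, dualKernel τ (-τ + Complex.I * ρ) (n, k) := by
  have hρ' : (ρ : ℂ) ≠ 0 := Complex.ofReal_ne_zero.mpr hρ.ne'
  set a : ℂ := ((3 / ρ : ℝ) : ℂ) with ha
  have hare : 0 < a.re := by rw [ha, Complex.ofReal_re]; positivity
  -- The summand `i/2` encodes the sign `(-1)^m`; the rest is the cross term of `(nτ + m)²`.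
  set b : ℂ := Complex.I / 2 - 3 / ρ * (n * τ) with hb
  have hP := Complex.tsum_exp_neg_quadratic hare b
  have hsqrt : 1 / a ^ (1 / 2 : ℂ) = ((√(ρ / 3) : ℝ) : ℂ) := by
    rw [ha, show (1 / 2 : ℂ) = ((1 / 2 : ℝ) : ℂ) by push_cast; rfl,
      ← Complex.ofReal_cpow (by positivity), ← Real.sqrt_eq_rpow, ← Complex.ofReal_one,
      ← Complex.ofReal_div, one_div, ← Real.sqrt_inv, inv_div]
  rw [hsqrt] at hP
  set E : ℂ := (-1) ^ n * Complex.exp (3 * Real.pi * Complex.I * n ^ 2 * τ -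
    3 * Real.pi / ρ * (n * τ) ^ 2) with hE
  have h1 : ∀ m : ℤ, thetaKernel τ ρ (n, m) =
      E * Complex.exp (-Real.pi * a * m ^ 2 + 2 * Real.pi * b * m) := fun m => by
    have hm : (-1 : ℂ) ^ m = Complex.exp (m * (Real.pi * Complex.I)) := by
      rw [Complex.exp_int_mul, Complex.exp_pi_mul_I]
    rw [thetaKernel, sub_eq_add_neg, Complex.exp_add, ← mul_assoc, latticeSign_mul_exp, hE, hm,
      mul_assoc ((-1 : ℂ) ^ n), mul_assoc ((-1 : ℂ) ^ n), mul_assoc ((-1 : ℂ) ^ n)]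
    congr 1
    rw [← Complex.exp_add, ← Complex.exp_add, ← Complex.exp_add]
    congr 1
    rw [latticePt, ha, hb]
    push_cast
    ring
  simp only [h1]
  rw [tsum_mul_left, hP, mul_left_comm, ← tsum_mul_left (a := E)]
  congr 1
  refine tsum_congr fun k => ?_
  rw [hE, dualKernel, mul_assoc, ← Complex.exp_add]
  congr 2
  rw [ha, hb]
  push_cast
  field_simp
  linear_combination (12 * n * τ * Complex.I * ρ - 36 * n ^ 2 * (τ : ℂ) ^ 2 - Complex.I ^ 2 * ρ ^ 2 -
    4 * ρ ^ 2 * k ^ 2) * Complex.I_sq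

theorem norm_thetaKernel (τ : ℍ) (ρ : ℝ) (p : ℤ × ℤ) :
    ‖thetaKernel τ ρ p‖ = Real.exp (-(3 * Real.pi * τ.im) * (p.1 : ℝ) ^ 2 -
      3 * Real.pi / ρ * ((latticePt τ p).re ^ 2 - (latticePt τ p).im ^ 2)) := by
  rw [thetaKernel, norm_mul, norm_latticeSign, one_mul, sub_eq_add_neg, Complex.exp_add, norm_mul,
    norm_exp_three_pi_mul_latticePt, sub_eq_add_neg, Real.exp_add]
  congr 1
  rw [Complex.norm_exp]
  congr 1
  rw [show (3 * (Real.pi : ℂ) / ρ) = ((3 * Real.pi / ρ : ℝ) : ℂ) by push_cast; rfl, Complex.neg_re,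
    Complex.re_ofReal_mul, sq (latticePt τ p), Complex.mul_re, sq, sq]

/-- The growing factor `exp(3π (nv)²/ρ)` is controlled by `(nv)²/ρ ≤ n²v/2`, valid for `ρ ≥ 2v`. The
constants leave Gaussian decay both in `n` and in `‖ω‖ / √ρ`. -/
theorem norm_thetaKernel_le (τ : ℍ) {ρ : ℝ} (hρ : 2 * τ.im ≤ ρ) (p : ℤ × ℤ) :
    ‖thetaKernel τ ρ p‖ ≤ Real.exp (-(3 * Real.pi * τ.im / 4) * (p.1 : ℝ) ^ 2) *
      Real.exp (-(3 * Real.pi / 2 * ‖latticePt τ p‖ ^ 2 / ρ)) := by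
  have hv := τ.im_pos
  have hρ0 : 0 < ρ := by linarith
  rw [norm_thetaKernel, ← Real.exp_add, ← Complex.normSq_eq_norm_sq, Complex.normSq_apply,
    latticePt_im]
  refine Real.exp_le_exp.mpr ?_
  set x := (latticePt τ p).re
  set n : ℝ := (p.1 : ℝ)
  set v := τ.im
  have h1 : 0 ≤ x ^ 2 / ρ := by positivity
  have h2 : (n * v) ^ 2 / ρ ≤ n ^ 2 * v / 2 := by
    rw [div_le_div_iff₀ hρ0 two_pos]
    nlinarith [mul_nonneg (sq_nonneg n) hv.le]
  have hpi := Real.pi_pos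
  have h3 : 0 ≤ Real.pi * (x ^ 2 / ρ) := by positivity
  have h4 := mul_le_mul_of_nonneg_left h2 hpi.le
  have e1 : 3 * Real.pi / ρ * (x ^ 2 - (n * v) ^ 2) =
    3 * (Real.pi * (x ^ 2 / ρ)) - 3 * (Real.pi * ((n * v) ^ 2 / ρ)) := by ring
  have e2 : 3 * Real.pi / 2 * (x * x + n * v * (n * v)) / ρ =
    3 / 2 * (Real.pi * (x ^ 2 / ρ)) + 3 / 2 * (Real.pi * ((n * v) ^ 2 / ρ)) := by ring
  rw [e1, e2]
  linarith

theorem norm_thetaKernel_le_one (τ : ℍ) {ρ : ℝ} (hρ : 2 * τ.im ≤ ρ) (p : ℤ × ℤ) :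
    ‖thetaKernel τ ρ p‖ ≤ 1 := by
  have hv := τ.im_pos
  have hρ0 : 0 < ρ := by linarith
  refine (norm_thetaKernel_le τ hρ p).trans (mul_le_one₀ ?_ (Real.exp_pos _).le ?_)
  · rw [Real.exp_le_one_iff, neg_mul, neg_nonpos]
    positivity
  · rw [Real.exp_le_one_iff, neg_nonpos]
    positivity

theorem summable_thetaKernel (τ : ℍ) {ρ : ℝ} (hρ : 2 * τ.im ≤ ρ) : Summable (thetaKernel τ ρ) := by
  have hv := τ.im_pos
  have hρ0 : 0 < ρ := by linarith
  refine summable_of_norm_le_lattice τ (c := 3 * Real.pi * τ.im / 4)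
    (C := 2 * ρ / (3 * Real.pi)) (by positivity) fun p hp => ?_
  have hn : 0 < ‖latticePt τ p‖ := norm_pos_iff.mpr ((latticePt_eq_zero_iff τ p).not.mpr hp)
  refine (norm_thetaKernel_le τ hρ p).trans ?_
  rw [div_eq_mul_inv (Real.exp _), mul_left_comm]
  refine mul_le_mul_of_nonneg_left ?_ (Real.exp_pos _).le
  set y := 3 * Real.pi / 2 * ‖latticePt τ p‖ ^ 2 / ρ with hy
  have hy0 : 0 < y := by positivity
  rw [show 2 * ρ / (3 * Real.pi) * (‖latticePt τ p‖ ^ 2)⁻¹ = y⁻¹ by rw [hy]; field_simp,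
    Real.exp_neg]
  exact inv_anti₀ hy0 (by linarith [Real.add_one_le_exp y])

/-- The theta kernel factors as a product of two eta functions. -/
theorem tsum_thetaKernel (τ : ℍ) {ρ : ℝ} (hρ : 2 * τ.im ≤ ρ) :
    ∑' p : ℤ × ℤ, thetaKernel τ ρ p = (√(ρ / 3) : ℝ) *
      (2 * ModularForm.eta τ * ModularForm.eta (-τ + Complex.I * ρ)) := by
  have hv := τ.im_pos
  have hw : 0 < (-(τ : ℂ) + Complex.I * ρ).im := by
    simp
    linarith
  have h := hasSum_dualKernel τ.im_pos hw
  rw [(summable_thetaKernel τ hρ).tsum_prod, ← h.tsum_eq, h.summable.tsum_prod]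
  simp only [tsum_thetaKernel_fiber τ (show 0 < ρ by linarith)]
  rw [tsum_mul_left]

/-! ### Integrating the theta kernel -/

section Integral

open MeasureTheory Set Filter Topology

theorem hasDerivAt_neg_div_add {a : ℝ} (A : ℝ) {r : ℝ} (h : 0 < a + r) :
    HasDerivAt (fun r : ℝ => -(A / (a + r))) (A / (a + r) ^ 2) r := by
  have h1 := ((hasDerivAt_id r).const_add a).inv h.ne'
  have h2 := (h1.const_mul A).neg
  simp only [id_eq] at h2
  convert! h2 using 1
  ring

theorem tendsto_neg_div_add (a A : ℝ) :
    Tendsto (fun r : ℝ => -(A / (a + r))) atTop (𝓝 0) := by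
  have h1 : Tendsto (fun r : ℝ => a + r) atTop atTop := tendsto_atTop_add_const_left _ _ tendsto_id
  simpa using (h1.const_div_atTop A).neg

theorem integrableOn_div_add_sq {a A : ℝ} (ha : 0 < a) (hA : 0 ≤ A) :
    IntegrableOn (fun r : ℝ => A / (a + r) ^ 2) (Ioi 0) := by
  refine integrableOn_Ioi_deriv_of_nonneg (g := fun r : ℝ => -(A / (a + r)))
    (hasDerivAt_neg_div_add A (by linarith)).continuousAt.continuousWithinAt
    (fun r hr => hasDerivAt_neg_div_add A (by linarith [mem_Ioi.mp hr]))
    (fun r hr => by positivity) (tendsto_neg_div_add a A)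

theorem hasDerivAt_exp_neg_div {a A : ℝ} {r : ℝ} (h : 0 < a + r) :
    HasDerivAt (fun r : ℝ => Real.exp (-(A / (a + r))))
      (Real.exp (-(A / (a + r))) * (A / (a + r) ^ 2)) r :=
  (hasDerivAt_neg_div_add A h).exp

theorem integrableOn_exp_neg_div {a A : ℝ} (ha : 0 < a) (hA : 0 ≤ A) :
    IntegrableOn (fun r : ℝ => Real.exp (-(A / (a + r))) * (A / (a + r) ^ 2)) (Ioi 0) := by
  refine integrableOn_Ioi_deriv_of_nonneg (g := fun r : ℝ => Real.exp (-(A / (a + r))))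
    (hasDerivAt_exp_neg_div (by linarith)).continuousAt.continuousWithinAt
    (fun r hr => hasDerivAt_exp_neg_div (by linarith [mem_Ioi.mp hr]))
    (fun r hr => by positivity) (((Real.continuous_exp.tendsto _).comp (tendsto_neg_div_add a A)))

/-- The integrand is the derivative of `exp(-A/(a+r))`, which stays between 0 and 1; the bound is
therefore independent of `A`. -/
theorem integral_exp_neg_div_le {a A : ℝ} (ha : 0 < a) (hA : 0 ≤ A) :
    ∫ r in Ioi (0 : ℝ), Real.exp (-(A / (a + r))) * (A / (a + r) ^ 2) ≤ 1 := by
  rw [integral_Ioi_of_hasDerivAt_of_nonneg (g := fun r : ℝ => Real.exp (-(A / (a + r))))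
    (hasDerivAt_exp_neg_div (by linarith)).continuousAt.continuousWithinAt
    (fun r hr => hasDerivAt_exp_neg_div (by linarith [mem_Ioi.mp hr]))
    (fun r hr => by positivity) ((Real.continuous_exp.tendsto _).comp (tendsto_neg_div_add a A))]
  simp [(Real.exp_pos _).le]

variable (τ : ℍ)

/-- The integrand whose lattice sum is the theta kernel integral. -/
def kernelIntegrand (p : ℤ × ℤ) (r : ℝ) : ℂ :=
  thetaKernel τ (2 * τ.im + r) p * ((3 * Real.pi / (2 * τ.im + r) ^ 2 : ℝ) : ℂ)

theorem norm_kernelIntegrand_le {r : ℝ} (hr : 0 ≤ r) (p : ℤ × ℤ) :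
    ‖kernelIntegrand τ p r‖ ≤ 3 * Real.pi / (2 * τ.im + r) ^ 2 := by
  have hv := τ.im_pos
  rw [kernelIntegrand, norm_mul, Complex.norm_real, Real.norm_of_nonneg (by positivity)]
  exact mul_le_of_le_one_left (by positivity) (norm_thetaKernel_le_one τ (by linarith) p)

theorem continuousOn_kernelIntegrand (p : ℤ × ℤ) :
    ContinuousOn (kernelIntegrand τ p) (Ici 0) := by
  intro r hr
  have hv := τ.im_pos
  have h : 2 * τ.im + r ≠ 0 := by
    have := mem_Ici.mp hr
    linarith
  have hc : ((2 * τ.im + r : ℝ) : ℂ) ≠ 0 := Complex.ofReal_ne_zero.mpr h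
  refine ContinuousAt.continuousWithinAt ?_
  unfold kernelIntegrand thetaKernel
  refine ContinuousAt.mul (ContinuousAt.mul continuousAt_const
    (ContinuousAt.cexp (ContinuousAt.sub continuousAt_const
      (ContinuousAt.mul (ContinuousAt.div continuousAt_const ?_ hc) continuousAt_const)))) ?_
  · fun_prop
  · refine Complex.continuous_ofReal.continuousAt.comp
      (ContinuousAt.div continuousAt_const (by fun_prop) (by positivity))

theorem integrableOn_kernelIntegrand (p : ℤ × ℤ) :
    IntegrableOn (kernelIntegrand τ p) (Ioi 0) := by
  have hv := τ.im_pos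
  refine Integrable.mono' (integrableOn_div_add_sq (a := 2 * τ.im) (A := 3 * Real.pi)
    (by positivity) (by positivity)) ?_ ?_
  · exact ((continuousOn_kernelIntegrand τ p).mono Ioi_subset_Ici_self).aestronglyMeasurable
      measurableSet_Ioi
  · exact (ae_restrict_iff' measurableSet_Ioi).mpr
      (Eventually.of_forall fun r hr => norm_kernelIntegrand_le τ (mem_Ioi.mp hr).le p)

/-- Taking `A = 3π‖ω‖²/2` makes the majorant an exact derivative times `3π/A = 2/‖ω‖²`, which
produces the summable weight of `summable_lattice`. -/
theorem integral_norm_kernelIntegrand_le {p : ℤ × ℤ} (hp : p ≠ 0) :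
    ∫ r in Ioi (0 : ℝ), ‖kernelIntegrand τ p r‖ ≤
      2 * (Real.exp (-(3 * Real.pi * τ.im / 4) * (p.1 : ℝ) ^ 2) / ‖latticePt τ p‖ ^ 2) := by
  have hv := τ.im_pos
  have hn : 0 < ‖latticePt τ p‖ := norm_pos_iff.mpr ((latticePt_eq_zero_iff τ p).not.mpr hp)
  set A := 3 * Real.pi / 2 * ‖latticePt τ p‖ ^ 2 with hA
  have hA0 : 0 ≤ A := by positivity
  set D := 2 * (Real.exp (-(3 * Real.pi * τ.im / 4) * (p.1 : ℝ) ^ 2) / ‖latticePt τ p‖ ^ 2) with hD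
  have hle : ∫ r in Ioi (0 : ℝ), ‖kernelIntegrand τ p r‖ ≤
      ∫ r in Ioi (0 : ℝ), D * (Real.exp (-(A / (2 * τ.im + r))) * (A / (2 * τ.im + r) ^ 2)) := by
    refine setIntegral_mono_on (integrableOn_kernelIntegrand τ p).norm
      ((integrableOn_exp_neg_div (by positivity) hA0).const_mul D) measurableSet_Ioi
      fun r hr => ?_
    have hr0 := mem_Ioi.mp hr
    rw [kernelIntegrand, norm_mul, Complex.norm_real, Real.norm_of_nonneg (by positivity)]
    refine (mul_le_mul_of_nonneg_right (norm_thetaKernel_le τ (by linarith) p)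
      (by positivity)).trans_eq ?_
    rw [hD, ← hA]
    generalize Real.exp (-(A / (2 * τ.im + r))) = E
    rw [hA]
    field_simp
  refine hle.trans ?_
  rw [integral_const_mul]
  exact mul_le_of_le_one_right (by positivity) (integral_exp_neg_div_le (by positivity) hA0)

theorem summable_integral_norm_kernelIntegrand :
    Summable fun p : ℤ × ℤ => ∫ r in Ioi (0 : ℝ), ‖kernelIntegrand τ p r‖ := by
  have hv := τ.im_pos
  refine Summable.of_norm_bounded_eventually ((summable_lattice τ
    (c := 3 * Real.pi * τ.im / 4) (by positivity)).mul_left 2) ?_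
  refine (Set.finite_singleton (0 : ℤ × ℤ)).subset fun p hp => ?_
  by_contra h0
  refine hp ?_
  change ‖∫ r in Ioi (0 : ℝ), ‖kernelIntegrand τ p r‖‖ ≤ _
  rw [Real.norm_of_nonneg (integral_nonneg fun r => norm_nonneg _)]
  exact integral_norm_kernelIntegrand_le τ h0

/-- The Eichler integral of the eta function. -/
def etaIntegral : ℂ :=
  ∫ r in Ioi (0 : ℝ), ModularForm.eta (-(starRingEnd ℂ) (τ : ℂ) + Complex.I * r) *
    (((2 * τ.im + r) ^ (-(3 / 2) : ℝ) : ℝ) : ℂ)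

theorem neg_add_I_mul_two_im_add (r : ℝ) :
    -(τ : ℂ) + Complex.I * ((2 * τ.im + r : ℝ) : ℂ) =
      -(starRingEnd ℂ) (τ : ℂ) + Complex.I * r := by
  apply Complex.ext <;> simp
  ring

theorem tsum_kernelIntegrand {r : ℝ} (hr : 0 < r) : ∑' p : ℤ × ℤ, kernelIntegrand τ p r =
    (2 * √3 * Real.pi : ℝ) * ModularForm.eta τ *
      (ModularForm.eta (-(starRingEnd ℂ) (τ : ℂ) + Complex.I * r) *
        (((2 * τ.im + r) ^ (-(3 / 2) : ℝ) : ℝ) : ℂ)) := by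
  have hv := τ.im_pos
  have hρ : 0 < 2 * τ.im + r := by linarith
  simp only [kernelIntegrand]
  rw [tsum_mul_right, tsum_thetaKernel τ (by linarith), neg_add_I_mul_two_im_add]
  have h : √((2 * τ.im + r) / 3) * 2 * (3 * Real.pi / (2 * τ.im + r) ^ 2) =
      2 * √3 * Real.pi * (2 * τ.im + r) ^ (-(3 / 2) : ℝ) := by
    set ρ := 2 * τ.im + r
    have h3 : √3 * √3 = 3 := Real.mul_self_sqrt (by norm_num)
    have h4 : ρ ^ (-(3 / 2) : ℝ) = √ρ / ρ ^ 2 := by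
      rw [Real.sqrt_eq_rpow, ← Real.rpow_natCast, ← Real.rpow_sub hρ]
      norm_num
    rw [Real.sqrt_div hρ.le, h4]
    field_simp
    linear_combination (-1) * h3
  have hC := congrArg (fun x : ℝ => (x : ℂ)) h
  simp only [Complex.ofReal_mul, Complex.ofReal_ofNat] at hC ⊢
  linear_combination (ModularForm.eta τ *
    ModularForm.eta (-(starRingEnd ℂ) (τ : ℂ) + Complex.I * r)) * hC

theorem hasSum_integral_kernelIntegrand :
    HasSum (fun p : ℤ × ℤ => ∫ r in Ioi (0 : ℝ), kernelIntegrand τ p r)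
      ((2 * √3 * Real.pi : ℝ) * ModularForm.eta τ * etaIntegral τ) := by
  have h := hasSum_integral_of_summable_integral_norm (fun p => integrableOn_kernelIntegrand τ p)
    (summable_integral_norm_kernelIntegrand τ)
  rw [setIntegral_congr_fun measurableSet_Ioi fun r hr => tsum_kernelIntegrand τ (mem_Ioi.mp hr),
    integral_const_mul] at h
  exact h

/-- The lattice point 0 is absent from the sums with `ω²` in the denominator but present in the
theta kernel; its contribution becomes the nonholomorphic term of `E₂`. -/
theorem integral_kernelIntegrand_zero :
    ∫ r in Ioi (0 : ℝ), kernelIntegrand τ 0 r = ((3 * Real.pi / (2 * τ.im) : ℝ) : ℂ) := by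
  have hv := τ.im_pos
  have h1 : ∀ r, kernelIntegrand τ 0 r = ((3 * Real.pi / (2 * τ.im + r) ^ 2 : ℝ) : ℂ) := fun r => by
    simp [kernelIntegrand, thetaKernel, latticeSign, latticePt_zero]
  simp only [h1]
  rw [integral_complex_ofReal,
    integral_Ioi_of_hasDerivAt_of_nonneg (g := fun r : ℝ => -(3 * Real.pi / (2 * τ.im + r)))
    (hasDerivAt_neg_div_add _ (by linarith)).continuousAt.continuousWithinAt
    (fun r hr => hasDerivAt_neg_div_add _ (by linarith [mem_Ioi.mp hr]))
    (fun r hr => by positivity) (tendsto_neg_div_add _ _)]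
  simp

/-- The summand of the modular lattice sum. -/
def modularSummand (p : ℤ × ℤ) : ℂ :=
  latticeSign p * (Real.exp (-(3 * Real.pi / (2 * τ.im) * ‖latticePt τ p‖ ^ 2)) : ℝ) /
    latticePt τ p ^ 2

/-- From `ω - conj ω = 2i n v` one gets `3πi n ω = (3π/(2v)) (ω² - |ω|²)`, so `ω²` cancels at `ρ =
2v`. -/
theorem exp_mul_exp_eq (p : ℤ × ℤ) :
    Complex.exp (3 * Real.pi * Complex.I * p.1 * latticePt τ p -
      3 * Real.pi / ((2 * τ.im : ℝ) : ℂ) * latticePt τ p ^ 2) =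
      (Real.exp (-(3 * Real.pi / (2 * τ.im) * ‖latticePt τ p‖ ^ 2)) : ℝ) := by
  have hv : ((τ.im : ℝ) : ℂ) ≠ 0 := Complex.ofReal_ne_zero.mpr τ.im_pos.ne'
  rw [Complex.ofReal_exp]
  congr 1
  have h1 := Complex.mul_conj (latticePt τ p)
  rw [Complex.normSq_eq_norm_sq] at h1
  push_cast at h1 ⊢
  rw [← h1]
  have h2 : latticePt τ p - (starRingEnd ℂ) (latticePt τ p) = 2 * Complex.I * p.1 * τ.im := by
    rw [Complex.sub_conj, latticePt_im]
    push_cast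
    ring
  rw [show (starRingEnd ℂ) (latticePt τ p) = latticePt τ p - 2 * Complex.I * p.1 * τ.im by
    rw [← h2]; ring]
  field_simp
  ring

/-- Dividing the kernel by `ω²` gives a primitive in `r`; its limit at infinity is `rankSummand` and
its value at 0 is `modularSummand`. -/
theorem integral_kernelIntegrand {p : ℤ × ℤ} (hp : p ≠ 0) :
    ∫ r in Ioi (0 : ℝ), kernelIntegrand τ p r = rankSummand τ p - modularSummand τ p := by
  have hv := τ.im_pos
  have hω : latticePt τ p ≠ 0 := (latticePt_eq_zero_iff τ p).not.mpr hp
  set B : ℂ := 3 * Real.pi * latticePt τ p ^ 2 with hB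
  set g : ℝ → ℂ := fun r => latticeSign p *
    Complex.exp (3 * Real.pi * Complex.I * p.1 * latticePt τ p +
      ((-(1 / (2 * τ.im + r)) : ℝ) : ℂ) * B) / latticePt τ p ^ 2 with hg
  have hd : ∀ r : ℝ, 0 ≤ r → HasDerivAt g (kernelIntegrand τ p r) r := fun r hr => by
    have hρ : 0 < 2 * τ.im + r := by linarith
    have h1 := (((hasDerivAt_neg_div_add 1 hρ).ofReal_comp.mul_const B).const_add
      (3 * Real.pi * Complex.I * p.1 * latticePt τ p)).cexp
    have h2 := (h1.const_mul (latticeSign p)).div_const (latticePt τ p ^ 2)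
    convert! h2 using 1
    rw [kernelIntegrand, thetaKernel, sub_eq_add_neg,
      show -(3 * Real.pi / ((2 * τ.im + r : ℝ) : ℂ) * latticePt τ p ^ 2) =
        ((-(1 / (2 * τ.im + r)) : ℝ) : ℂ) * B by rw [hB]; push_cast; ring]
    generalize Complex.exp _ = E
    rw [hB]
    push_cast
    field_simp
  have hlim : Tendsto g atTop (𝓝 (rankSummand τ p)) := by
    have h1 : Tendsto (fun r : ℝ => ((-(1 / (2 * τ.im + r)) : ℝ) : ℂ)) atTop (𝓝 ((0 : ℝ) : ℂ)) :=
      (Complex.continuous_ofReal.tendsto _).comp (tendsto_neg_div_add _ _)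
    have h2 := ((h1.mul_const B).const_add (3 * Real.pi * Complex.I * p.1 * latticePt τ p)).cexp
    have h3 := (h2.const_mul (latticeSign p)).div_const (latticePt τ p ^ 2)
    simpa [rankSummand, hg] using h3
  rw [integral_Ioi_of_hasDerivAt_of_tendsto (hd 0 le_rfl).continuousAt.continuousWithinAt
    (fun r hr => hd r (mem_Ioi.mp hr).le) (integrableOn_kernelIntegrand τ p) hlim, modularSummand,
    ← exp_mul_exp_eq, hg]
  congr 4
  rw [hB]
  push_cast
  ring_nf

theorem summable_modularSummand : Summable (modularSummand τ) := by
  have hv := τ.im_pos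
  refine summable_of_norm_le_lattice τ (c := 3 * Real.pi / 2 * τ.im) (C := 1) (by positivity)
    fun p _ => ?_
  rw [modularSummand, norm_div, norm_mul, norm_latticeSign, norm_pow, one_mul, one_mul,
    Complex.norm_real, Real.norm_of_nonneg (Real.exp_pos _).le]
  gcongr
  rw [neg_mul, neg_le_neg_iff, ← Complex.normSq_eq_norm_sq, Complex.normSq_apply, latticePt_im,
    show 3 * Real.pi / 2 * τ.im * (p.1 : ℝ) ^ 2 =
      3 * Real.pi / (2 * τ.im) * (p.1 * τ.im * (p.1 * τ.im)) by field_simp]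
  refine mul_le_mul_of_nonneg_left ?_ (by positivity)
  nlinarith [mul_self_nonneg (latticePt τ p).re]

/-- The comparison of the two lattice sums. -/
theorem tsum_rankSummand_eq : ∑' p : ℤ × ℤ, rankSummand τ p =
    ∑' p : ℤ × ℤ, modularSummand τ p - ((3 * Real.pi / (2 * τ.im) : ℝ) : ℂ) +
      (2 * √3 * Real.pi : ℝ) * ModularForm.eta τ * etaIntegral τ := by
  have h1 := (summable_rankSummand τ).sub (summable_modularSummand τ)
  have h2 := hasSum_integral_kernelIntegrand τ
  -- At `p = 0` both summands are 0 by division by zero, so the integral there enters as a separate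
  -- correction.
  have h3 : ∀ p : ℤ × ℤ, ∫ r in Ioi (0 : ℝ), kernelIntegrand τ p r =
      (rankSummand τ p - modularSummand τ p) +
        if p = 0 then ((3 * Real.pi / (2 * τ.im) : ℝ) : ℂ) else 0 := fun p => by
    split_ifs with hp
    · subst hp
      rw [integral_kernelIntegrand_zero]
      simp [rankSummand, modularSummand, latticePt_zero]
    · rw [integral_kernelIntegrand τ hp, add_zero]
  simp only [h3] at h2
  have h4 := h2.unique (h1.hasSum.add (hasSum_ite_eq (0 : ℤ × ℤ)
    (((3 * Real.pi / (2 * τ.im) : ℝ)) : ℂ)))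
  rw [h4, (summable_rankSummand τ).tsum_sub (summable_modularSummand τ)]
  ring

end Integral

/-! ### The completed rank moment function as a quotient of a weight two lattice sum -/

theorem coe_div24 (τ : ℍ) : ((div24 τ : ℍ) : ℂ) = τ / 24 := by
  rw [div24, UpperHalfPlane.coe_pos_real_smul, Complex.real_smul]
  push_cast
  ring

theorem mul24_div24 (τ : ℍ) : mul24 (div24 τ) = τ := by
  rw [mul24, div24, smul_smul, show (⟨24, by norm_num⟩ : {x : ℝ // 0 < x}) * ⟨1 / 24, by norm_num⟩
    = 1 from Subtype.ext (by norm_num), one_smul]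

open MeasureTheory Set in
-- Substitute `r = 24t`. The constant is `i · i · 24^(3/2) / (24 · 4√2 π) = -√3/(2π)`.
theorem eichlerPart_div24 (τ : ℍ) :
    eichlerPart (div24 τ) = -((√3 / (2 * Real.pi) : ℝ) : ℂ) * etaIntegral τ := by
  have hv := τ.im_pos
  set g : ℝ → ℂ := fun r => ModularForm.eta (-(starRingEnd ℂ) (τ : ℂ) + Complex.I * r) *
    (((2 * τ.im + r) ^ (-(3 / 2) : ℝ) : ℝ) : ℂ) with hg
  have h1 : ∀ t ∈ Ioi (0 : ℝ),
      ModularForm.eta (24 * (-(starRingEnd ℂ) ((div24 τ : ℍ) : ℂ) + Complex.I * t)) /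
          (-Complex.I * (((div24 τ : ℍ) : ℂ) +
            (-(starRingEnd ℂ) ((div24 τ : ℍ) : ℂ) + Complex.I * t))) ^ (3 / 2 : ℂ) *
        Complex.I = (Complex.I * (((24 : ℝ) ^ (3 / 2 : ℝ) : ℝ) : ℂ)) * g (24 * t) := by
    intro t ht
    have ht0 := mem_Ioi.mp ht
    have hy : 0 < 2 * τ.im + 24 * t := by linarith
    have e1 : 24 * (-(starRingEnd ℂ) ((div24 τ : ℍ) : ℂ) + Complex.I * t) =
        -(starRingEnd ℂ) (τ : ℂ) + Complex.I * ((24 * t : ℝ) : ℂ) := by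
      rw [coe_div24, map_div₀, map_ofNat]
      push_cast
      ring
    have e2 : -Complex.I * (((div24 τ : ℍ) : ℂ) +
            (-(starRingEnd ℂ) ((div24 τ : ℍ) : ℂ) + Complex.I * t)) =
        (((2 * τ.im + 24 * t) / 24 : ℝ) : ℂ) := by
      rw [coe_div24, map_div₀, map_ofNat]
      have h := Complex.sub_conj (τ : ℂ)
      rw [coe_im] at h
      push_cast at h ⊢
      linear_combination (-Complex.I / 24) * h - (τ.im / 12 + t) * Complex.I_sq
    rw [e1, e2, show (3 / 2 : ℂ) = ((3 / 2 : ℝ) : ℂ) by push_cast; rfl,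
      ← Complex.ofReal_cpow (by positivity), Real.div_rpow hy.le (by norm_num), hg]
    simp only
    rw [Real.rpow_neg hy.le]
    have : (2 * τ.im + 24 * t) ^ (3 / 2 : ℝ) ≠ 0 := (Real.rpow_pos_of_pos hy _).ne'
    have h24 : (24 : ℝ) ^ (3 / 2 : ℝ) ≠ 0 := (Real.rpow_pos_of_pos (by norm_num) _).ne'
    generalize (2 * τ.im + 24 * t) ^ (3 / 2 : ℝ) = Y at *
    generalize (24 : ℝ) ^ (3 / 2 : ℝ) = Z at *
    have hY : (Y : ℂ) ≠ 0 := Complex.ofReal_ne_zero.mpr this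
    have hZ : (Z : ℂ) ≠ 0 := Complex.ofReal_ne_zero.mpr h24
    push_cast
    field_simp
  rw [eichlerPart, setIntegral_congr_fun measurableSet_Ioi h1, integral_const_mul,
    integral_comp_mul_left_Ioi g 0 (by norm_num : (0 : ℝ) < 24), mul_zero,
    show ∫ x in Ioi (0 : ℝ), g x = etaIntegral τ from rfl]
  have h2 : (24 : ℝ) ^ (3 / 2 : ℝ) = 24 * (2 * (√2 * √3)) := by
    rw [show (3 / 2 : ℝ) = 1 + 1 / 2 by norm_num, Real.rpow_add (by norm_num), Real.rpow_one,
      ← Real.sqrt_eq_rpow, show (24 : ℝ) = 2 ^ 2 * (2 * 3) by norm_num,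
      Real.sqrt_mul (by norm_num), Real.sqrt_sq (by norm_num), Real.sqrt_mul (by norm_num)]
  rw [h2]
  have h3 : ((√2 : ℝ) : ℂ) ≠ 0 := Complex.ofReal_ne_zero.mpr (by positivity)
  have hpi : (Real.pi : ℂ) ≠ 0 := Complex.ofReal_ne_zero.mpr Real.pi_ne_zero
  rw [Complex.real_smul]
  push_cast
  field_simp
  linear_combination (4 * etaIntegral τ) * Complex.I_sq

theorem eta_coe_ne_zero (τ : ℍ) : ModularForm.eta τ ≠ 0 := ModularForm.eta_ne_zero τ.im_pos

/-- The weight two lattice sum whose quotient by the eta function is the completed rank moment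
function. -/
def modularLattice (τ : ℍ) : ℂ :=
  (∑' p : ℤ × ℤ, modularSummand τ p) / (4 * Real.pi ^ 2) +
    (EisensteinSeries.E2 τ - 3 / (Real.pi * τ.im)) / 8

theorem rankPart_div24 (τ : ℍ) : rankPart (div24 τ) =
    1 / 2 * rankMomentSeries 2 (Complex.exp (2 * Real.pi * Complex.I * τ)) *
      (Complex.exp (Real.pi * Complex.I * τ / 12))⁻¹ := by
  rw [rankPart, coe_div24, ← Complex.exp_nat_mul,
    show ((24 : ℕ) : ℂ) * (2 * Real.pi * Complex.I * (τ / 24)) = 2 * Real.pi * Complex.I * τ by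
      push_cast; ring,
    show 2 * Real.pi * Complex.I * ((τ : ℂ) / 24) = Real.pi * Complex.I * τ / 12 by ring]

/-- Three cancellations occur: the Eichler integrals, since `2√3π/(4π²) = √3/(2π)`; the constants
`1/24`; and `-3π/(2v)` over `4π²`, which completes `E₂/8`. -/
theorem rankMHat_mul_eta (τ : ℍ) : rankMHat τ * ModularForm.eta τ = modularLattice τ := by
  have hη := eta_coe_ne_zero τ
  have hv : ((τ.im : ℝ) : ℂ) ≠ 0 := Complex.ofReal_ne_zero.mpr τ.im_pos.ne'
  have hpi : (Real.pi : ℂ) ≠ 0 := Complex.ofReal_ne_zero.mpr Real.pi_ne_zero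
  have h1 := (tsum_rankSummand τ).symm.trans (tsum_rankSummand_eq τ)
  have h2 : rankPart (div24 τ) * ModularForm.eta τ =
      1 / 2 * rankMomentSeries 2 (Complex.exp (2 * Real.pi * Complex.I * τ)) *
        ∏' n : ℕ, (1 - Complex.exp (2 * Real.pi * Complex.I * τ) ^ (n + 1)) := by
    have := Complex.exp_ne_zero (Real.pi * Complex.I * τ / 12)
    rw [rankPart_div24, eta_eq_mul_tprod]
    field_simp
  rw [rankMHat, rankM, mul24_div24, modularLattice, eichlerPart_div24]
  rw [← h2] at h1
  generalize ∑' p : ℤ × ℤ, modularSummand τ p = S at *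
  generalize rankPart (div24 τ) = R at *
  generalize etaIntegral τ = J at *
  generalize EisensteinSeries.E2 τ = E at *
  have h3 : R * ModularForm.eta τ = (S - ((3 * Real.pi / (2 * τ.im) : ℝ) : ℂ) +
      (2 * √3 * Real.pi : ℝ) * ModularForm.eta τ * J) / (4 * Real.pi ^ 2) + 1 / 24 := by
    rw [← h1]
    field_simp
    ring
  rw [add_mul, sub_mul, add_mul, h3]
  push_cast
  field_simp
  ring

/-! ### Modular transformation of the lattice sum and of the completed function -/

/-- The right action of a matrix on the lattice. -/
def latticeAct (γ : SL(2, ℤ)) (p : ℤ × ℤ) : ℤ × ℤ :=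
  (p.1 * γ 0 0 + p.2 * γ 1 0, p.1 * γ 0 1 + p.2 * γ 1 1)

theorem latticeAct_bijective (γ : SL(2, ℤ)) : Function.Bijective (latticeAct γ) := by
  have hdet : γ 0 0 * γ 1 1 - γ 0 1 * γ 1 0 = 1 := by
    have := γ.det_coe
    rwa [Matrix.det_fin_two] at this
  refine ⟨fun p p' h => ?_, fun p => ⟨(p.1 * γ 1 1 - p.2 * γ 1 0, p.2 * γ 0 0 - p.1 * γ 0 1), ?_⟩⟩
  · simp only [latticeAct, Prod.mk.injEq] at h
    obtain ⟨h1, h2⟩ := h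
    refine Prod.ext ?_ ?_
    · linear_combination γ 1 1 * h1 - γ 1 0 * h2 + (p'.1 - p.1) * hdet
    · linear_combination γ 0 0 * h2 - γ 0 1 * h1 + (p'.2 - p.2) * hdet
  · simp only [latticeAct]
    refine Prod.ext ?_ ?_
    · simp only
      linear_combination p.1 * hdet
    · simp only
      linear_combination p.2 * hdet

/-- An invertible integral change of basis preserves the sublattice `2Λ`. -/
theorem latticeSign_act (γ : SL(2, ℤ)) (p : ℤ × ℤ) :
    latticeSign (latticeAct γ p) = latticeSign p := by
  have hdet : γ 0 0 * γ 1 1 - γ 0 1 * γ 1 0 = 1 := by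
    have := γ.det_coe
    rwa [Matrix.det_fin_two] at this
  have h : (Even (latticeAct γ p).1 ∧ Even (latticeAct γ p).2) ↔ (Even p.1 ∧ Even p.2) := by
    constructor
    · rintro ⟨h1, h2⟩
      have e1 : p.1 = (latticeAct γ p).1 * γ 1 1 - (latticeAct γ p).2 * γ 1 0 := by
        simp only [latticeAct]
        linear_combination (-p.1) * hdet
      have e2 : p.2 = (latticeAct γ p).2 * γ 0 0 - (latticeAct γ p).1 * γ 0 1 := by
        simp only [latticeAct]
        linear_combination (-p.2) * hdet
      rw [e1, e2]
      exact ⟨(h1.mul_right _).sub (h2.mul_right _), (h2.mul_right _).sub (h1.mul_right _)⟩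
    · rintro ⟨h1, h2⟩
      exact ⟨(h1.mul_right _).add (h2.mul_right _), (h1.mul_right _).add (h2.mul_right _)⟩
  simp only [latticeSign, h]

theorem denom_eq_autFactor (γ : SL(2, ℤ)) (τ : ℍ) : denom γ τ = autFactor γ τ := by
  simp [autFactor, denom]

theorem im_smul_eq (γ : SL(2, ℤ)) (τ : ℍ) :
    (γ • τ).im = τ.im / ‖autFactor γ τ‖ ^ 2 := by
  rw [ModularGroup.im_smul_eq_div_normSq, denom_eq_autFactor, Complex.normSq_eq_norm_sq]

theorem latticePt_smul (γ : SL(2, ℤ)) (τ : ℍ) (p : ℤ × ℤ) :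
    latticePt (γ • τ) p = latticePt τ (latticeAct γ p) / autFactor γ τ := by
  have h0 := autFactor_ne_zero γ τ
  rw [eq_div_iff h0, latticePt, UpperHalfPlane.coe_specialLinearGroup_apply]
  simp only [algebraMap_int_eq, eq_intCast, Complex.ofReal_intCast]
  rw [show (γ 1 0 : ℂ) * τ + γ 1 1 = autFactor γ τ from rfl]
  field_simp
  rw [latticePt, latticeAct, autFactor]
  push_cast
  ring

/-- Both `ω` and `√v` scale by the automorphy factor, up to a phase, so `|ω|²/v` is invariant and
only `1/ω²` contributes weight two. -/
theorem modularSummand_smul (γ : SL(2, ℤ)) (τ : ℍ) (p : ℤ × ℤ) :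
    modularSummand (γ • τ) p = autFactor γ τ ^ 2 * modularSummand τ (latticeAct γ p) := by
  have h0 := autFactor_ne_zero γ τ
  have hn : ‖autFactor γ τ‖ ≠ 0 := norm_ne_zero_iff.mpr h0
  have hv := τ.im_pos.ne'
  rw [modularSummand, modularSummand, latticePt_smul, im_smul_eq, latticeSign_act, norm_div]
  have e : 3 * Real.pi / (2 * (τ.im / ‖autFactor γ τ‖ ^ 2)) *
      (‖latticePt τ (latticeAct γ p)‖ / ‖autFactor γ τ‖) ^ 2 =
      3 * Real.pi / (2 * τ.im) * ‖latticePt τ (latticeAct γ p)‖ ^ 2 := by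
    field_simp
  rw [e]
  by_cases hp : latticePt τ (latticeAct γ p) = 0
  · simp [hp]
  · field_simp

theorem tsum_modularSummand_smul (γ : SL(2, ℤ)) (τ : ℍ) :
    ∑' p : ℤ × ℤ, modularSummand (γ • τ) p =
      autFactor γ τ ^ 2 * ∑' p : ℤ × ℤ, modularSummand τ p := by
  simp only [modularSummand_smul]
  rw [tsum_mul_left]
  congr 1
  exact (Equiv.ofBijective _ (latticeAct_bijective γ)).tsum_eq (modularSummand τ)

theorem E2_smul (γ : SL(2, ℤ)) (τ : ℍ) :
    EisensteinSeries.E2 (γ • τ) = autFactor γ τ ^ 2 * EisensteinSeries.E2 τ -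
      6 * Complex.I / Real.pi * γ 1 0 * autFactor γ τ := by
  have h := congrFun (EisensteinSeries.E2_slash_action γ) τ
  have h0 := autFactor_ne_zero γ τ
  have hpi : (Real.pi : ℂ) ≠ 0 := Complex.ofReal_ne_zero.mpr Real.pi_ne_zero
  rw [ModularForm.SL_slash_apply, denom_eq_autFactor, Pi.sub_apply, Pi.smul_apply,
    EisensteinSeries.D2, denom_eq_autFactor, riemannZeta_two, smul_eq_mul, zpow_neg,
    ← div_eq_mul_inv, div_eq_iff (zpow_ne_zero _ h0)] at h
  rw [h, zpow_ofNat]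
  field_simp

/-- With `j = cτ + d` and `conj j = j - 2icv`, one has `1/Im(γτ) = j²/v - 2icj`; the last term
cancels the anomaly of `E₂`. -/
theorem modularLattice_smul (γ : SL(2, ℤ)) (τ : ℍ) :
    modularLattice (γ • τ) = autFactor γ τ ^ 2 * modularLattice τ := by
  have h0 := autFactor_ne_zero γ τ
  have hv : ((τ.im : ℝ) : ℂ) ≠ 0 := Complex.ofReal_ne_zero.mpr τ.im_pos.ne'
  have hpi : (Real.pi : ℂ) ≠ 0 := Complex.ofReal_ne_zero.mpr Real.pi_ne_zero
  have h1 : (((γ • τ).im : ℝ) : ℂ) * (autFactor γ τ * (autFactor γ τ - 2 * Complex.I * γ 1 0 *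
      τ.im)) = τ.im := by
    have h2 := Complex.mul_conj (autFactor γ τ)
    have h3 : (starRingEnd ℂ) (autFactor γ τ) = autFactor γ τ - 2 * Complex.I * γ 1 0 * τ.im := by
      rw [autFactor]
      apply Complex.ext <;> simp
      ring
    rw [← h3, h2, Complex.normSq_eq_norm_sq, im_smul_eq, ← Complex.ofReal_mul,
      div_mul_cancel₀ _ (pow_ne_zero 2 (norm_ne_zero_iff.mpr h0))]
  have h4 : autFactor γ τ - 2 * Complex.I * γ 1 0 * τ.im ≠ 0 := fun h => by
    rw [h, mul_zero, mul_zero] at h1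
    exact hv h1.symm
  have h5 : (((γ • τ).im : ℝ) : ℂ) = τ.im /
      (autFactor γ τ * (autFactor γ τ - 2 * Complex.I * γ 1 0 * τ.im)) := by
    rw [eq_div_iff (mul_ne_zero h0 h4), h1]
  rw [modularLattice, modularLattice, tsum_modularSummand_smul, E2_smul, h5]
  field_simp
  ring

/-- The transformation law of the completed rank moment function. -/
theorem rankMHat_smul (γ : SL(2, ℤ)) (τ : ℍ) :
    rankMHat (γ • τ) = (etaMultiplier γ)⁻¹ * autFactor γ τ ^ (3 / 2 : ℂ) * rankMHat τ := by
  have h0 := autFactor_ne_zero γ τ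
  have hη := eta_coe_ne_zero τ
  have hη' := eta_coe_ne_zero (γ • τ)
  have h1 := eta_smul γ τ
  have hm : etaMultiplier γ ≠ 0 := fun h => by
    rw [h, zero_mul, zero_mul] at h1
    exact hη' h1
  have h2 := rankMHat_mul_eta (γ • τ)
  rw [modularLattice_smul, ← rankMHat_mul_eta, h1] at h2
  have hs : autFactor γ τ ^ (1 / 2 : ℂ) ≠ 0 := by simp [Complex.cpow_eq_zero_iff, h0]
  have h3 : autFactor γ τ ^ (1 / 2 : ℂ) * autFactor γ τ ^ (3 / 2 : ℂ) = autFactor γ τ ^ 2 := by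
    rw [← Complex.cpow_add _ _ h0, ← Complex.cpow_natCast]
    norm_num
  have h4 : etaMultiplier γ * autFactor γ τ ^ (1 / 2 : ℂ) * ModularForm.eta τ ≠ 0 :=
    mul_ne_zero (mul_ne_zero hm hs) hη
  refine mul_right_cancel₀ h4 (h2.trans ?_)
  rw [← h3]
  field_simp

section

/-! ### Integrals of decaying holomorphic functions along vertical rays -/

open MeasureTheory Set Metric

/-- A function that is holomorphic on the upper half-plane and decays exponentially as the imaginary
part tends to infinity. -/
structure IsDecaying (φ : ℂ → ℂ) : Prop where
  differentiableOn : DifferentiableOn ℂ φ {z | 0 < z.im}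
  bound : ∀ δ : ℝ, 0 < δ → ∃ C c : ℝ, 0 < c ∧ ∀ w : ℂ, δ ≤ w.im → ‖φ w‖ ≤ C * Real.exp (-c * w.im)

/-- A continuous function on `(1, ∞)` of polynomial growth. -/
structure IsWeight (g : ℝ → ℂ) : Prop where
  continuousOn : ContinuousOn g (Ioi 1)
  bound : ∃ (A : ℝ) (j : ℕ), 0 ≤ A ∧ ∀ y, 1 < y → ‖g y‖ ≤ A * y ^ j

theorem isOpen_im_pos : IsOpen {z : ℂ | 0 < z.im} := isOpen_lt continuous_const Complex.continuous_im

/-- Cauchy's estimate on discs of radius `δ/2`, on which the imaginary part stays at least `δ/2`. -/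
theorem IsDecaying.deriv {φ : ℂ → ℂ} (h : IsDecaying φ) : IsDecaying (deriv φ) := by
  refine ⟨h.differentiableOn.deriv isOpen_im_pos, fun δ hδ => ?_⟩
  obtain ⟨C, c, hc, hb⟩ := h.bound (δ / 2) (by positivity)
  refine ⟨C * Real.exp (c * (δ / 2)) / (δ / 2), c, hc, fun w hw => ?_⟩
  have hC : 0 ≤ C := by
    have h1 := (norm_nonneg _).trans (hb (δ / 2 * Complex.I) (by simp))
    exact nonneg_of_mul_nonneg_left h1 (Real.exp_pos _)
  have him : ∀ z ∈ closedBall w (δ / 2), w.im - δ / 2 ≤ z.im := fun z hz => by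
    have h1 := (Complex.abs_im_le_norm (z - w)).trans (mem_closedBall_iff_norm.mp hz)
    rw [Complex.sub_im] at h1
    linarith [neg_abs_le (z.im - w.im)]
  have hd : DiffContOnCl ℂ φ (ball w (δ / 2)) := by
    refine DifferentiableOn.diffContOnCl (h.differentiableOn.mono fun z hz => ?_)
    have := him z (closure_ball_subset_closedBall hz)
    simp only [mem_ofPred_eq]
    linarith
  refine (Complex.norm_deriv_le_of_forall_mem_sphere_norm_le (by positivity) hd fun z hz =>
    ?_ : ‖_‖ ≤ C * Real.exp (-c * (w.im - δ / 2)) / (δ / 2)).trans_eq ?_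
  · have h1 := him z (sphere_subset_closedBall hz)
    refine (hb z (by linarith)).trans (mul_le_mul_of_nonneg_left (Real.exp_le_exp.mpr ?_) hC)
    nlinarith
  · rw [show -c * (w.im - δ / 2) = c * (δ / 2) + -c * w.im by ring, Real.exp_add]
    ring

theorem IsWeight.ofReal_mul {g : ℝ → ℂ} (h : IsWeight g) : IsWeight fun y => (y : ℂ) * g y := by
  obtain ⟨A, j, hA, hb⟩ := h.bound
  refine ⟨Complex.continuous_ofReal.continuousOn.mul h.continuousOn, A, j + 1, hA, fun y hy => ?_⟩
  rw [norm_mul, Complex.norm_real, Real.norm_of_nonneg (by linarith), pow_succ]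
  nlinarith [hb y hy]

theorem isWeight_rpow {s : ℝ} (hs : s ≤ 0) :
    IsWeight fun y => (((1 + y) ^ s : ℝ) : ℂ) := by
  refine ⟨?_, 1, 0, zero_le_one, fun y hy => ?_⟩
  · refine Complex.continuous_ofReal.comp_continuousOn
      (ContinuousOn.rpow_const (by fun_prop) fun y hy => Or.inl ?_)
    have := mem_Ioi.mp hy
    linarith
  · rw [Complex.norm_real, Real.norm_of_nonneg (Real.rpow_nonneg (by linarith) _), pow_zero, mul_one]
    exact Real.rpow_le_one_of_one_le_of_nonpos (by linarith) hs

/-- The point at height `y Im z` above the reflection of `z` in the imaginary axis, as a real linear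
function of `z`. -/
def verticalPath (y : ℝ) : ℂ →L[ℝ] ℂ :=
  -(Complex.ofRealCLM ∘L Complex.reCLM) +
    (y : ℂ) • (Complex.I • (Complex.ofRealCLM ∘L Complex.imCLM))

theorem verticalPath_apply (y : ℝ) (z : ℂ) :
    verticalPath y z = -(z.re : ℂ) + y * (Complex.I * z.im) := rfl

theorem verticalPath_im (y : ℝ) (z : ℂ) : (verticalPath y z).im = y * z.im := by
  simp [verticalPath_apply]

theorem integrableOn_pow_mul_exp (j : ℕ) {b : ℝ} (hb : 0 < b) :
    IntegrableOn (fun y : ℝ => y ^ j * Real.exp (-b * y)) (Ioi 1) := by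
  have h := integrableOn_rpow_mul_exp_neg_mul_rpow (p := 1) (s := j) (b := b)
    (by linarith [(Nat.cast_nonneg j : (0 : ℝ) ≤ j)]) one_pos hb
  simp only [Real.rpow_natCast, Real.rpow_one] at h
  exact h.mono_set (Ioi_subset_Ioi zero_le_one)

/-- The integral of `φ`, weighted by `g`, along the vertical ray above the reflection of `z` in the
imaginary axis. -/
def verticalIntegral (φ : ℂ → ℂ) (g : ℝ → ℂ) (z : ℂ) : ℂ :=
  ∫ y in Ioi (1 : ℝ), φ (verticalPath y z) * g y

section

variable {φ : ℂ → ℂ} {g : ℝ → ℂ}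

theorem exists_norm_verticalPath_mul_le (hφ : IsDecaying φ) (hg : IsWeight g) {δ : ℝ} (hδ : 0 < δ) :
    ∃ (C c : ℝ) (j : ℕ), 0 < c ∧ 0 ≤ C ∧ ∀ z : ℂ, δ ≤ z.im → ∀ y : ℝ, 1 < y →
      ‖φ (verticalPath y z) * g y‖ ≤ C * (y ^ j * Real.exp (-(c * z.im) * y)) := by
  obtain ⟨C, c, hc, hb⟩ := hφ.bound δ hδ
  obtain ⟨A, j, hA, hb'⟩ := hg.bound
  have hC : 0 ≤ C := by
    have h1 := (norm_nonneg _).trans (hb (δ * Complex.I) (by simp))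
    exact nonneg_of_mul_nonneg_left h1 (Real.exp_pos _)
  refine ⟨C * A, c, j, hc, by positivity, fun z hz y hy => ?_⟩
  have h1 := hb (verticalPath y z) (by rw [verticalPath_im]; nlinarith)
  rw [verticalPath_im] at h1
  rw [norm_mul]
  calc _ ≤ C * Real.exp (-c * (y * z.im)) * (A * y ^ j) :=
        mul_le_mul h1 (hb' y hy) (norm_nonneg _) (by positivity)
    _ = _ := by rw [show -c * (y * z.im) = -(c * z.im) * y by ring]; ring

theorem continuousOn_verticalPath_mul (hφ : IsDecaying φ) (hg : IsWeight g) {z : ℂ}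
    (hz : 0 < z.im) : ContinuousOn (fun y => φ (verticalPath y z) * g y) (Ioi 1) := by
  refine ContinuousOn.mul (hφ.differentiableOn.continuousOn.comp ?_ fun y hy => ?_) hg.continuousOn
  · simp only [verticalPath_apply]
    fun_prop
  · rw [mem_ofPred_eq, verticalPath_im]
    exact mul_pos (zero_lt_one.trans hy) hz

theorem integrableOn_verticalPath_mul (hφ : IsDecaying φ) (hg : IsWeight g) {z : ℂ}
    (hz : 0 < z.im) : IntegrableOn (fun y => φ (verticalPath y z) * g y) (Ioi 1) := by
  obtain ⟨C, c, j, hc, -, hb⟩ := exists_norm_verticalPath_mul_le hφ hg hz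
  refine Integrable.mono' ((integrableOn_pow_mul_exp j (mul_pos hc hz)).const_mul C)
    ((continuousOn_verticalPath_mul hφ hg hz).aestronglyMeasurable measurableSet_Ioi) ?_
  filter_upwards [ae_restrict_mem measurableSet_Ioi] with y hy
  exact hb z le_rfl y hy

/-- Differentiation under the integral sign. The derivative is built from integrals of the same
type, with `φ'` for `φ` and with weights `g` and `y g`, so it can be iterated. -/
theorem hasFDerivAt_verticalIntegral (hφ : IsDecaying φ) (hg : IsWeight g) {z : ℂ}
    (hz : 0 < z.im) : HasFDerivAt (𝕜 := ℝ) (verticalIntegral φ g)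
      (verticalIntegral (deriv φ) g z • -(Complex.ofRealCLM ∘L Complex.reCLM) +
        verticalIntegral (deriv φ) (fun y => y * g y) z •
          (Complex.I • (Complex.ofRealCLM ∘L Complex.imCLM))) z := by
  set A : ℂ →L[ℝ] ℂ := -(Complex.ofRealCLM ∘L Complex.reCLM) with hA
  set B : ℂ →L[ℝ] ℂ := Complex.I • (Complex.ofRealCLM ∘L Complex.imCLM) with hB
  obtain ⟨C, c, j, hc, hC, hb⟩ := exists_norm_verticalPath_mul_le hφ.deriv hg (half_pos hz)
  obtain ⟨C', c', j', hc', hC', hb'⟩ :=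
    exists_norm_verticalPath_mul_le hφ.deriv hg.ofReal_mul (half_pos hz)
  set F' : ℂ → ℝ → ℂ →L[ℝ] ℂ := fun x y => (deriv φ (verticalPath y x) * g y) • A +
    (deriv φ (verticalPath y x) * (y * g y)) • B with hF'
  have him : ∀ x ∈ ball z (z.im / 2), z.im / 2 ≤ x.im := fun x hx => by
    have h1 := (Complex.abs_im_le_norm (x - z)).trans (mem_ball_iff_norm.mp hx).le
    rw [Complex.sub_im] at h1
    linarith [neg_abs_le (x.im - z.im)]
  have hI1 := integrableOn_verticalPath_mul hφ.deriv hg hz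
  have hI2 := integrableOn_verticalPath_mul hφ.deriv hg.ofReal_mul hz
  have hF'int : Integrable (F' z) (volume.restrict (Ioi 1)) :=
    (hI1.smul_const A).add (hI2.smul_const B)
  have hexp : ∀ x ∈ ball z (z.im / 2), ∀ y : ℝ, 1 < y → ∀ b : ℝ, 0 < b →
      Real.exp (-(b * x.im) * y) ≤ Real.exp (-(b * (z.im / 2)) * y) := fun x hx y hy b hb => by
    refine Real.exp_le_exp.mpr ?_
    have := mul_le_mul_of_nonneg_left (him x hx) (mul_pos hb (zero_lt_one.trans hy)).le
    linarith
  have key := hasFDerivAt_integral_of_dominated_of_fderiv_le (𝕜 := ℝ)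
    (μ := volume.restrict (Ioi (1 : ℝ))) (F := fun x y => φ (verticalPath y x) * g y) (x₀ := z)
    (F' := F') (s := ball z (z.im / 2))
    (bound := fun y => C * (y ^ j * Real.exp (-(c * (z.im / 2)) * y)) * ‖A‖ +
      C' * (y ^ j' * Real.exp (-(c' * (z.im / 2)) * y)) * ‖B‖)
    (ball_mem_nhds z (half_pos hz)) ?_ (integrableOn_verticalPath_mul hφ hg hz)
    hF'int.aestronglyMeasurable ?_ ?_ ?_
  · rwa [hF', integral_add (hI1.smul_const A) (hI2.smul_const B), integral_smul_const,
      integral_smul_const] at key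
  · filter_upwards [isOpen_im_pos.mem_nhds hz] with x hx
    exact (continuousOn_verticalPath_mul hφ hg hx).aestronglyMeasurable measurableSet_Ioi
  · filter_upwards [ae_restrict_mem measurableSet_Ioi] with y hy x hx
    have hy0 : 0 ≤ y := zero_le_one.trans (mem_Ioi.mp hy).le
    refine (norm_add_le _ _).trans (add_le_add ?_ ?_)
    · rw [norm_smul]
      refine mul_le_mul_of_nonneg_right ((hb x (him x hx) y hy).trans ?_) (norm_nonneg _)
      have := hexp x hx y hy c hc
      gcongr
    · rw [norm_smul]
      refine mul_le_mul_of_nonneg_right ((hb' x (him x hx) y hy).trans ?_) (norm_nonneg _)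
      have := hexp x hx y hy c' hc'
      gcongr
  · exact (((integrableOn_pow_mul_exp j (mul_pos hc (half_pos hz))).const_mul C).mul_const _).add
      (((integrableOn_pow_mul_exp j' (mul_pos hc' (half_pos hz))).const_mul C').mul_const _)
  · filter_upwards [ae_restrict_mem measurableSet_Ioi] with y hy x hx
    have hx0 : 0 < x.im := (half_pos hz).trans_le (him x hx)
    have hpos : 0 < (verticalPath y x).im := by
      rw [verticalPath_im]
      exact mul_pos (zero_lt_one.trans hy) hx0
    have h1 := ((hφ.differentiableOn.differentiableAt (isOpen_im_pos.mem_nhds hpos)).hasDerivAt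
      |>.hasFDerivAt.restrictScalars ℝ).comp x (verticalPath y).hasFDerivAt
    have h2 := h1.mul_const (g y)
    refine h2.congr_fderiv ?_
    ext w
    all_goals
      simp [hF', hA, hB, verticalPath_apply]
      ring

theorem contDiffOn_verticalIntegral (n : ℕ) (hφ : IsDecaying φ) (hg : IsWeight g) :
    ContDiffOn ℝ n (verticalIntegral φ g) {z | 0 < z.im} := by
  have hd : ∀ {φ : ℂ → ℂ} {g : ℝ → ℂ}, IsDecaying φ → IsWeight g →
      DifferentiableOn ℝ (verticalIntegral φ g) {z | 0 < z.im} := fun hφ hg z hz =>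
    (hasFDerivAt_verticalIntegral hφ hg hz).differentiableAt.differentiableWithinAt
  induction n generalizing φ g with
  | zero => exact contDiffOn_zero.mpr (hd hφ hg).continuousOn
  | succ n ih =>
    rw [Nat.cast_succ, contDiffOn_succ_iff_fderiv_of_isOpen isOpen_im_pos]
    refine ⟨hd hφ hg, fun h => absurd h (by simp), ?_⟩
    refine ContDiffOn.congr ?_ fun z hz => (hasFDerivAt_verticalIntegral hφ hg hz).fderiv
    exact ((ih hφ.deriv hg).smul contDiffOn_const).add
      ((ih hφ.deriv hg.ofReal_mul).smul contDiffOn_const)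

end

end

section

/-! ### The non-holomorphic part is smooth, and its anti-holomorphic derivative -/

open MeasureTheory Set Filter Topology

theorem isDecaying_eta : IsDecaying ModularForm.eta := by
  refine ⟨fun z hz => (ModularForm.differentiableAt_eta_of_mem_upperHalfPlaneSet
    hz).differentiableWithinAt, fun δ hδ => ?_⟩
  set r := Real.exp (-(2 * Real.pi * δ)) with hr
  have hr1 : r < 1 := Real.exp_lt_one_iff.mpr (by have := Real.pi_pos; nlinarith)
  -- The constant bounds `1 - rankTheta 0 - rankTheta 1`, and the decay rate comes from the
  -- prefactor `exp(πiw/12)`.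
  refine ⟨1 + (1 - r)⁻¹ + (1 - r)⁻¹, Real.pi / 12, by positivity, fun w hw => ?_⟩
  have hw0 : 0 < w.im := hδ.trans_le hw
  have hq := norm_exp_two_pi_I_mul_lt_one hw0
  have hqr : ‖Complex.exp (2 * Real.pi * Complex.I * w)‖ ≤ r := by
    rw [Complex.norm_exp]
    refine Real.exp_le_exp.mpr ?_
    simp
    nlinarith [Real.pi_pos]
  have h1 : ∀ m, ‖rankTheta m (Complex.exp (2 * Real.pi * Complex.I * w))‖ ≤ (1 - r)⁻¹ := fun m =>
    (norm_rankTheta_le hq m).trans (inv_anti₀ (by linarith) (by linarith))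
  rw [eta_eq_mul_tprod, tprod_one_sub_pow_eq hq, norm_mul, mul_comm]
  have h2 : ‖Complex.exp (Real.pi * Complex.I * w / 12)‖ = Real.exp (-(Real.pi / 12) * w.im) := by
    rw [Complex.norm_exp]
    congr 1
    simp
    ring
  rw [h2]
  refine mul_le_mul_of_nonneg_right ?_ (Real.exp_nonneg _)
  refine (norm_sub_le _ _).trans (add_le_add ((norm_sub_le _ _).trans (add_le_add ?_ (h1 0))) (h1 1))
  rw [norm_one]

/-- The weight `(1 + y) ^ s`. -/
def shiftPow (s : ℝ) (y : ℝ) : ℂ := (((1 + y) ^ s : ℝ) : ℂ)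

/-- The substitution `r = v(y - 1)` makes the weight independent of `τ`, which now enters only
through the real linear path and a power of `v`. -/
theorem etaIntegral_eq (τ : ℍ) : etaIntegral τ =
    ((τ.im ^ (-(1 / 2) : ℝ) : ℝ) : ℂ) *
      verticalIntegral ModularForm.eta (shiftPow (-(3 / 2))) τ := by
  have hv := τ.im_pos
  set G : ℝ → ℂ := fun r => ModularForm.eta (-(starRingEnd ℂ) (τ : ℂ) + Complex.I * r) *
    (((2 * τ.im + r) ^ (-(3 / 2) : ℝ) : ℝ) : ℂ) with hG
  have h1 : etaIntegral τ = ∫ s in Ioi τ.im, G (s - τ.im) := by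
    rw [etaIntegral]
    have h := (measurePreserving_sub_right volume τ.im).setIntegral_preimage_emb
      (measurableEmbedding_subRight τ.im) G (Ioi 0)
    rw [← h]
    congr 2
    ext y
    simp
  have h2 := integral_comp_mul_left_Ioi (fun s => G (s - τ.im)) 1 hv
  rw [mul_one, ← h1] at h2
  have h3 : etaIntegral τ = (τ.im : ℂ) * ∫ y in Ioi (1 : ℝ), G (τ.im * y - τ.im) := by
    rw [h2, Complex.real_smul]
    push_cast
    rw [mul_inv_cancel_left₀ (Complex.ofReal_ne_zero.mpr hv.ne')]
  rw [h3, verticalIntegral, ← integral_const_mul, ← integral_const_mul]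
  refine setIntegral_congr_fun measurableSet_Ioi fun y hy => ?_
  have hy0 : 0 < 1 + y := by linarith [mem_Ioi.mp hy]
  have h4 : (2 * τ.im + (τ.im * y - τ.im)) ^ (-(3 / 2) : ℝ) =
      τ.im ^ (-(3 / 2) : ℝ) * (1 + y) ^ (-(3 / 2) : ℝ) := by
    rw [← Real.mul_rpow hv.le hy0.le]
    congr 1
    ring
  have h5 : τ.im * τ.im ^ (-(3 / 2) : ℝ) = τ.im ^ (-(1 / 2) : ℝ) := by
    rw [← Real.rpow_one_add' hv.le (by norm_num)]
    norm_num
  have h6 : -(starRingEnd ℂ) (τ : ℂ) + Complex.I * ((τ.im * y - τ.im : ℝ) : ℂ) =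
      verticalPath y τ := by
    rw [verticalPath_apply]
    apply Complex.ext <;> simp
    ring
  simp only [hG]
  rw [h4, h6, ← h5, shiftPow]
  push_cast
  ring

/-- Integration by parts in `y` against `(1 + y)^(-1/2)`. The boundary term sits at `y = 1`, where
the path is at `-conj z` and the weight is `1/√2`. -/
theorem I_mul_verticalIntegral_deriv_eta {z : ℂ} (hz : 0 < z.im) :
    Complex.I * z.im * verticalIntegral (deriv ModularForm.eta) (shiftPow (-(1 / 2))) z =
      1 / 2 * verticalIntegral ModularForm.eta (shiftPow (-(3 / 2))) z -
        ModularForm.eta (-(starRingEnd ℂ) z) / (√2 : ℝ) := by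
  have hη := isDecaying_eta
  have hw1 : IsWeight (shiftPow (-(1 / 2))) := isWeight_rpow (by norm_num)
  have hw3 : IsWeight (shiftPow (-(3 / 2))) := isWeight_rpow (by norm_num)
  have hI1 := integrableOn_verticalPath_mul hη.deriv hw1 hz
  have hI3 := integrableOn_verticalPath_mul hη hw3 hz
  have hpos : ∀ y : ℝ, 1 ≤ y → 0 < (verticalPath y z).im := fun y hy => by
    rw [verticalPath_im]
    exact mul_pos (zero_lt_one.trans_le hy) hz
  have hder : ∀ y : ℝ, 1 ≤ y → HasDerivAt
      (fun y => ModularForm.eta (verticalPath y z) * shiftPow (-(1 / 2)) y)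
      (Complex.I * z.im * (deriv ModularForm.eta (verticalPath y z) * shiftPow (-(1 / 2)) y) -
        1 / 2 * (ModularForm.eta (verticalPath y z) * shiftPow (-(3 / 2)) y)) y := fun y hy => by
    have h1 : HasDerivAt (fun y : ℝ => verticalPath y z) (Complex.I * z.im) y := by
      simp only [verticalPath_apply]
      simpa using ((Complex.ofRealCLM.hasDerivAt (x := y)).mul_const
        (Complex.I * z.im)).const_add (-(z.re : ℂ))
    have h2 := (hη.differentiableOn.differentiableAt
      (isOpen_im_pos.mem_nhds (hpos y hy))).hasDerivAt.comp y h1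
    have h3 : HasDerivAt (fun y : ℝ => (1 + y) ^ (-(1 / 2) : ℝ))
        (-(1 / 2) * (1 + y) ^ (-(3 / 2) : ℝ)) y := by
      have := ((hasDerivAt_id y).const_add 1).rpow_const (p := (-(1 / 2) : ℝ))
        (Or.inl (by simp only [id]; linarith))
      convert this using 1
      simp only [id]
      norm_num
    refine (h2.mul h3.ofReal_comp).congr_deriv ?_
    simp only [shiftPow, Function.comp_apply]
    push_cast
    ring
  have hlim : Tendsto (fun y => ModularForm.eta (verticalPath y z) * shiftPow (-(1 / 2)) y)
      atTop (𝓝 0) := by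
    obtain ⟨C, c, j, hc, -, hb⟩ := exists_norm_verticalPath_mul_le hη hw1 hz
    have h1 : Tendsto (fun y : ℝ => C * (y ^ j * Real.exp (-(c * z.im) * y))) atTop (𝓝 0) := by
      have := (tendsto_rpow_mul_exp_neg_mul_atTop_nhds_zero j _ (mul_pos hc hz)).const_mul C
      simpa using this
    refine squeeze_zero_norm' ?_ h1
    filter_upwards [eventually_gt_atTop 1] with y hy
    exact hb z le_rfl y hy
  have hint := integral_Ioi_of_hasDerivAt_of_tendsto
    (hder 1 le_rfl).continuousAt.continuousWithinAt (fun y hy => hder y (mem_Ioi.mp hy).le)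
    ((hI1.const_mul (Complex.I * z.im)).sub (hI3.const_mul (1 / 2))) hlim
  rw [integral_sub (hI1.const_mul _) (hI3.const_mul _), integral_const_mul, integral_const_mul] at hint
  have h4 : verticalPath 1 z = -(starRingEnd ℂ) z := by
    rw [verticalPath_apply]
    apply Complex.ext <;> simp
  have h5 : shiftPow (-(1 / 2)) 1 = ((√2 : ℝ) : ℂ)⁻¹ := by
    rw [shiftPow, one_add_one_eq_two, Real.rpow_neg zero_le_two, ← Real.sqrt_eq_rpow]
    push_cast
    rfl
  rw [h4, h5, zero_sub, ← div_eq_mul_inv] at hint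
  rw [verticalIntegral, verticalIntegral]
  linear_combination hint

/-- The eta integral as a function of a complex variable. -/
def etaIntegralExt (z : ℂ) : ℂ :=
  ((z.im ^ (-(1 / 2) : ℝ) : ℝ) : ℂ) * verticalIntegral ModularForm.eta (shiftPow (-(3 / 2))) z

theorem hasFDerivAt_im_rpow (s : ℝ) {z : ℂ} (hz : 0 < z.im) :
    HasFDerivAt (𝕜 := ℝ) (fun z : ℂ => ((z.im ^ s : ℝ) : ℂ))
      (((s * z.im ^ (s - 1) : ℝ) : ℂ) • (Complex.ofRealCLM ∘L Complex.imCLM)) z := by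
  have h := Complex.ofRealCLM.hasFDerivAt.comp z
    ((Complex.imCLM.hasFDerivAt (x := z)).rpow_const (p := s) (Or.inl hz.ne'))
  refine h.congr_fderiv ?_
  ext
  all_goals simp

theorem contDiffOn_etaIntegralExt : ContDiffOn ℝ ∞ etaIntegralExt {z | 0 < z.im} := by
  refine contDiffOn_infty.mpr fun n => ContDiffOn.mul ?_
    (contDiffOn_verticalIntegral n isDecaying_eta (isWeight_rpow (by norm_num)))
  exact Complex.ofRealCLM.contDiff.comp_contDiffOn
    (Complex.imCLM.contDiff.contDiffOn.rpow_const_of_ne fun z hz => (ne_of_gt hz))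

/-- The weights combine through `(1 + y)(1 + y)^(-3/2) = (1 + y)^(-1/2)`. After integration by parts
the remaining integral cancels against the derivative of `v^(-1/2)`, and only the boundary term
survives. -/
theorem etaIntegralExt_dbar {z : ℂ} (hz : 0 < z.im) :
    partialU etaIntegralExt z + Complex.I * partialV etaIntegralExt z =
      -(Complex.I / (√2 : ℝ)) * (((z.im ^ (-(3 / 2) : ℝ) : ℝ) : ℂ) *
        ModularForm.eta (-(starRingEnd ℂ) z)) := by
  have hη := isDecaying_eta
  have hw3 : IsWeight (shiftPow (-(3 / 2))) := isWeight_rpow (by norm_num)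
  have hd := ((hasFDerivAt_im_rpow (-(1 / 2)) hz).mul (hasFDerivAt_verticalIntegral hη hw3 hz)).fderiv
  have hJ : partialU etaIntegralExt z + Complex.I * partialV etaIntegralExt z =
      -((z.im ^ (-(1 / 2) : ℝ) : ℝ) : ℂ) *
        (verticalIntegral (deriv ModularForm.eta) (shiftPow (-(3 / 2))) z +
          verticalIntegral (deriv ModularForm.eta) (fun y => y * shiftPow (-(3 / 2)) y) z) -
        Complex.I / 2 * ((z.im ^ (-(3 / 2) : ℝ) : ℝ) : ℂ) *
          verticalIntegral ModularForm.eta (shiftPow (-(3 / 2))) z := by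
    rw [partialU, partialV, show etaIntegralExt = (fun z : ℂ => ((z.im ^ (-(1 / 2) : ℝ) : ℝ) : ℂ)) *
      verticalIntegral ModularForm.eta (shiftPow (-(3 / 2))) from rfl, hd]
    simp
    norm_num
    linear_combination ((z.im ^ (-(1 / 2) : ℝ) : ℝ) : ℂ) *
      verticalIntegral (deriv ModularForm.eta) (fun y => y * shiftPow (-(3 / 2)) y) z *
        Complex.I_sq
  have hK : verticalIntegral (deriv ModularForm.eta) (shiftPow (-(3 / 2))) z +
      verticalIntegral (deriv ModularForm.eta) (fun y => y * shiftPow (-(3 / 2)) y) z =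
      verticalIntegral (deriv ModularForm.eta) (shiftPow (-(1 / 2))) z := by
    rw [verticalIntegral, verticalIntegral, verticalIntegral, ← integral_add
      (integrableOn_verticalPath_mul hη.deriv hw3 hz)
      (integrableOn_verticalPath_mul hη.deriv hw3.ofReal_mul hz)]
    refine setIntegral_congr_fun measurableSet_Ioi fun y hy => ?_
    have hy0 : 0 < 1 + y := by linarith [mem_Ioi.mp hy]
    have h1 : (1 + y) ^ (-(1 / 2) : ℝ) = (1 + y) * (1 + y) ^ (-(3 / 2) : ℝ) := by
      rw [← Real.rpow_one_add' hy0.le (by norm_num)]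
      norm_num
    simp only [shiftPow, h1]
    push_cast
    ring
  have hv : z.im ^ (-(1 / 2) : ℝ) = z.im * z.im ^ (-(3 / 2) : ℝ) := by
    rw [← Real.rpow_one_add' hz.le (by norm_num)]
    norm_num
  have hP := I_mul_verticalIntegral_deriv_eta hz
  rw [hJ, hK, hv]
  push_cast
  linear_combination (Complex.I * ((z.im ^ (-(3 / 2) : ℝ) : ℝ) : ℂ)) * hP -
    (z.im * ((z.im ^ (-(3 / 2) : ℝ) : ℝ) : ℂ) *
      verticalIntegral (deriv ModularForm.eta) (shiftPow (-(1 / 2))) z) * Complex.I_sq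

end

section

/-! ### Smoothness and harmonicity of the completed rank moment function -/

open Set Filter Topology

/-- The holomorphic part of the completed rank moment function. -/
def holomorphicPart (z : ℂ) : ℂ :=
  1 / 2 * rankMomentSeries 2 (Complex.exp (2 * Real.pi * Complex.I * z)) *
      (Complex.exp (Real.pi * Complex.I * z / 12))⁻¹ - 1 / (24 * ModularForm.eta z) +
    (EisensteinSeries.E2 ∘ ofComplex) z / (8 * ModularForm.eta z)

theorem rankMHat_eq (τ : ℍ) : rankMHat τ =
    holomorphicPart τ - ((√3 / (2 * Real.pi) : ℝ) : ℂ) * etaIntegralExt τ := by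
  rw [rankMHat, rankM, rankPart_div24, eichlerPart_div24, mul24_div24, etaIntegral_eq,
    holomorphicPart, etaIntegralExt, coe_im, Function.comp_apply, ofComplex_apply]
  ring

theorem differentiableOn_rankMomentSeries_two :
    DifferentiableOn ℂ (rankMomentSeries 2) (Metric.ball 0 1) := by
  intro q hq
  rw [mem_ball_zero_iff] at hq
  obtain ⟨r, hr, hr1⟩ := exists_between hq
  have hr0 : 0 ≤ r := (norm_nonneg q).trans hr.le
  have hs := (summable_rankMoment_two (q := (r : ℂ))
    (by rwa [Complex.norm_real, Real.norm_of_nonneg hr0])).norm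
  have h := Complex.differentiableOn_tsum_of_summable_norm
    (F := fun (n : ℕ) (q : ℂ) => (rankMoment 2 n : ℂ) * q ^ n) (U := Metric.ball 0 r) hs
    (fun n => by fun_prop) Metric.isOpen_ball fun n w hw => by
      rw [mem_ball_zero_iff] at hw
      rw [norm_mul, norm_mul, norm_pow, norm_pow, Complex.norm_real, Real.norm_of_nonneg hr0]
      gcongr
  exact (h.differentiableAt (Metric.isOpen_ball.mem_nhds
    (mem_ball_zero_iff.mpr hr))).differentiableWithinAt

theorem differentiableOn_holomorphicPart :
    DifferentiableOn ℂ holomorphicPart {z | 0 < z.im} := by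
  have hη : DifferentiableOn ℂ ModularForm.eta {z | 0 < z.im} := isDecaying_eta.differentiableOn
  have hη0 : ∀ z ∈ {z : ℂ | 0 < z.im}, ModularForm.eta z ≠ 0 := fun z hz =>
    ModularForm.eta_ne_zero hz
  have hE := UpperHalfPlane.mdifferentiable_iff.mp E2_mdifferentiable
  have hR : DifferentiableOn ℂ (fun z => rankMomentSeries 2
      (Complex.exp (2 * Real.pi * Complex.I * z))) {z | 0 < z.im} :=
    differentiableOn_rankMomentSeries_two.comp (by fun_prop) fun z hz => by
      rw [mem_ball_zero_iff]
      exact norm_exp_two_pi_I_mul_lt_one hz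
  refine DifferentiableOn.add (DifferentiableOn.sub ((hR.const_mul _).mul
    (DifferentiableOn.inv (by fun_prop) fun z _ => Complex.exp_ne_zero _))
    (DifferentiableOn.div (differentiableOn_const _) (hη.const_mul _) fun z hz => ?_))
    (hE.div (hη.const_mul _) fun z hz => ?_)
  · exact mul_ne_zero (by norm_num) (hη0 z hz)
  · exact mul_ne_zero (by norm_num) (hη0 z hz)

theorem rankMHat_comp_ofComplex {z : ℂ} (hz : 0 < z.im) : (rankMHat ∘ ofComplex) z =
    holomorphicPart z - ((√3 / (2 * Real.pi) : ℝ) : ℂ) * etaIntegralExt z := by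
  rw [Function.comp_apply, ofComplex_apply_of_im_pos hz, rankMHat_eq]

theorem contDiffOn_rankMHat : ContDiffOn ℝ ∞ (rankMHat ∘ ofComplex) {z : ℂ | 0 < z.im} := by
  refine ContDiffOn.congr ?_ fun z hz => rankMHat_comp_ofComplex hz
  exact ((differentiableOn_holomorphicPart.contDiffOn isOpen_im_pos).restrict_scalars ℝ).sub
    (contDiffOn_const.mul contDiffOn_etaIntegralExt)

theorem partialU_add_I_mul_partialV_eq_zero {G : ℂ → ℂ} {z : ℂ} (h : DifferentiableAt ℂ G z) :
    partialU G z + Complex.I * partialV G z = 0 := by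
  rw [partialU, partialV, h.fderiv_restrictScalars ℝ]
  simp only [ContinuousLinearMap.coe_restrictScalars']
  have h1 : fderiv ℂ G z Complex.I = Complex.I * fderiv ℂ G z 1 := by
    rw [← smul_eq_mul, ← map_smul, smul_eq_mul, mul_one]
  rw [h1]
  linear_combination fderiv ℂ G z 1 * Complex.I_sq

theorem rankMHat_dbar {z : ℂ} (hz : 0 < z.im) :
    partialU (rankMHat ∘ ofComplex) z + Complex.I * partialV (rankMHat ∘ ofComplex) z =
      (((√3 / (2 * Real.pi) : ℝ) : ℂ) * (Complex.I / (√2 : ℝ))) *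
        (((z.im ^ (-(3 / 2) : ℝ) : ℝ) : ℂ) * ModularForm.eta (-(starRingEnd ℂ) z)) := by
  have hh := differentiableOn_holomorphicPart.differentiableAt (isOpen_im_pos.mem_nhds hz)
  have hJ : DifferentiableAt ℝ etaIntegralExt z :=
    (contDiffOn_etaIntegralExt.contDiffAt (isOpen_im_pos.mem_nhds hz)).differentiableAt (by simp)
  have h1 := partialU_add_I_mul_partialV_eq_zero hh
  have h2 := etaIntegralExt_dbar hz
  have heq : (rankMHat ∘ ofComplex) =ᶠ[𝓝 z] fun z =>
      holomorphicPart z - ((√3 / (2 * Real.pi) : ℝ) : ℂ) * etaIntegralExt z := by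
    filter_upwards [isOpen_im_pos.mem_nhds hz] with w hw
    exact rankMHat_comp_ofComplex hw
  have hd := ((hh.restrictScalars ℝ).hasFDerivAt.sub
    (hJ.hasFDerivAt.const_mul ((√3 / (2 * Real.pi) : ℝ) : ℂ))).fderiv
  rw [partialU, partialV] at h1 h2 ⊢
  rw [heq.fderiv_eq]
  erw [hd]
  simp only [sub_apply, smul_apply, smul_eq_mul]
  linear_combination h1 - ((√3 / (2 * Real.pi) : ℝ) : ℂ) * h2

/-- Factorization `∂u² + ∂v² = (∂u - i∂v)(∂u + i∂v)`, by symmetry of second derivatives. -/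
theorem laplacian_eq {G : ℂ → ℂ} {z : ℂ} (h : ContDiffAt ℝ ∞ G z) :
    partialU (partialU G) z + partialV (partialV G) z =
      partialU (fun z => partialU G z + Complex.I * partialV G z) z -
        Complex.I * partialV (fun z => partialU G z + Complex.I * partialV G z) z := by
  have hL : DifferentiableAt ℝ (fderiv ℝ G) z :=
    (h.fderiv_right (m := 1) (by norm_cast)).differentiableAt (by simp)
  have hsymm := (h.isSymmSndFDerivAt (by simpa using WithTop.coe_le_coe.mpr (le_top : (2 : ℕ∞) ≤ ⊤))).eq 1 Complex.I
  have hw : ∀ w : ℂ, HasFDerivAt (fun z => fderiv ℝ G z w)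
      ((ContinuousLinearMap.apply ℝ ℂ w) ∘L fderiv ℝ (fderiv ℝ G) z) z := fun w =>
    (ContinuousLinearMap.apply ℝ ℂ w).hasFDerivAt.comp z hL.hasFDerivAt
  have hW := ((hw 1).add ((hw Complex.I).const_mul Complex.I)).fderiv
  have e1 : partialU G = fun z => fderiv ℝ G z 1 := rfl
  have e2 : partialV G = fun z => fderiv ℝ G z Complex.I := rfl
  rw [e1, e2, partialU, partialV, (hw 1).fderiv, (hw Complex.I).fderiv, partialU, partialV]
  erw [hW]
  simp only [add_apply, smul_apply, smul_eq_mul,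
    ContinuousLinearMap.comp_apply, ContinuousLinearMap.apply_apply]
  rw [hsymm]
  linear_combination fderiv ℝ (fderiv ℝ G) z Complex.I Complex.I * Complex.I_sq

/-- The function `η(-conj z)` is antiholomorphic, hence killed by `∂u - i∂v`; only the power of `v`
is differentiated. -/
theorem antiholomorphic_shadow {z : ℂ} (hz : 0 < z.im) (κ : ℂ) :
    partialU (fun z => κ * (((z.im ^ (-(3 / 2) : ℝ) : ℝ) : ℂ) *
        ModularForm.eta (-(starRingEnd ℂ) z))) z -
      Complex.I * partialV (fun z => κ * (((z.im ^ (-(3 / 2) : ℝ) : ℝ) : ℂ) *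
        ModularForm.eta (-(starRingEnd ℂ) z))) z =
      3 / 2 * Complex.I * (κ * (((z.im ^ (-(5 / 2) : ℝ) : ℝ) : ℂ) *
        ModularForm.eta (-(starRingEnd ℂ) z))) := by
  have hpos : 0 < (-(starRingEnd ℂ) z).im := by simpa using hz
  have hE := ((isDecaying_eta.differentiableOn.differentiableAt
    (isOpen_im_pos.mem_nhds hpos)).hasDerivAt.hasFDerivAt.restrictScalars ℝ).comp z
    (-(Complex.conjCLE : ℂ →L[ℝ] ℂ)).hasFDerivAt
  have hd := (((hasFDerivAt_im_rpow (-(3 / 2)) hz).mul hE).const_mul κ).fderiv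
  rw [partialU, partialV]
  erw [hd]
  simp
  norm_num
  linear_combination (-κ * ((z.im ^ (-(3 / 2) : ℝ) : ℝ) : ℂ) *
    deriv ModularForm.eta (-(starRingEnd ℂ) z)) * Complex.I_sq

/-- The second order part contributes `-v² · (3/2)i v^(-5/2)` and the first order part `(3/2)i v ·
v^(-3/2)`, times a common factor; these cancel. -/
theorem hyperbolicLaplacian_rankMHat (τ : ℍ) : hyperbolicLaplacian (3 / 2) rankMHat τ = 0 := by
  have hz : 0 < (τ : ℂ).im := τ.im_pos
  have heq : (fun z => partialU (rankMHat ∘ ofComplex) z +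
      Complex.I * partialV (rankMHat ∘ ofComplex) z) =ᶠ[𝓝 (τ : ℂ)]
      fun z => (((√3 / (2 * Real.pi) : ℝ) : ℂ) * (Complex.I / (√2 : ℝ))) *
        (((z.im ^ (-(3 / 2) : ℝ) : ℝ) : ℂ) * ModularForm.eta (-(starRingEnd ℂ) z)) := by
    filter_upwards [isOpen_im_pos.mem_nhds hz] with w hw
    exact rankMHat_dbar hw
  have h1 := laplacian_eq (contDiffOn_rankMHat.contDiffAt (isOpen_im_pos.mem_nhds hz))
  have hu : partialU _ (τ : ℂ) = partialU _ (τ : ℂ) :=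
    congrArg (fun L : ℂ →L[ℝ] ℂ => L 1) heq.fderiv_eq
  have hv : partialV _ (τ : ℂ) = partialV _ (τ : ℂ) :=
    congrArg (fun L : ℂ →L[ℝ] ℂ => L Complex.I) heq.fderiv_eq
  rw [hu, hv, antiholomorphic_shadow hz] at h1
  have h3 : τ.im ^ (-(3 / 2) : ℝ) = τ.im * τ.im ^ (-(5 / 2) : ℝ) := by
    rw [← Real.rpow_one_add' τ.im_pos.le (by norm_num)]
    norm_num
  rw [hyperbolicLaplacian, h1, rankMHat_dbar hz, coe_im, h3]
  push_cast
  ring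

end

section

/-! ### Growth at the cusps -/

open Set Filter Topology MeasureTheory

theorem exists_norm_tsum_sub_le {a : ℕ → ℂ} (ha : Summable fun n => a n * (1 / 2 : ℂ) ^ n) :
    ∃ C : ℝ, 0 ≤ C ∧ ∀ q : ℂ, ‖q‖ ≤ 1 / 2 → ‖∑' n, a n * q ^ n - a 0‖ ≤ C * ‖q‖ := by
  have hs : Summable fun n => ‖a (n + 1)‖ * (1 / 2 : ℝ) ^ n := by
    refine (((summable_nat_add_iff 1).mpr ha.norm).mul_left 2).congr fun n => ?_
    rw [norm_mul, norm_pow, pow_succ]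
    norm_num
    ring
  refine ⟨∑' n, ‖a (n + 1)‖ * (1 / 2 : ℝ) ^ n, tsum_nonneg fun n => by positivity, fun q hq => ?_⟩
  have hb : ∀ n, ‖a (n + 1) * q ^ (n + 1)‖ ≤ ‖a (n + 1)‖ * (1 / 2 : ℝ) ^ n * ‖q‖ := fun n => by
    rw [norm_mul, norm_pow, pow_succ, ← mul_assoc]
    gcongr
  have hsum : Summable fun n => a n * q ^ n :=
    (summable_nat_add_iff 1).mp (Summable.of_norm_bounded (hs.mul_right ‖q‖) hb)
  rw [hsum.tsum_eq_zero_add, pow_zero, mul_one, add_sub_cancel_left, ← tsum_mul_right]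
  exact tsum_of_norm_bounded (hs.mul_right ‖q‖).hasSum hb

theorem exists_norm_rankMomentSeries_two_le : ∃ C : ℝ, 0 ≤ C ∧
    ∀ q : ℂ, ‖q‖ ≤ 1 / 2 → ‖rankMomentSeries 2 q‖ ≤ C * ‖q‖ := by
  obtain ⟨C, hC, h⟩ := exists_norm_tsum_sub_le
    (summable_rankMoment_two (q := (1 / 2 : ℂ)) (by norm_num))
  refine ⟨C, hC, fun q hq => ?_⟩
  have h0 : rankMoment 2 0 = 0 := by
    rw [rankMoment_eq_sum]
    refine Finset.sum_eq_zero fun p _ => ?_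
    rw [Subsingleton.elim p (Nat.Partition.indiscrete 0)]
    simp [partitionRank]
  have := h q hq
  rwa [h0, Int.cast_zero, sub_zero] at this

theorem exists_norm_partitionSeries_sub_one_le : ∃ C : ℝ, 0 ≤ C ∧
    ∀ q : ℂ, ‖q‖ ≤ 1 / 2 → ‖partitionSeries q - 1‖ ≤ C * ‖q‖ := by
  obtain ⟨C, hC, h⟩ := exists_norm_tsum_sub_le
    (summable_partitionSeries (q := (1 / 2 : ℂ)) (by norm_num))
  refine ⟨C, hC, fun q hq => ?_⟩
  have h0 : partitionCount 0 = 1 := by simp [partitionCount]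
  have := h q hq
  rwa [h0, Nat.cast_one] at this

theorem exists_norm_E2_sub_one_le : ∃ C : ℝ, 0 ≤ C ∧ ∀ τ : ℍ,
    ‖Complex.exp (2 * Real.pi * Complex.I * τ)‖ ≤ 1 / 2 →
      ‖EisensteinSeries.E2 τ - 1‖ ≤ C * ‖Complex.exp (2 * Real.pi * Complex.I * τ)‖ := by
  have hs : Summable fun n : ℕ =>
      (ArithmeticFunction.sigma 1 n : ℂ) * (1 / 2 : ℂ) ^ n := by
    refine Summable.of_norm_bounded (summable_pow_mul_geometric_of_norm_lt_one 2
      (r := (1 / 2 : ℝ)) (by norm_num)) fun n => ?_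
    rw [norm_mul, norm_pow, Complex.norm_natCast, show ‖(1 / 2 : ℂ)‖ = 1 / 2 by norm_num]
    gcongr
    exact_mod_cast ArithmeticFunction.sigma_le_pow_succ 1 n
  obtain ⟨C, hC, h⟩ := exists_norm_tsum_sub_le hs
  refine ⟨24 * C, by positivity, fun τ hτ => ?_⟩
  have h1 := h _ hτ
  have h2 : ∑' n : ℕ+, (ArithmeticFunction.sigma 1 n : ℂ) *
      Complex.exp (2 * Real.pi * Complex.I * τ) ^ (n : ℕ) = ∑' n : ℕ,
        (ArithmeticFunction.sigma 1 n : ℂ) * Complex.exp (2 * Real.pi * Complex.I * τ) ^ n :=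
    PNat.coe_injective.tsum_eq (f := fun n : ℕ => (ArithmeticFunction.sigma 1 n : ℂ) *
      Complex.exp (2 * Real.pi * Complex.I * τ) ^ n) fun n hn =>
        ⟨⟨n, Nat.pos_of_ne_zero fun h => hn (by simp [h])⟩, rfl⟩
  rw [ArithmeticFunction.map_zero, Nat.cast_zero, sub_zero] at h1
  rw [EisensteinSeries.E2_eq_tsum_cexp, h2, sub_sub_cancel_left, norm_neg, norm_mul, mul_assoc (24 : ℝ) C,
    show ‖(24 : ℂ)‖ = 24 by norm_num]
  exact mul_le_mul_of_nonneg_left h1 (by norm_num : (0 : ℝ) ≤ 24)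

theorem inv_eta (τ : ℍ) : (ModularForm.eta τ)⁻¹ =
    (Complex.exp (Real.pi * Complex.I * τ / 12))⁻¹ *
      partitionSeries (Complex.exp (2 * Real.pi * Complex.I * τ)) := by
  have h := partitionSeries_mul_tprod (norm_exp_two_pi_I_mul_lt_one τ.im_pos)
  rw [eta_eq_mul_tprod, mul_inv, ← eq_inv_of_mul_eq_one_left h]

/-- `R₂` has no constant term, so the leading coefficient is `-1/24 + 1/8 = 1/12`; each summand in
the last bracket is `O(q)`. -/
theorem holomorphicPart_sub (τ : ℍ) : holomorphicPart τ -
    1 / 12 * (Complex.exp (Real.pi * Complex.I * τ / 12))⁻¹ =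
      (Complex.exp (Real.pi * Complex.I * τ / 12))⁻¹ *
        (1 / 2 * rankMomentSeries 2 (Complex.exp (2 * Real.pi * Complex.I * τ)) +
          1 / 12 * (partitionSeries (Complex.exp (2 * Real.pi * Complex.I * τ)) - 1) +
          1 / 8 * ((EisensteinSeries.E2 τ - 1) *
            partitionSeries (Complex.exp (2 * Real.pi * Complex.I * τ)))) := by
  rw [holomorphicPart, Function.comp_apply, ofComplex_apply, div_eq_mul_inv 1 (24 * _), mul_inv,
    div_eq_mul_inv (EisensteinSeries.E2 τ), mul_inv, inv_eta]
  ring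

theorem exists_norm_holomorphicPart_sub_le : ∃ C : ℝ, ∀ τ : ℍ, 1 ≤ τ.im →
    ‖holomorphicPart τ - 1 / 12 * (Complex.exp (Real.pi * Complex.I * τ / 12))⁻¹‖ ≤
      C * Real.exp (-Real.pi * τ.im) := by
  obtain ⟨A, hA, hR⟩ := exists_norm_rankMomentSeries_two_le
  obtain ⟨B, hB, hP⟩ := exists_norm_partitionSeries_sub_one_le
  obtain ⟨D, hD, hE⟩ := exists_norm_E2_sub_one_le
  refine ⟨A + B + D * (B + 1), fun τ hτ => ?_⟩
  set q := Complex.exp (2 * Real.pi * Complex.I * τ) with hq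
  have hnq : ‖q‖ = Real.exp (-(2 * Real.pi * τ.im)) := by
    rw [hq, Complex.norm_exp]
    simp
  have hq2 : ‖q‖ ≤ 1 / 2 := by
    rw [hnq, Real.exp_neg, one_div]
    refine inv_anti₀ two_pos (le_trans ?_ (Real.add_one_le_exp _))
    nlinarith [Real.pi_gt_three]
  have hne : ‖(Complex.exp (Real.pi * Complex.I * τ / 12))⁻¹‖ =
      Real.exp (Real.pi * τ.im / 12) := by
    rw [← Complex.exp_neg, Complex.norm_exp]
    congr 1
    simp
    ring
  have h1 : ‖1 / 2 * rankMomentSeries 2 q + 1 / 12 * (partitionSeries q - 1) +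
      1 / 8 * ((EisensteinSeries.E2 τ - 1) * partitionSeries q)‖ ≤
        (A + B + D * (B + 1)) * ‖q‖ := by
    have hP1 : ‖partitionSeries q‖ ≤ B + 1 := by
      have h2 := norm_add_le (partitionSeries q - 1) 1
      rw [sub_add_cancel, norm_one] at h2
      nlinarith [hP q hq2]
    refine (norm_add₃_le).trans ?_
    rw [norm_mul, norm_mul, norm_mul, norm_mul]
    have e1 : ‖(1 / 2 : ℂ)‖ ≤ 1 := by norm_num
    have e2 : ‖(1 / 12 : ℂ)‖ ≤ 1 := by norm_num
    have e3 : ‖(1 / 8 : ℂ)‖ ≤ 1 := by norm_num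
    calc _ ≤ 1 * (A * ‖q‖) + 1 * (B * ‖q‖) + 1 * ((D * ‖q‖) * (B + 1)) := by
          gcongr
          · exact hR q hq2
          · exact hP q hq2
          · exact hE τ hq2
      _ = _ := by ring
  rw [holomorphicPart_sub, norm_mul, hne]
  calc _ ≤ Real.exp (Real.pi * τ.im / 12) * ((A + B + D * (B + 1)) * ‖q‖) := by gcongr
    _ = (A + B + D * (B + 1)) * Real.exp (Real.pi * τ.im / 12 + -(2 * Real.pi * τ.im)) := by
        rw [hnq, Real.exp_add]
        ring
    _ ≤ _ := by
        gcongr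
        nlinarith [mul_pos Real.pi_pos τ.im_pos]

theorem exists_norm_etaIntegralExt_le : ∃ C c : ℝ, 0 < c ∧ ∀ τ : ℍ, 1 ≤ τ.im →
    ‖etaIntegralExt τ‖ ≤ C * Real.exp (-c * τ.im) := by
  obtain ⟨C, c, j, hc, hC, hb⟩ := exists_norm_verticalPath_mul_le isDecaying_eta
    (g := shiftPow (-(3 / 2))) (isWeight_rpow (by norm_num)) one_pos
  have hc2 := half_pos hc
  refine ⟨C * ∫ y in Ioi (1 : ℝ), y ^ j * Real.exp (-(c / 2) * y), c / 2, hc2, fun τ hτ => ?_⟩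
  have h1 : ‖verticalIntegral ModularForm.eta (shiftPow (-(3 / 2))) τ‖ ≤
      ∫ y in Ioi (1 : ℝ), C * Real.exp (-(c / 2) * τ.im) *
        (y ^ j * Real.exp (-(c / 2) * y)) := by
    refine norm_integral_le_of_norm_le ((integrableOn_pow_mul_exp j hc2).const_mul _) ?_
    filter_upwards [ae_restrict_mem measurableSet_Ioi] with y hy
    have hy1 := mem_Ioi.mp hy
    refine (hb τ hτ y hy).trans ?_
    rw [mul_assoc, mul_left_comm (Real.exp _), ← Real.exp_add]
    gcongr
    rw [coe_im]
    -- For `v, y ≥ 1`, adding `vy ≥ v + y - 1` and `vy ≥ 1` gives `vy ≥ (v + y)/2`, which separates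
    -- the decay in `v` from the integrability in `y`.
    nlinarith [mul_nonneg hc.le (mul_nonneg (sub_nonneg.mpr hτ) (sub_nonneg.mpr hy1.le)),
      mul_le_mul_of_nonneg_left (one_le_mul_of_one_le_of_one_le hτ hy1.le) hc.le]
  have h2 : ‖((((τ : ℂ).im ^ (-(1 / 2) : ℝ) : ℝ)) : ℂ)‖ ≤ 1 := by
    rw [coe_im, Complex.norm_real, Real.norm_of_nonneg (Real.rpow_nonneg τ.im_pos.le _)]
    exact Real.rpow_le_one_of_one_le_of_nonpos hτ (by norm_num)
  rw [integral_const_mul] at h1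
  rw [etaIntegralExt, norm_mul]
  calc _ ≤ 1 * _ := mul_le_mul h2 h1 (norm_nonneg _) zero_le_one
    _ = _ := by ring

theorem rankMHat_sub_isBigO : ∃ ε : ℝ, 0 < ε ∧ (fun τ : ℍ => rankMHat τ -
    1 / 12 * (Complex.exp (Real.pi * Complex.I * τ / 12))⁻¹) =O[atImInfty]
      fun τ : ℍ => Real.exp (-ε * τ.im) := by
  obtain ⟨C, h⟩ := exists_norm_holomorphicPart_sub_le
  obtain ⟨C', c, hc, h'⟩ := exists_norm_etaIntegralExt_le
  have hev : ∀ᶠ τ : ℍ in atImInfty, 1 ≤ τ.im :=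
    tendsto_comap.eventually (eventually_ge_atTop (1 : ℝ))
  have hexp : ∀ b : ℝ, min Real.pi c ≤ b → (fun τ : ℍ => Real.exp (-b * τ.im)) =O[atImInfty]
      fun τ : ℍ => Real.exp (-min Real.pi c * τ.im) := fun b hb =>
    Asymptotics.IsBigO.of_norm_le fun τ => by
      rw [Real.norm_of_nonneg (Real.exp_nonneg _)]
      have := τ.im_pos
      gcongr
  refine ⟨min Real.pi c, lt_min Real.pi_pos hc, ?_⟩
  have h1 : (fun τ : ℍ => holomorphicPart τ -
      1 / 12 * (Complex.exp (Real.pi * Complex.I * τ / 12))⁻¹) =O[atImInfty]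
        fun τ : ℍ => Real.exp (-min Real.pi c * τ.im) := by
    refine (Asymptotics.IsBigO.of_bound C ?_).trans (hexp _ (min_le_left _ _))
    filter_upwards [hev] with τ hτ
    rw [Real.norm_of_nonneg (Real.exp_nonneg _)]
    exact h τ hτ
  have h2 : (fun τ : ℍ => etaIntegralExt τ) =O[atImInfty]
      fun τ : ℍ => Real.exp (-min Real.pi c * τ.im) := by
    refine (Asymptotics.IsBigO.of_bound C' ?_).trans (hexp _ (min_le_right _ _))
    filter_upwards [hev] with τ hτ
    rw [Real.norm_of_nonneg (Real.exp_nonneg _)]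
    exact h' τ hτ
  refine (h1.sub (h2.const_mul_left ((√3 / (2 * Real.pi) : ℝ) : ℂ))).congr_left fun τ => ?_
  rw [rankMHat_eq]
  ring

/-- The transformation law reduces every `γ` to the cusp `∞`, up to the constant `ψ(γ)⁻¹`. The
principal part is a multiple of `q^(-1/24)`, hence `N = 24` and a linear `P`. -/
theorem rankMHat_growth (γ : SL(2, ℤ)) : ∃ (N : ℕ) (P : Polynomial ℂ) (ε : ℝ), 0 < N ∧ 0 < ε ∧
    (fun τ : ℍ => autFactor γ τ ^ (-(3 / 2 : ℝ) : ℂ) * rankMHat (γ • τ) -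
        P.eval (Complex.exp (-(2 * Real.pi * Complex.I * τ / N))))
      =O[atImInfty] fun τ : ℍ => Real.exp (-ε * τ.im) := by
  obtain ⟨ε, hε, h⟩ := rankMHat_sub_isBigO
  refine ⟨24, Polynomial.C ((etaMultiplier γ)⁻¹ / 12) * Polynomial.X, ε, by norm_num, hε,
    (h.const_mul_left (etaMultiplier γ)⁻¹).congr_left fun τ => ?_⟩
  have h0 := autFactor_ne_zero γ τ
  have h1 : autFactor γ τ ^ (-(3 / 2 : ℝ) : ℂ) * autFactor γ τ ^ (3 / 2 : ℂ) = 1 := by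
    rw [← Complex.cpow_add _ _ h0]
    push_cast
    norm_num
  have h2 : Complex.exp (-(2 * Real.pi * Complex.I * τ / (24 : ℕ))) =
      (Complex.exp (Real.pi * Complex.I * τ / 12))⁻¹ := by
    rw [← Complex.exp_neg]
    congr 1
    push_cast
    ring
  rw [rankMHat_smul, Polynomial.eval_C_mul, Polynomial.eval_X, h2]
  linear_combination (-(etaMultiplier γ)⁻¹ * rankMHat τ) * h1

end

end RankForms

end

theorem corollary1p2 :
    RankForms.IsHarmonicMaassForm (3 / 2) ⊤ (fun γ => (RankForms.etaMultiplier γ)⁻¹)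
        RankForms.rankMHat ∧
      ∀ (γ : SL(2, ℤ)) (τ : ℍ),
        RankForms.rankMHat (γ • τ) =
          (RankForms.etaMultiplier γ)⁻¹ * ((γ 1 0 : ℂ) * (τ : ℂ) + (γ 1 1 : ℂ)) ^ (3 / 2 : ℂ) *
            RankForms.rankMHat τ := by
  -- The weight is `3/2`, and the full group is a congruence subgroup as it contains `Γ(1)`.
  refine ⟨⟨⟨3, by norm_num⟩, ⟨1, one_ne_zero, le_top⟩,
    RankForms.contDiffOn_rankMHat, fun γ _ τ => ?_, RankForms.hyperbolicLaplacian_rankMHat,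
    RankForms.rankMHat_growth⟩, RankForms.rankMHat_smul⟩
  rw [RankForms.rankMHat_smul]
  push_cast
  rfl
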